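/- Work over $\mathbb{C}$. Let $\mathcal{S}$ be the linear system of sextic surfaces of $\mathbb{P}^3_{[t_0:\dots:t_3]}$ that are double along the six edges $\{t_i=t_j=0\}$ of the coordinate tetrahedron. The fourteen monomials $w_0=t_0t_1^3t_2t_3$, $w_1=t_0^2t_1^2t_2^2$, $w_2=t_0^2t_1^2t_2t_3$, $w_3=t_0^2t_1^2t_3^2$, $w_4=t_0^3t_1t_2t_3$, $w_5=t_0t_1^2t_2^2t_3$, $w_6=t_0t_1^2t_2t_3^2$, $w_7=t_0^2t_1t_2^2t_3$, $w_8=t_0^2t_1t_2t_3^2$, $w_9=t_1^2t_2^2t_3^2$, $w_{10}=t_0t_1t_2^3t_3$, $w_{11}=t_0t_1t_2^2t_3^2$, $w_{12}=t_0t_1t_2t_3^3$, $w_{13}=t_0^2t_2^2t_3^2$ form a basis of $\mathcal{S}$. Let $W_F^{13}\subset\mathbb{P}^{13}$ be the closure of the image of the rational map $\nu:\mathbb{P}^3\dashrightarrow\mathbb{P}^{13}$ that they define. Let $\Sigma=\{\sum_{k=0}^{13}a_kw_k=0\}$ be a member of $\mathcal{S}$ with $a_0a_1a_3a_4\neq 0$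 and $(a_2^2-4a_0a_4-4a_1a_3)^2\neq 64\,a_0a_1a_3a_4$; these conditions hold for general $\Sigma\in\mathcal{S}$. Let $F_{23}$ be the exceptional divisor over the edge $\{t_2=t_3=0\}$ in the blow-up of $\mathbb{P}^3$ at the vertices and then along the strict transforms of the edges of the tetrahedron. Let $E_3\subset W_F^{13}$ be the (closure of the) image, under the rational map induced by $\nu$ on this blow-up, of the intersection of $F_{23}$ with the strict transform of $\Sigma$. Then $E_3$ is an elliptic quartic curve (nonsingular, irreducible, of degree $4$ and genus $1$). Its span $\langle E_3\rangle$ is the $\mathbb{P}^3$ given by $a_0w_0+a_1w_1+a_2w_2+a_3w_3+a_4w_4=0$, $w_5=\dots=w_{13}=0$, and $W_F^{13}\cap\langle E_3\rangle=E_3$. Let $W_{KLM}^9\subset\mathbb{P}^9_{[z_0:\dots:z_9]}$ be the closure of the image of $W_F^{13}$ under the projection from $\langle E_3\rangle$, $$[w_0:\dots:w_{13}]\mapsto[a_0w_0+a_1w_1+a_2w_2+a_3w_3+a_4w_4:w_5:w_6:\dots:w_{13}].$$ Then the following hold. 1. $W_{KLM}^9$ is an irreducible threefold whose homogeneous ideal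 is generated by quadrics and cubics. 2. $W_{KLM}^9$ has exactly five singular points, namely the coordinate points $P_1=\{z_k=0\mid k\neq5\}$, $P_2=\{z_k=0\mid k\neq9\}$, $P_3=\{z_k=0\mid k\neq6\}$, $P_4=\{z_k=0\mid k\neq8\}$, $P_5=\{z_k=0\mid k\neq0\}$. 3. For $i=1,2,3,4$ the point $P_i$ is a quadruple point, and the tangent cone $TC_{P_i}W_{KLM}^9\subset\mathbb{P}^9$ is, as a scheme, the (reduced) cone with vertex $P_i$ over a Veronese surface in a $\mathbb{P}^5\subset\mathbb{P}^9$ not containing $P_i$. 4. $P_5$ is a sextuple point, and the tangent cone $TC_{P_5}W_{KLM}^9\subset\mathbb{P}^9$ is, as a scheme, the (reduced) cone with vertex $P_5$ over a reducible surface $M_6$ of degree $6$ in a $\mathbb{P}^7\subset\mathbb{P}^9$ not containing $P_5$. The surface $M_6$ is the union of four planes $\pi_1,\pi_2,\pi_1',\pi_2'$ and a nonsingular quadric surface $Q\subset\mathbb{P}^3\subset\mathbb{P}^7$. The planes $\pi_1,\pi_2,\pi_1',\pi_2'$ meet $Q$ respectively along lines $l_1,l_2,l_1',l_2'$, where $l_i$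 is disjoint from $l_i'$ for $i=1,2$, and the intersections $l_1\cap l_2$, $l_1\cap l_2'$, $l_1'\cap l_2$, $l_1'\cap l_2'$ are four distinct points. Here the tangent cone at $P$ is defined by the ideal generated by the homogeneous parts of minimal degree of the equations of the threefold in affine coordinates centred at $P$, and the multiplicity of $P$ is the degree of the tangent cone. -/

import Mathlib

open MvPolynomial

noncomputable section

namespace EnriquesFano

/-! ### Projective geometry over the complex numbers -/

/-- Complex projective `n`-space. -/
abbrev PSpace (n : ℕ) : Type := Projectivization ℂ (Fin (n + 1) → ℂ)

/-- The homogeneous coordinate ring of `PSpace n`. -/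
abbrev CoordRing (n : ℕ) : Type := MvPolynomial (Fin (n + 1)) ℂ

variable {n : ℕ}

/-- `v` is a vector of homogeneous coordinates of the point `p`. -/
def Represents (v : Fin (n + 1) → ℂ) (p : PSpace n) : Prop :=
  ∃ h : v ≠ 0, Projectivization.mk ℂ v h = p

/-- The coordinate point, all of whose homogeneous coordinates but the `j`-th vanish. -/
def coordPoint (j : Fin (n + 1)) : PSpace n :=
  Projectivization.mk ℂ (Pi.single j 1) (by simp)

/-- The affine cone over a subset of projective space. -/
def affineCone (X : Set (PSpace n)) : Set (Fin (n + 1) → ℂ) :=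
  {v | ∃ p ∈ X, v ∈ p.submodule}

/-- The homogeneous ideal `I(X)` of a subset `X` of projective space. -/
def homIdeal (X : Set (PSpace n)) : Ideal (CoordRing n) :=
  vanishingIdeal ℂ (affineCone X)

/-- The Zariski closure of a subset of projective space. -/
def zariskiClosure (X : Set (PSpace n)) : Set (PSpace n) :=
  {p | ∀ f ∈ homIdeal X, eval p.rep f = 0}

/-- The linear subspace of projective space attached to a vector subspace. -/
def linearSubspace (L : Submodule ℂ (Fin (n + 1) → ℂ)) : Set (PSpace n) :=
  {p | p.submodule ≤ L}

/-- `X` is a linear subspace of projective dimension `k` (a line if `k = 1`, a plane if `k = 2`). -/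
def IsLinear (k : ℕ) (X : Set (PSpace n)) : Prop :=
  ∃ L : Submodule ℂ (Fin (n + 1) → ℂ), Module.finrank ℂ L = k + 1 ∧ X = linearSubspace L

/-- The cone with vertex `p` over `Y`: the union of the lines joining `p` to the points of `Y`
(it is used for `Y` in a linear subspace that does not contain `p`). -/
def coneOver (p : PSpace n) (Y : Set (PSpace n)) : Set (PSpace n) :=
  {x | ∃ y ∈ Y, x.submodule ≤ p.submodule ⊔ y.submodule}

/-- The (projectively) `d`-dimensional irreducible varieties: the homogeneous ideal is prime, and
the homogeneous coordinate ring, which is that of the affine cone, has transcendence degree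
`d + 1` over `ℂ`. -/
def IsVarietyOfDim (X : Set (PSpace n)) (d : ℕ) : Prop :=
  zariskiClosure X = X ∧ (homIdeal X).IsPrime ∧
    Algebra.trdeg ℂ (CoordRing n ⧸ homIdeal X) = d + 1

/-- The embedded Zariski tangent space to `X` at `p`, as a vector subspace of `ℂ ^ (n + 1)`. -/
def tangentSpace (X : Set (PSpace n)) (p : PSpace n) : Submodule ℂ (Fin (n + 1) → ℂ) where
  carrier := {v | ∀ f ∈ homIdeal X, ∑ i, eval p.rep (pderiv i f) * v i = 0}
  add_mem' := by
    intro v w hv hw f hf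
    have h1 := hv f hf
    have h2 := hw f hf
    simp only [Pi.add_apply, mul_add, Finset.sum_add_distrib, h1, h2, add_zero]
  zero_mem' := by
    intro f _
    simp
  smul_mem' := by
    intro c v hv f hf
    have h1 := hv f hf
    have h2 : ∀ i, eval p.rep (pderiv i f) * (c • v) i
        = c * (eval p.rep (pderiv i f) * v i) := by
      intro i
      simp only [Pi.smul_apply, smul_eq_mul]
      ring
    simp only [h2, ← Finset.mul_sum, h1, mul_zero]

/-- The set of singular points of an irreducible variety of dimension `d`: the points where the
embedded tangent space has projective dimension larger than `d`. -/
def singularLocus (X : Set (PSpace n)) (d : ℕ) : Set (PSpace n) :=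
  {p | p ∈ X ∧ d + 1 < Module.finrank ℂ (tangentSpace X p)}

/-- The Hilbert function of the graded ring `CoordRing n ⧸ J`, for a homogeneous ideal `J`. -/
def hilbertFunction (J : Ideal (CoordRing n)) (k : ℕ) : ℕ :=
  Module.finrank ℂ
    ((homogeneousSubmodule (Fin (n + 1)) ℂ k).map (Ideal.Quotient.mkₐ ℂ J).toLinearMap)

/-- `P` is the Hilbert polynomial of the homogeneous ideal `J`. -/
def HasHilbertPolynomial (J : Ideal (CoordRing n)) (P : Polynomial ℚ) : Prop :=
  ∀ᶠ k : ℕ in Filter.atTop, (hilbertFunction J k : ℚ) = P.eval (k : ℚ)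

/-- The projective scheme defined by the homogeneous ideal `J` has dimension `d` and degree `e`:
the leading term of its Hilbert polynomial is `(e / d!) x ^ d`. -/
def HasDimDegree (J : Ideal (CoordRing n)) (d e : ℕ) : Prop :=
  ∃ P : Polynomial ℚ, HasHilbertPolynomial J P ∧ P.natDegree = d ∧
    P.leadingCoeff * (Nat.factorial d : ℚ) = e

/-- The polynomial `f (v + x)` in `x`. -/
def translate (v : Fin (n + 1) → ℂ) : CoordRing n →ₐ[ℂ] CoordRing n :=
  aeval fun i => X i + C (v i)

/-- The homogeneous ideal of the projective tangent cone `TC_p X`, as a closed subscheme of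
projective space. It is generated by the homogeneous parts of minimal degree of the polynomials
`f (v + x)`, for `f` in the ideal of `X` and `v` a coordinate vector of `p`. (This is the ideal of
the tangent cone at `v` to the affine cone over `X`, i.e. of the affine cone over `TC_p X`. Where
`v` is the `j`-th coordinate vector, it is generated by the minimal degree homogeneous parts of
the equations of `X` in the affine chart `x_j ≠ 0`, whose origin is `p`.) -/
def tangentConeIdeal (X : Set (PSpace n)) (p : PSpace n) : Ideal (CoordRing n) :=
  Ideal.span {g | ∃ f ∈ homIdeal X, ∃ m : ℕ,
    (∀ k < m, homogeneousComponent k (translate p.rep f) = 0) ∧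
      g = homogeneousComponent m (translate p.rep f)}

/-- `p` is a point of multiplicity `e` of the `d`-dimensional variety `X`: its tangent cone has
dimension `d` and degree `e`. -/
def HasMultiplicity (X : Set (PSpace n)) (d : ℕ) (p : PSpace n) (e : ℕ) : Prop :=
  p ∈ X ∧ HasDimDegree (tangentConeIdeal X p) d e

/-- Elliptic quartic curves: nonsingular irreducible curves of degree `4` and genus `1`, i.e. with
Hilbert polynomial `4 x + (1 - 1)`. -/
def IsEllipticQuartic (E : Set (PSpace n)) : Prop :=
  IsVarietyOfDim E 1 ∧ singularLocus E 1 = ∅ ∧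
    HasHilbertPolynomial (homIdeal E) (4 * Polynomial.X)

/-- The quadratic monomials in three variables. -/
def veroneseVector (x : Fin 3 → ℂ) : Fin 6 → ℂ :=
  ![x 0 ^ 2, x 0 * x 1, x 0 * x 2, x 1 ^ 2, x 1 * x 2, x 2 ^ 2]

/-- `V` is a Veronese surface in the five-dimensional linear subspace given by `L`: the image of
the projective plane under all conics, in some linear coordinates of `L`. -/
def IsVeroneseSurface (L : Submodule ℂ (Fin (n + 1) → ℂ)) (V : Set (PSpace n)) : Prop :=
  ∃ φ : (Fin 6 → ℂ) →ₗ[ℂ] (Fin (n + 1) → ℂ), Function.Injective φ ∧ LinearMap.range φ = L ∧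
    V = {p | ∃ x : Fin 3 → ℂ, Represents (φ (veroneseVector x)) p}

/-- `Q` is a nonsingular quadric surface in the three-dimensional linear subspace given by `L`. -/
def IsQuadricSurface (L : Submodule ℂ (Fin (n + 1) → ℂ)) (Q : Set (PSpace n)) : Prop :=
  Module.finrank ℂ L = 4 ∧ ∃ q : QuadraticForm ℂ L, q.Nondegenerate ∧
    Q = {p | p ∈ linearSubspace L ∧ ∀ v : L, (v : Fin (n + 1) → ℂ) ∈ p.submodule → q v = 0}

/-! ### The Fano threefold of genus 13 -/

/-- The linear system of the sextic surfaces of `PSpace 3` which are double along the six edges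
`t_i = t_j = 0` of the coordinate tetrahedron. -/
def sexticSystem : Submodule ℂ (CoordRing 3) :=
  homogeneousSubmodule (Fin 4) ℂ 6 ⊓
    ⨅ (i : Fin 4) (j : Fin 4) (_ : i < j),
      ((Ideal.span {X i, X j} : Ideal (CoordRing 3)) ^ 2).restrictScalars ℂ

/-- The monomials in the linear system of sextics. -/
def sextic : Fin 14 → CoordRing 3 :=
  ![X 0 * X 1 ^ 3 * X 2 * X 3, X 0 ^ 2 * X 1 ^ 2 * X 2 ^ 2, X 0 ^ 2 * X 1 ^ 2 * X 2 * X 3,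
    X 0 ^ 2 * X 1 ^ 2 * X 3 ^ 2, X 0 ^ 3 * X 1 * X 2 * X 3, X 0 * X 1 ^ 2 * X 2 ^ 2 * X 3,
    X 0 * X 1 ^ 2 * X 2 * X 3 ^ 2, X 0 ^ 2 * X 1 * X 2 ^ 2 * X 3, X 0 ^ 2 * X 1 * X 2 * X 3 ^ 2,
    X 1 ^ 2 * X 2 ^ 2 * X 3 ^ 2, X 0 * X 1 * X 2 ^ 3 * X 3, X 0 * X 1 * X 2 ^ 2 * X 3 ^ 2,
    X 0 * X 1 * X 2 * X 3 ^ 3, X 0 ^ 2 * X 2 ^ 2 * X 3 ^ 2]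

/-- The Fano threefold of genus 13: the image of the rational map given by the sextics. -/
def fano13 : Set (PSpace 13) :=
  zariskiClosure {p | ∃ t : Fin 4 → ℂ, Represents (fun k => eval t (sextic k)) p}

/-! ### The Knutsen-Lopez-Muñoz threefold of genus 9 -/

/-- The coefficient of `ε ^ 2` in `F (t_0, t_1, ε t_2, ε t_3)`: the restriction of a sextic that is
double along the edge `t_2 = t_3 = 0` to the exceptional divisor over that edge, whose points (away
from the vertices) are given by a point `(t_0 : t_1)` of the edge and a normal direction
`(t_2 : t_3)`. -/
def alongEdge (F : CoordRing 3) (t : Fin 4 → ℂ) : ℂ :=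
  (aeval ![Polynomial.C (t 0), Polynomial.C (t 1), Polynomial.X * Polynomial.C (t 2),
    Polynomial.X * Polynomial.C (t 3)] F : Polynomial ℂ).coeff 2

/-- The curve `E_3` in the Fano threefold attached to the sextic `Σ = ∑ a_k w_k`: the image of the
intersection of the strict transform of `Σ` with the exceptional divisor over the edge
`t_2 = t_3 = 0`. -/
def curveE3 (a : Fin 14 → ℂ) : Set (PSpace 13) :=
  zariskiClosure {p | ∃ t : Fin 4 → ℂ, t 0 ≠ 0 ∧ t 1 ≠ 0 ∧ (t 2 ≠ 0 ∨ t 3 ≠ 0) ∧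
    alongEdge (∑ k, C (a k) * sextic k) t = 0 ∧ Represents (fun k => alongEdge (sextic k) t) p}

/-- The linear map `(w_0, …, w_13) ↦ (a_0 w_0 + a_1 w_1 + a_2 w_2 + a_3 w_3 + a_4 w_4, w_5, …, w_13)`
which induces the projection from the span of `E_3`. -/
def projectionMap (a : Fin 14 → ℂ) : (Fin 14 → ℂ) →ₗ[ℂ] (Fin 10 → ℂ) :=
  LinearMap.pi
    ![a 0 • LinearMap.proj 0 + a 1 • LinearMap.proj 1 + a 2 • LinearMap.proj 2
        + a 3 • LinearMap.proj 3 + a 4 • LinearMap.proj 4,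
      LinearMap.proj 5, LinearMap.proj 6, LinearMap.proj 7, LinearMap.proj 8, LinearMap.proj 9,
      LinearMap.proj 10, LinearMap.proj 11, LinearMap.proj 12, LinearMap.proj 13]

/-- The KLM threefold of genus 9: the closure of the image of the Fano threefold of genus 13 under
the projection. -/
def klm9 (a : Fin 14 → ℂ) : Set (PSpace 9) :=
  zariskiClosure {p | ∃ w : PSpace 13, w ∈ fano13 ∧ Represents (projectionMap a w.rep) p}

end EnriquesFano

end

open MvPolynomial

noncomputable section

namespace EnriquesFano

variable {n : ℕ}

/-! ### Homogeneous ideals, closures and coordinate points -/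

section

/-! The threefold is almost toric. On the torus every sextic is t₀t₁t₂t₃ times a Laurent monomial,
and in terms of α = t₁/t₀, β = t₂/t₃ and two scales P, μ (proportional to t₀t₃ and t₂t₃) the
projected point has coordinates z₁, …, z₄ = P(αβ, α, β, 1), z₅, …, z₉ = μ(α, β, 1, 1/β, 1/α) and z₀
= (P²/μ)·G(α, β), where G = a₀α²β + a₁αβ² + a₂αβ + a₃α + a₄β (`klmPoint`). Only z₀ fails to be a
monomial. The conditions on a enter twice: the four vertices of the Newton polygon of G carry a₀,
a₁, a₃, a₄, which do not vanish, and the discriminant condition makes the curve G = 0 nonsingular.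

All ideals are computed by one method. A finite list of known equations, each with a distinguished
monomial, rewrites every monomial into standard ones of the same degree; a weight that drops at each
step gives termination (`exists_normalForm`). If moreover no nonzero combination of standard
monomials lies in the ideal, then the known equations generate it (`le_of_normalForm`), and its
Hilbert function counts standard monomials (`hilbertFunction_eq_card`). For the threefold the
equations are twelve quadrics and four cubics, and independence (`eq_zero_of_klmHom_eq_zero`) is an
extremal argument at the vertices of the Newton polygon of G.

With these generators the singular locus is a Jacobian computation. A point with z₇ ≠ 0 is regular.
If z₇ = 0, the symmetries α ↦ 1/α and α ↔ β reduce matters to z₉ ≠ 0, or to z₄ ≠ 0 with z₅, …, z₉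
zero; in the last case the point lies on a cone over the curve G = 0, where the discriminant
condition is used.

A tangent cone is squeezed from two sides. The initial forms of the generators give equations of the
expected cone. Conversely every initial form vanishes on the tangent directions of arcs in the
threefold (`eval_eq_zero_of_arc`), and explicit arcs sweep out a dense part of each component of the
expected cone. Normal forms modulo the known equations then give equality of ideals, hence
reducedness, and counting gives the multiplicities 4 and 6.

The curve E₃ is cut out in its span by w₀w₄ = w₂² and w₁w₃ = w₂². Putting w₁ = p², w₂ = pq, w₃ = q²,
w₄ = w and eliminating w₀ leaves a single equation, monic of degree two in w up to the factor a₄. It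
is prime because its discriminant is not a square (`not_isSquare_discriminant`), and the standard
monomials, of degree at most one in w₄, number 4k in degree k ≥ 1. -/

theorem mem_homIdeal_iff {X : Set (PSpace n)} {f : CoordRing n} :
    f ∈ homIdeal X ↔ ∀ p ∈ X, ∀ v ∈ p.submodule, eval v f = 0 := by
  simp only [homIdeal, mem_vanishingIdeal_iff, affineCone, Set.mem_ofPred_eq, aeval_eq_eval]
  exact ⟨fun h p hp v hv => h v ⟨p, hp, hv⟩, fun h v ⟨p, hp, hv⟩ => h p hp v hv⟩

theorem mem_submodule_iff {p : PSpace n} {v : Fin (n + 1) → ℂ} :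
    v ∈ p.submodule ↔ ∃ c : ℂ, c • p.rep = v := by
  rw [Projectivization.submodule_eq, Submodule.mem_span_singleton]

theorem rep_mem_submodule (p : PSpace n) : p.rep ∈ p.submodule :=
  mem_submodule_iff.2 ⟨1, one_smul _ _⟩

theorem Represents.submodule_eq {v : Fin (n + 1) → ℂ} {p : PSpace n} (h : Represents v p) :
    p.submodule = Submodule.span ℂ {v} := by
  obtain ⟨h0, rfl⟩ := h
  exact Projectivization.submodule_mk v h0

theorem Represents.mem {v : Fin (n + 1) → ℂ} {p : PSpace n} (h : Represents v p) :
    v ∈ p.submodule := by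
  rw [h.submodule_eq]; exact Submodule.mem_span_singleton_self v

theorem Represents.mem_iff {v w : Fin (n + 1) → ℂ} {p : PSpace n} (h : Represents v p) :
    w ∈ p.submodule ↔ ∃ c : ℂ, c • v = w := by
  rw [h.submodule_eq, Submodule.mem_span_singleton]

theorem represents_rep (p : PSpace n) : Represents p.rep p :=
  ⟨p.rep_nonzero, p.mk_rep⟩

theorem represents_mk {v : Fin (n + 1) → ℂ} (h : v ≠ 0) :
    Represents v (Projectivization.mk ℂ v h) := ⟨h, rfl⟩

theorem mem_homIdeal_setOf_represents {ι : Type*} {C : ι → Prop} {v : ι → Fin (n + 1) → ℂ}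
    {f : CoordRing n} : f ∈ homIdeal {p | ∃ i, C i ∧ Represents (v i) p} ↔
      ∀ i, C i → v i ≠ 0 → ∀ c : ℂ, eval (c • v i) f = 0 := by
  rw [mem_homIdeal_iff]
  constructor
  · intro h i hi h0 c
    exact h _ ⟨i, hi, represents_mk h0⟩ _ ((represents_mk h0).mem_iff.2 ⟨c, rfl⟩)
  · rintro h p ⟨i, hi, hp⟩ w hw
    obtain ⟨c, rfl⟩ := hp.mem_iff.1 hw
    exact h i hi hp.1 c

/-- Rescaling the variables. -/
def rescale (c : ℂ) : CoordRing n →ₐ[ℂ] CoordRing n := aeval fun i => C c * X i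

theorem eval_rescale (c : ℂ) (v : Fin (n + 1) → ℂ) (f : CoordRing n) :
    eval v (rescale c f) = eval (c • v) f := by
  have : ((aeval v : CoordRing n →ₐ[ℂ] ℂ).comp (rescale c)) = aeval (c • v) := by
    ext i; simp [rescale]
  simpa [aeval_eq_eval] using DFunLike.congr_fun this f

theorem rescale_mem_homIdeal {X : Set (PSpace n)} {f : CoordRing n} (hf : f ∈ homIdeal X) (c : ℂ) :
    rescale c f ∈ homIdeal X := by
  rw [mem_homIdeal_iff] at hf ⊢
  intro p hp v hv
  rw [eval_rescale]
  exact hf p hp _ (Submodule.smul_mem _ _ hv)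

theorem mem_zariskiClosure_iff {X : Set (PSpace n)} {p : PSpace n} :
    p ∈ zariskiClosure X ↔ ∀ f ∈ homIdeal X, ∀ v ∈ p.submodule, eval v f = 0 := by
  constructor
  · intro h f hf v hv
    obtain ⟨c, rfl⟩ := mem_submodule_iff.1 hv
    rw [← eval_rescale]
    exact h _ (rescale_mem_homIdeal hf c)
  · intro h f hf
    exact h f hf _ (rep_mem_submodule p)

theorem subset_zariskiClosure (X : Set (PSpace n)) : X ⊆ zariskiClosure X := fun p hp =>
  mem_zariskiClosure_iff.2 fun _ hf v hv => mem_homIdeal_iff.1 hf p hp v hv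

theorem homIdeal_zariskiClosure (X : Set (PSpace n)) :
    homIdeal (zariskiClosure X) = homIdeal X := by
  refine le_antisymm ?_ ?_
  · intro f hf
    rw [mem_homIdeal_iff] at hf ⊢
    exact fun p hp => hf p (subset_zariskiClosure X hp)
  · intro f hf
    rw [mem_homIdeal_iff]
    exact fun p hp v hv => mem_zariskiClosure_iff.1 hp f hf v hv

theorem zariskiClosure_idem (X : Set (PSpace n)) :
    zariskiClosure (zariskiClosure X) = zariskiClosure X := by
  ext p
  simp only [zariskiClosure, Set.mem_ofPred_eq]
  have := homIdeal_zariskiClosure X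
  rw [zariskiClosure] at this
  rw [this]

theorem mem_zariskiClosure_of_represents {X : Set (PSpace n)} {p : PSpace n}
    {v : Fin (n + 1) → ℂ} (hv : Represents v p) (h : ∀ f ∈ homIdeal X, eval v f = 0) :
    p ∈ zariskiClosure X := by
  rw [mem_zariskiClosure_iff]
  intro f hf w hw
  obtain ⟨c, rfl⟩ := hv.mem_iff.1 hw
  rw [← eval_rescale]
  exact h _ (rescale_mem_homIdeal hf c)

theorem mem_linearSubspace_of_represents {p : PSpace n} {v : Fin (n + 1) → ℂ}
    (hv : Represents v p) {L : Submodule ℂ (Fin (n + 1) → ℂ)} :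
    p ∈ linearSubspace L ↔ v ∈ L := by
  rw [linearSubspace, Set.mem_ofPred_eq, hv.submodule_eq, Submodule.span_singleton_le_iff_mem]

theorem represents_coordPoint (j : Fin (n + 1)) : Represents (Pi.single j 1) (coordPoint j) :=
  ⟨by simp, rfl⟩

theorem coordPoint_rep (j : Fin (n + 1)) :
    ∃ c : ℂ, c ≠ 0 ∧ (coordPoint j).rep = Pi.single j c := by
  obtain ⟨c, hc⟩ := (represents_coordPoint j).mem_iff.1 (rep_mem_submodule (coordPoint j))
  refine ⟨c, ?_, ?_⟩
  · rintro rfl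
    exact (coordPoint j).rep_nonzero (by rw [← hc, zero_smul])
  · rw [← hc]
    ext i
    by_cases h : i = j
    · subst h; simp
    · simp [h]

theorem eq_coordPoint_of_represents {p : PSpace n} {v : Fin (n + 1) → ℂ} (hv : Represents v p)
    {j : Fin (n + 1)} (h : ∀ i, i ≠ j → v i = 0) : p = coordPoint j := by
  obtain ⟨h0, rfl⟩ := hv
  refine (Projectivization.mk_eq_mk_iff' ℂ _ _ _ _).2 ⟨v j, ?_⟩
  ext i
  by_cases hi : i = j
  · subst hi; simp
  · simp [hi, h i hi]

theorem eval_translate (v x : Fin (n + 1) → ℂ) (f : CoordRing n) :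
    eval x (translate v f) = eval (v + x) f := by
  have : ((aeval x : CoordRing n →ₐ[ℂ] ℂ).comp (translate v)) = aeval (v + x) := by
    ext i; simp [translate, add_comm]
  simpa [aeval_eq_eval] using DFunLike.congr_fun this f

/-! ### Arcs and tangent cones -/

theorem aeval_mul_of_isHomogeneous {A : Type*} [CommRing A] [Algebra ℂ A] {F : CoordRing n}
    {k : ℕ} (hF : F.IsHomogeneous k) (a : A) (w : Fin (n + 1) → A) :
    aeval (fun i => a * w i) F = a ^ k * aeval w F := by
  rw [aeval_def, aeval_def, eval₂_eq', eval₂_eq', Finset.mul_sum]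
  refine Finset.sum_congr rfl fun d hd => ?_
  have hk : ∑ i, d i = k := by
    have := hF (mem_support_iff.1 hd)
    rw [← this, Finsupp.weight_apply, Finsupp.sum_fintype _ _ (by simp)]
    simp
  simp only [mul_pow, Finset.prod_mul_distrib, Finset.prod_pow_eq_pow_sum, hk]
  ring

theorem eval_smul_of_isHomogeneous {F : CoordRing n} {k : ℕ} (hF : F.IsHomogeneous k) (c : ℂ)
    (v : Fin (n + 1) → ℂ) : eval (c • v) F = c ^ k * eval v F := by
  exact (aeval_mul_of_isHomogeneous hF c v :)

/-- Along the arc e ↦ e(u + e r(e)) the component of degree k contributes e^k times a polynomial in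
e, so the coefficient of e^m in the vanishing restriction is the m-th component at u. -/
theorem homogeneousComponent_eval_eq_zero_of_arc {F : CoordRing n} {m : ℕ}
    (hm : ∀ k < m, homogeneousComponent k F = 0) {u : Fin (n + 1) → ℂ}
    (r : Fin (n + 1) → Polynomial ℂ)
    (h : ∀ e : ℂ, e ≠ 0 → eval (fun i => e * (u i + e * (r i).eval e)) F = 0) :
    eval u (homogeneousComponent m F) = 0 := by
  set w : Fin (n + 1) → Polynomial ℂ :=
    fun i => Polynomial.C (u i) + Polynomial.X * r i with hw
  have key : ∀ (e : ℂ) (w : Fin (n + 1) → Polynomial ℂ) (F : CoordRing n),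
      (aeval w F).eval e = eval (fun i => (w i).eval e) F := by
    intro e w F
    have : ((Polynomial.aeval e).comp (aeval w : CoordRing n →ₐ[ℂ] Polynomial ℂ))
        = aeval (fun i => (w i).eval e) := by
      ext i; simp [← Polynomial.eval₂_id]
    simpa [aeval_eq_eval, Polynomial.aeval_def, Polynomial.eval₂_id] using DFunLike.congr_fun this F
  have h0 : aeval (fun i => Polynomial.X * w i) F = 0 := by
    refine Polynomial.eq_zero_of_infinite_isRoot _ ?_
    refine Set.Infinite.mono (s := {0}ᶜ) ?_ (Set.finite_singleton _).infinite_compl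
    intro e he
    have := h e he
    simp only [Set.mem_ofPred_eq, Polynomial.IsRoot.def, key]
    simpa [hw] using this
  have hdeg : ∀ k, aeval (fun i => Polynomial.X * w i) (homogeneousComponent k F)
      = Polynomial.X ^ k * aeval w (homogeneousComponent k F) := fun k =>
    aeval_mul_of_isHomogeneous (homogeneousComponent_isHomogeneous k F) _ _
  have hsum : ∀ N, m ≤ N → Polynomial.X ^ (m + 1) ∣
      ∑ k ∈ Finset.range (N + 1), aeval (fun i => Polynomial.X * w i) (homogeneousComponent k F)
        - Polynomial.X ^ m * aeval w (homogeneousComponent m F) := by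
    intro N hN
    rw [← Finset.sum_erase_add _ _ (Finset.mem_range.2 (Nat.lt_succ_of_le hN)), hdeg m,
      add_sub_cancel_right]
    -- Components below degree m are zero by hypothesis; those above are divisible by X^(m+1).
    refine Finset.dvd_sum fun k hk => ?_
    rw [Finset.mem_erase] at hk
    rcases lt_or_gt_of_ne hk.1 with hkm | hkm
    · rw [hm k hkm]; simp
    · rw [hdeg k]
      exact Dvd.dvd.mul_right (pow_dvd_pow _ hkm) _
  have hF : ∑ k ∈ Finset.range (max F.totalDegree m + 1),
      aeval (fun i => Polynomial.X * w i) (homogeneousComponent k F) = 0 := by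
    rw [← h0]
    conv_rhs => rw [← sum_homogeneousComponent F]
    rw [map_sum]
    symm
    refine Finset.sum_subset (Finset.range_mono (by simp)) fun k _ hk => ?_
    rw [Finset.mem_range, not_lt] at hk
    rw [homogeneousComponent_eq_zero _ _ (by omega), map_zero]
  have := hsum _ (le_max_right F.totalDegree m)
  rw [hF, zero_sub, dvd_neg, pow_succ, mul_dvd_mul_iff_left
    (pow_ne_zero _ Polynomial.X_ne_zero), Polynomial.X_dvd_iff,
    Polynomial.coeff_zero_eq_eval_zero, key] at this
  simpa [hw] using this

/-- The initial forms at `p` vanish along the tangent directions of the arcs through `p`. -/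
theorem eval_eq_zero_of_arc {X : Set (PSpace n)} {p : PSpace n} {v u : Fin (n + 1) → ℂ}
    (hv : Represents v p) (r : Fin (n + 1) → Polynomial ℂ)
    (h : ∀ e : ℂ, e ≠ 0 → (fun i => v i + e * (u i + e * (r i).eval e)) ∈ affineCone X)
    {g : CoordRing n} (hg : g ∈ tangentConeIdeal X p) (y : ℂ) : eval (u + y • v) g = 0 := by
  obtain ⟨c, hc⟩ := hv.mem_iff.1 (rep_mem_submodule p)
  have hc0 : c ≠ 0 := by
    rintro rfl
    exact p.rep_nonzero (by rw [← hc, zero_smul])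
  suffices tangentConeIdeal X p ≤ RingHom.ker (eval (u + y • v)) from this hg
  refine Ideal.span_le.2 ?_
  rintro _ ⟨f, hf, m, hm, rfl⟩
  have h1 : eval (c • (u + y • v)) (homogeneousComponent m (translate p.rep f)) = 0 := by
    -- The cone is stable under scaling, so the arc may be multiplied by c(1 + ye). It then starts
    -- at cv, the chosen representative, and leaves it in the direction c(u + yv).
    refine homogeneousComponent_eval_eq_zero_of_arc hm
      (fun i => Polynomial.C c * (r i + Polynomial.C y *
        (Polynomial.C (u i) + Polynomial.X * r i))) fun e he => ?_
    rw [eval_translate, ← hc]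
    have h2 : eval ((c * (1 + y * e)) • fun i => v i + e * (u i + e * (r i).eval e)) f = 0 := by
      obtain ⟨q, hq, hq'⟩ := h e he
      exact mem_homIdeal_iff.1 hf q hq _ (Submodule.smul_mem _ _ hq')
    rw [← h2]
    congr 2
    ext i
    simp
    ring
  rw [eval_smul_of_isHomogeneous (homogeneousComponent_isHomogeneous m _)] at h1
  exact (mul_eq_zero.1 h1).resolve_left (pow_ne_zero _ hc0)

theorem mem_tangentConeIdeal {X : Set (PSpace n)} {p : PSpace n} {f G H : CoordRing n}
    {m m' : ℕ} (hf : f ∈ homIdeal X) (h : translate p.rep f = G + H) (hG : G.IsHomogeneous m)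
    (hH : H.IsHomogeneous m') (hm : m < m') : G ∈ tangentConeIdeal X p := by
  have hG' := fun k => homogeneousComponent_of_mem (m := k) hG
  have hH' := fun k => homogeneousComponent_of_mem (m := k) hH
  refine Ideal.subset_span ⟨f, hf, m, fun k hk => ?_, ?_⟩
  · rw [h, map_add, hG', hH', if_neg hk.ne, if_neg (hk.trans hm).ne, add_zero]
  · rw [h, map_add, hG', hH', if_pos rfl, if_neg hm.ne, add_zero]

/-! ### Spans of monomials and normal forms -/

variable {σ : Type*}

/-- Rewriting with termination but without any confluence: a monomial outside B has a divisor s that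
is congruent to a combination of monomials of the same degree and smaller weight. Induction on the
weight of the whole monomial applies because weight and degree are additive. -/
theorem exists_normalForm (J : Ideal (MvPolynomial σ ℂ)) (w : σ → ℕ) (B : Set (σ →₀ ℕ))
    (rule : ∀ d ∉ B, ∃ s ≤ d, ∃ r ∈ restrictSupport ℂ {e : σ →₀ ℕ | e.degree = s.degree ∧
      Finsupp.weight w e < Finsupp.weight w s}, monomial s 1 - r ∈ J) (d : σ →₀ ℕ) :
    ∃ g ∈ restrictSupport ℂ {e | e ∈ B ∧ e.degree = d.degree}, monomial d 1 - g ∈ J := by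
  induction hN : Finsupp.weight w d using Nat.strong_induction_on generalizing d with
  | _ N ih =>
  subst hN
  by_cases hd : d ∈ B
  · exact ⟨monomial d 1, (monomial_mem_restrictSupport ℂ).2 (Or.inl ⟨hd, rfl⟩), by simp⟩
  obtain ⟨s, hs, r, hr, hJ⟩ := rule d hd
  obtain ⟨t, rfl⟩ := exists_add_of_le hs
  have key : ∀ e ∈ r.support, ∃ g ∈ restrictSupport ℂ {e | e ∈ B ∧ e.degree = (s + t).degree},
      monomial (e + t) 1 - g ∈ J := by
    intro e he
    obtain ⟨h1, h2⟩ := hr he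
    have := ih (Finsupp.weight w (e + t)) (by simp only [map_add]; omega) (e + t) rfl
    rwa [map_add, h1, ← map_add] at this
  choose! g hg hgJ using key
  refine ⟨∑ e ∈ r.support, coeff e r • g e, Submodule.sum_mem _ fun e he =>
    Submodule.smul_mem _ _ (hg e he), ?_⟩
  have h1 : (monomial (s + t) 1 : MvPolynomial σ ℂ) - ∑ e ∈ r.support, coeff e r • g e
      = (monomial s 1 - r) * monomial t 1
        + ∑ e ∈ r.support, coeff e r • (monomial (e + t) 1 - g e) := by
    have h2 : r * monomial t 1 = ∑ e ∈ r.support, coeff e r • monomial (e + t) (1 : ℂ) := by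
      conv_lhs => rw [r.as_sum, Finset.sum_mul]
      refine Finset.sum_congr rfl fun e _ => ?_
      rw [monomial_mul, smul_monomial, smul_eq_mul]
    simp only [smul_sub, Finset.sum_sub_distrib, ← h2, sub_mul, monomial_mul, mul_one]
    ring
  rw [h1]
  refine J.add_mem (J.mul_mem_right _ hJ) (J.sum_mem fun e he => ?_)
  rw [smul_eq_C_mul]
  exact J.mul_mem_left _ (hgJ e he)

theorem exists_normalForm' {J : Ideal (MvPolynomial σ ℂ)} {B : Set (σ →₀ ℕ)}
    (h : ∀ d : σ →₀ ℕ, ∃ g ∈ restrictSupport ℂ {e | e ∈ B ∧ e.degree = d.degree},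
      monomial d 1 - g ∈ J) (f : MvPolynomial σ ℂ) : ∃ g ∈ restrictSupport ℂ B, f - g ∈ J := by
  choose g hg hJ using h
  refine ⟨∑ e ∈ f.support, coeff e f • g e, Submodule.sum_mem _ fun e _ =>
    Submodule.smul_mem _ _ (restrictSupport_mono _ (fun e he => he.1) (hg e)), ?_⟩
  have : f - ∑ e ∈ f.support, coeff e f • g e
      = ∑ e ∈ f.support, coeff e f • (monomial e 1 - g e) := by
    simp only [smul_sub, Finset.sum_sub_distrib, smul_monomial, smul_eq_mul, mul_one]
    rw [← f.as_sum]
  rw [this]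
  refine J.sum_mem fun e _ => ?_
  rw [smul_eq_C_mul]
  exact J.mul_mem_left _ (hJ e)

/-- An ideal which is reduced to the standard monomials by rules taken from a smaller ideal
coincides with it. -/
theorem le_of_normalForm {I J : Ideal (MvPolynomial σ ℂ)} {B : Set (σ →₀ ℕ)} (hJI : J ≤ I)
    (h : ∀ d : σ →₀ ℕ, ∃ g ∈ restrictSupport ℂ {e | e ∈ B ∧ e.degree = d.degree},
      monomial d 1 - g ∈ J) (hI : ∀ g ∈ restrictSupport ℂ B, g ∈ I → g = 0) : I ≤ J := by
  intro f hf
  obtain ⟨g, hg, hfg⟩ := exists_normalForm' h f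
  have : g = 0 := hI g hg (by simpa using I.sub_mem hf (hJI hfg))
  simpa [this] using hfg

/-- The standard monomials of degree k span the degree k part of the quotient by the normal forms,
and they are independent there by the second hypothesis; `E` merely enumerates them. -/
theorem hilbertFunction_eq_card {T : Type*} [Fintype T] {J : Ideal (CoordRing n)}
    {B : Set (Fin (n + 1) →₀ ℕ)} {k : ℕ}
    (h : ∀ d : Fin (n + 1) →₀ ℕ, ∃ g ∈ restrictSupport ℂ {e | e ∈ B ∧ e.degree = d.degree},
      monomial d 1 - g ∈ J) (hJ : ∀ g ∈ restrictSupport ℂ B, g ∈ J → g = 0)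
    (E : T → (Fin (n + 1) →₀ ℕ)) (hE : Function.Injective E)
    (hB : Set.range E = {e | e ∈ B ∧ e.degree = k}) :
    hilbertFunction J k = Fintype.card T := by
  have hmap : (homogeneousSubmodule (Fin (n + 1)) ℂ k).map (Ideal.Quotient.mkₐ ℂ J).toLinearMap
      = (restrictSupport ℂ {e | e ∈ B ∧ e.degree = k}).map
        (Ideal.Quotient.mkₐ ℂ J).toLinearMap := by
    refine le_antisymm ?_ (Submodule.map_mono ?_)
    · rw [show homogeneousSubmodule (Fin (n + 1)) ℂ k
        = restrictSupport ℂ {d : Fin (n + 1) →₀ ℕ | d.degree = k} from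
          homogeneousSubmodule_eq_finsupp_supported _ _ k, restrictSupport_eq_span,
        Submodule.map_span_le]
      rintro _ ⟨d, rfl, rfl⟩
      obtain ⟨g, hg, hgJ⟩ := h d
      exact ⟨g, hg, ((Ideal.Quotient.mk_eq_mk_iff_sub_mem _ _).2 hgJ).symm⟩
    · rw [show homogeneousSubmodule (Fin (n + 1)) ℂ k
        = restrictSupport ℂ {d : Fin (n + 1) →₀ ℕ | d.degree = k} from
          homogeneousSubmodule_eq_finsupp_supported _ _ k]
      exact restrictSupport_mono _ fun e he => he.2
  have hinj : Function.Injective ((Ideal.Quotient.mkₐ ℂ J).toLinearMap.domRestrict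
      (restrictSupport ℂ {e | e ∈ B ∧ e.degree = k})) := by
    rw [← LinearMap.ker_eq_bot, LinearMap.ker_eq_bot']
    rintro ⟨g, hg⟩ hg0
    exact Subtype.ext (hJ g (restrictSupport_mono _ (fun e he => he.1) hg)
      (Ideal.Quotient.eq_zero_iff_mem.1 hg0))
  rw [hilbertFunction, hmap, ← LinearMap.range_domRestrict, LinearMap.finrank_range_of_inj hinj,
    Module.finrank_eq_nat_card_basis (basisRestrictSupport ℂ _), ← hB,
    Nat.card_range_of_injective hE, Nat.card_eq_fintype_card]

/-- A ring homomorphism which maps monomials to multiples of monomials or to zero detects the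
coefficients. -/
theorem coeff_eq_zero_of_monomialMap {τ : Type*} {B : Set (σ →₀ ℕ)}
    {ρ : MvPolynomial σ ℂ →ₐ[ℂ] MvPolynomial τ ℂ} {A : Set (σ →₀ ℕ)} (E : (σ →₀ ℕ) → (τ →₀ ℕ))
    (u : (σ →₀ ℕ) → ℂ) (hu : ∀ d ∈ A, u d ≠ 0)
    (hA : ∀ d ∈ A, ρ (monomial d 1) = monomial (E d) (u d))
    (hA' : ∀ d ∈ B, d ∉ A → ρ (monomial d 1) = 0)
    (hE : Set.InjOn E (A ∩ B)) {g : MvPolynomial σ ℂ} (hg : g ∈ restrictSupport ℂ B)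
    (h0 : ρ g = 0) {d : σ →₀ ℕ} (hd : d ∈ A) : coeff d g = 0 := by
  classical
  by_contra hne
  have hdg : d ∈ g.support := mem_support_iff.2 hne
  have h1 : coeff (E d) (ρ g) = coeff d g * u d := by
    conv_lhs => rw [g.as_sum, map_sum, coeff_sum]
    rw [Finset.sum_eq_single d]
    · rw [← mul_one (coeff d g), ← smul_eq_mul, ← smul_monomial, map_smul, hA d hd, coeff_smul,
        coeff_monomial, if_pos rfl, smul_eq_mul, smul_eq_mul, mul_one]
    · intro e he hed
      rw [← mul_one (coeff e g), ← smul_eq_mul, ← smul_monomial, map_smul, coeff_smul]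
      by_cases heA : e ∈ A
      · rw [hA e heA, coeff_monomial, if_neg, smul_zero]
        exact fun h => hed (hE ⟨heA, hg he⟩ ⟨hd, hg hdg⟩ h)
      · rw [hA' e (hg he) heA, coeff_zero, smul_zero]
    · exact fun h => absurd hdg h
  rw [h0, coeff_zero] at h1
  exact mul_ne_zero hne (hu d hd) h1.symm

end

section

/-! ### The linear system of sextics -/

/-- The exponents of the monomials in the linear system of sextics. -/
def sexticTable : Fin 14 → Fin 4 → ℕ :=
  ![![1, 3, 1, 1], ![2, 2, 2, 0], ![2, 2, 1, 1], ![2, 2, 0, 2], ![3, 1, 1, 1], ![1, 2, 2, 1],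
    ![1, 2, 1, 2], ![2, 1, 2, 1], ![2, 1, 1, 2], ![0, 2, 2, 2], ![1, 1, 3, 1], ![1, 1, 2, 2],
    ![1, 1, 1, 3], ![2, 0, 2, 2]]

/-- The exponents of the monomials in the linear system of sextics, as finitely supported
functions. -/
def sexticExp (k : Fin 14) : Fin 4 →₀ ℕ := Finsupp.equivFunOnFinite.symm (sexticTable k)

theorem sextic_eq_prod (k : Fin 14) : sextic k = X 0 ^ sexticTable k 0 * X 1 ^ sexticTable k 1 *
    X 2 ^ sexticTable k 2 * X 3 ^ sexticTable k 3 := by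
  fin_cases k <;> simp [sextic, sexticTable]

theorem sextic_eq_monomial (k : Fin 14) : sextic k = monomial (sexticExp k) 1 := by
  rw [monomial_eq, Finsupp.prod_fintype _ _ (by simp), Fin.prod_univ_four, sextic_eq_prod]
  simp [sexticExp]

theorem sexticExp_injective : Function.Injective sexticExp :=
  Finsupp.equivFunOnFinite.symm.injective.comp (by decide)

theorem linearIndependent_sextic : LinearIndependent ℂ sextic := by
  have : sextic = basisMonomials (Fin 4) ℂ ∘ sexticExp := by
    ext1 k; rw [sextic_eq_monomial]; simp
  rw [this]
  exact (basisMonomials (Fin 4) ℂ).linearIndependent.comp _ sexticExp_injective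

theorem monomial_mem_span_pair_sq {i j : Fin 4} (hij : i ≠ j) {d : Fin 4 →₀ ℕ}
    (h : 2 ≤ d i + d j) :
    (monomial d 1 : CoordRing 3) ∈ (Ideal.span {X i, X j} : Ideal (CoordRing 3)) ^ 2 := by
  have hmem : ∀ (p q : Fin 4), p ∈ ({i, j} : Set (Fin 4)) → q ∈ ({i, j} : Set (Fin 4)) →
      Finsupp.single p 1 + Finsupp.single q 1 ≤ d →
      (monomial d 1 : CoordRing 3) ∈ (Ideal.span {X i, X j} : Ideal (CoordRing 3)) ^ 2 := by
    intro p q hp hq hle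
    obtain ⟨t, rfl⟩ := exists_add_of_le hle
    have hX : ∀ p ∈ ({i, j} : Set (Fin 4)),
        (X p : CoordRing 3) ∈ (Ideal.span {X i, X j} : Ideal (CoordRing 3)) := by
      rintro p (rfl | rfl)
      · exact Ideal.subset_span (by simp)
      · exact Ideal.subset_span (by simp)
    have : (monomial (Finsupp.single p 1 + Finsupp.single q 1 + t) 1 : CoordRing 3)
        = X p * X q * monomial t 1 := by
      simp [X, monomial_mul]
    rw [this, sq]
    exact Ideal.mul_mem_right _ _ (Ideal.mul_mem_mul (hX p hp) (hX q hq))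
  have hle : ∀ p q : Fin 4, (∀ r, (Pi.single p 1 + Pi.single q 1 : Fin 4 → ℕ) r ≤ d r) →
      Finsupp.single p 1 + Finsupp.single q 1 ≤ d := fun p q h r => by
    simpa [Finsupp.single_eq_pi_single] using h r
  by_cases hi : 2 ≤ d i
  · refine hmem i i (by simp) (by simp) (hle _ _ fun r => ?_)
    by_cases hr : r = i
    · subst hr; simpa using hi
    · simp [hr]
  by_cases hj : 2 ≤ d j
  · refine hmem j j (by simp) (by simp) (hle _ _ fun r => ?_)
    by_cases hr : r = j
    · subst hr; simpa using hj
    · simp [hr]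
  refine hmem i j (by simp) (by simp) (hle _ _ fun r => ?_)
  by_cases hr : r = i
  · subst hr; simp [hij]; omega
  · by_cases hr' : r = j
    · subst hr'; simp [hr]; omega
    · simp [hr, hr']

/-- The polynomials all of whose exponents satisfy the inequality form an ideal, since the
inequality is inherited by multiples; it is enough to look at the products of two generators. -/
theorem two_le_of_mem_span_pair_sq {i j : Fin 4} (hij : i ≠ j) {f : CoordRing 3}
    (hf : f ∈ (Ideal.span {X i, X j} : Ideal (CoordRing 3)) ^ 2) {d : Fin 4 →₀ ℕ}
    (hd : d ∈ f.support) : 2 ≤ d i + d j := by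
  have hup : IsUpperSet {d : Fin 4 →₀ ℕ | 2 ≤ d i + d j} := fun a b hab ha =>
    le_trans ha (add_le_add (hab i) (hab j))
  suffices (Ideal.span {X i, X j} : Ideal (CoordRing 3)) ^ 2 ≤ restrictSupportIdeal ℂ _ hup from
    this hf hd
  rw [sq, Ideal.span_mul_span', Ideal.span_le]
  rintro _ ⟨x, hx, y, hy, rfl⟩
  have : ∀ p q : Fin 4, p ∈ ({i, j} : Set (Fin 4)) → q ∈ ({i, j} : Set (Fin 4)) →
      (X p * X q : CoordRing 3) ∈ restrictSupport ℂ {d : Fin 4 →₀ ℕ | 2 ≤ d i + d j} := by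
    intro p q hp hq
    rw [X, X, monomial_mul, monomial_mem_restrictSupport]
    left
    rcases hp with rfl | rfl <;> rcases hq with rfl | rfl <;> simp [hij, hij.symm]
  rcases hx with rfl | rfl <;> rcases hy with rfl | rfl <;> exact this _ _ (by simp) (by simp)

theorem span_sextic : Submodule.span ℂ (Set.range sextic) = sexticSystem := by
  have hspan : Submodule.span ℂ (Set.range sextic) = restrictSupport ℂ (Set.range sexticExp) := by
    rw [restrictSupport_eq_span, ← Set.range_comp]
    congr 2
    ext1 k
    exact sextic_eq_monomial k
  have hdec : ∀ k : Fin 14, ∑ i, sexticTable k i = 6 ∧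
      ∀ i j : Fin 4, i < j → 2 ≤ sexticTable k i + sexticTable k j := by decide
  apply le_antisymm
  · rw [Submodule.span_le]
    rintro _ ⟨k, rfl⟩
    rw [sextic_eq_monomial]
    refine ⟨?_, ?_⟩
    · refine isHomogeneous_monomial _ ?_
      rw [Finsupp.degree_eq_sum]
      exact (hdec k).1
    · simp only [SetLike.mem_coe, Submodule.mem_iInf]
      intro i j hij
      exact monomial_mem_span_pair_sq hij.ne ((hdec k).2 i j hij)
  · rw [hspan]
    rintro f ⟨h6, hf⟩ d hd
    simp only [SetLike.mem_coe, Submodule.mem_iInf] at hf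
    have hp : ∀ i j : Fin 4, i < j → 2 ≤ d i + d j := fun i j hij =>
      two_le_of_mem_span_pair_sq hij.ne (hf i j hij) hd
    have hs : d 0 + d 1 + d 2 + d 3 = 6 := by
      have := h6 (mem_support_iff.1 hd)
      rw [Finsupp.weight_apply, Finsupp.sum_fintype _ _ (by simp)] at this
      simpa [Fin.sum_univ_four] using this
    have h01 := hp 0 1 (by decide)
    have h02 := hp 0 2 (by decide)
    have h03 := hp 0 3 (by decide)
    have h12 := hp 1 2 (by decide)
    have h13 := hp 1 3 (by decide)
    have h23 := hp 2 3 (by decide)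
    -- The conditions on the three pairs of other variables make the sum of the other exponents at
    -- least 3. Hence every exponent is at most 3 and a finite check over `Fin 4` remains.
    have h0 : d 0 ≤ 3 := by omega
    have h1 : d 1 ≤ 3 := by omega
    have h2 : d 2 ≤ 3 := by omega
    have h3 : d 3 ≤ 3 := by omega
    have hall : ∀ x y z w : Fin 4, x.1 + y.1 + z.1 + w.1 = 6 ∧ 2 ≤ x.1 + y.1 ∧ 2 ≤ x.1 + z.1 ∧
        2 ≤ x.1 + w.1 ∧ 2 ≤ y.1 + z.1 ∧ 2 ≤ y.1 + w.1 ∧ 2 ≤ z.1 + w.1 →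
        ∃ k, sexticTable k = ![x.1, y.1, z.1, w.1] := by decide
    obtain ⟨k, hk⟩ := hall ⟨d 0, by omega⟩ ⟨d 1, by omega⟩ ⟨d 2, by omega⟩ ⟨d 3, by omega⟩
      ⟨hs, h01, h02, h03, h12, h13, h23⟩
    refine ⟨k, Finsupp.ext fun i => ?_⟩
    rw [sexticExp, Finsupp.equivFunOnFinite_symm_apply_apply, hk]
    fin_cases i <;> rfl

end

section

/-! ### Parametrizations -/

theorem eval_aeval_eq {σ τ : Type*} (w : σ → MvPolynomial τ ℂ) (x : τ → ℂ)
    (f : MvPolynomial σ ℂ) : eval x (aeval w f) = eval (fun i => eval x (w i)) f := by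
  have : ((aeval x : MvPolynomial τ ℂ →ₐ[ℂ] ℂ).comp (aeval w))
      = aeval (fun i => eval x (w i)) := by
    ext i; simp [aeval_eq_eval]
  simpa [aeval_eq_eval] using DFunLike.congr_fun this f

/-- Multiplying by the product of the variables turns vanishing on the torus into vanishing
everywhere. -/
theorem eq_zero_of_eval_torus {m : ℕ} {f : MvPolynomial (Fin m) ℂ}
    (h : ∀ x : Fin m → ℂ, (∀ i, x i ≠ 0) → eval x f = 0) : f = 0 := by
  have h1 : f * ∏ i, X i = 0 := by
    refine MvPolynomial.funext fun x => ?_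
    rw [map_mul, map_zero]
    by_cases hx : ∀ i, x i ≠ 0
    · rw [h x hx, zero_mul]
    · push Not at hx
      obtain ⟨i, hi⟩ := hx
      rw [map_prod, Finset.prod_eq_zero (Finset.mem_univ i) (by simpa using hi), mul_zero]
  exact (mul_eq_zero.1 h1).resolve_right (Finset.prod_ne_zero_iff.2 fun i _ => X_ne_zero i)

theorem mem_homIdeal_fano13_iff {f : CoordRing 13} : f ∈ homIdeal fano13 ↔
    ∀ t : Fin 4 → ℂ, ∀ c : ℂ, (fun k => eval t (sextic k)) ≠ 0 →
      eval (c • fun k => eval t (sextic k)) f = 0 := by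
  have := mem_homIdeal_setOf_represents (C := fun _ : Fin 4 → ℂ => True)
    (v := fun t k => eval t (sextic k)) (f := f)
  simp only [true_and, true_imp_iff] at this
  rw [fano13, homIdeal_zariskiClosure, this]
  exact ⟨fun h t c h0 => h t h0 c, fun h t h0 c => h t c h0⟩

/-- The scale c is treated as a fifth variable, so that vanishing for nonzero t and c becomes a
polynomial identity, valid also on the coordinate planes. -/
theorem mem_homIdeal_fano13_of_torus {f : CoordRing 13}
    (h : ∀ t : Fin 4 → ℂ, ∀ c : ℂ, (∀ i, t i ≠ 0) → c ≠ 0 →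
      eval (c • fun k => eval t (sextic k)) f = 0) : f ∈ homIdeal fano13 := by
  have key : ∀ x : Fin 5 → ℂ, eval x (aeval (fun k => X (Fin.last 4) *
      rename Fin.castSucc (sextic k)) f : MvPolynomial (Fin 5) ℂ) =
        eval (x (Fin.last 4) • fun k => eval (x ∘ Fin.castSucc) (sextic k)) f := fun x => by
    rw [eval_aeval_eq]
    congr 2
    ext k
    simp [eval_rename]
  have h0 : (aeval (fun k => X (Fin.last 4) * rename Fin.castSucc (sextic k)) f :
      MvPolynomial (Fin 5) ℂ) = 0 :=
    eq_zero_of_eval_torus fun x hx => by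
      rw [key]
      exact h _ _ (fun i => hx _) (hx _)
  refine mem_homIdeal_fano13_iff.2 fun t c _ => ?_
  have := key (Fin.snoc (α := fun _ => ℂ) t c)
  rw [h0, map_zero] at this
  rw [this]
  congr 2
  ext k
  rw [Fin.snoc_last]
  simp [Function.comp_def]

theorem mk_mem_fano13 {t : Fin 4 → ℂ} (h : (fun k => eval t (sextic k)) ≠ 0) :
    Projectivization.mk ℂ _ h ∈ fano13 :=
  subset_zariskiClosure _ ⟨t, h, rfl⟩

/-- Continuity in c adds the vertex of the cone, at which nothing is assumed. -/
theorem eval_smul_eq_zero {f : CoordRing n} {v : Fin (n + 1) → ℂ}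
    (h : ∀ c : ℂ, c ≠ 0 → eval (c • v) f = 0) (c : ℂ) : eval (c • v) f = 0 := by
  have hc : Continuous fun c : ℂ => eval (c • v) f :=
    (MvPolynomial.continuous_eval f).comp (by fun_prop)
  exact congrFun (hc.ext_on (dense_compl_singleton (0 : ℂ)) continuous_const
    (fun c hc => h c hc)) c

/-- The parametrization of the affine cone over the threefold of genus 9 by a torus. -/
def klmPoint (a : Fin 14 → ℂ) (P μ α β : ℂ) : Fin 10 → ℂ :=
  ![P ^ 2 / μ * (a 0 * α ^ 2 * β + a 1 * α * β ^ 2 + a 2 * α * β + a 3 * α + a 4 * β),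
    P * α * β, P * α, P * β, P, μ * α, μ * β, μ, μ / β, μ / α]

/-- After division by t₀t₁t₂t₃ the sextics w₅, …, w₈ are t₁t₂, t₁t₃, t₀t₂, t₀t₃, and w₉, …, w₁₃ are
t₂t₃ times α, β, 1, 1/β, 1/α; this is where the four parameters come from. -/
theorem klmPoint_sextic (a : Fin 14 → ℂ) (t : Fin 4 → ℂ) (ht : ∀ i, t i ≠ 0) (c : ℂ)
    (hc : c ≠ 0) :
    c • projectionMap a (fun k => eval t (sextic k)) =
      klmPoint a (c * t 0 * t 1 * t 2 * t 3 * (t 0 * t 3)) (c * t 0 * t 1 * t 2 * t 3 * (t 2 * t 3))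
        (t 1 / t 0) (t 2 / t 3) := by
  have h0 := ht 0
  have h1 := ht 1
  have h2 := ht 2
  have h3 := ht 3
  ext i
  fin_cases i <;> simp [projectionMap, klmPoint, sextic] <;> field_simp

theorem klmPoint_mem_affineCone (a : Fin 14 → ℂ) {P μ α β : ℂ} (hP : P ≠ 0) (hμ : μ ≠ 0)
    (hα : α ≠ 0) (hβ : β ≠ 0) : klmPoint a P μ α β ∈ affineCone (klm9 a) := by
  -- Solution of t₁/t₀ = α, t₂/t₃ = β, t₂/t₀ = μ/P with t₀ = 1; the scale c then adjusts P itself,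
  -- and μ follows.
  set t : Fin 4 → ℂ := ![1, α, μ / P, μ / (P * β)] with ht
  have ht0 : ∀ i, t i ≠ 0 := by
    intro i; fin_cases i <;> simp [ht, hP, hμ, hα, hβ]
  set c : ℂ := P / (t 0 * t 1 * t 2 * t 3 * (t 0 * t 3)) with hc
  have hprod : t 0 * t 1 * t 2 * t 3 * (t 0 * t 3) ≠ 0 := by simp [ht0]
  have hc0 : c ≠ 0 := div_ne_zero hP hprod
  have h1 := klmPoint_sextic a t ht0 c hc0
  have hcP : c * (t 0 * t 1 * t 2 * t 3 * (t 0 * t 3)) = P := div_mul_cancel₀ _ hprod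
  have h3 : c * t 0 * t 1 * t 2 * t 3 * (t 2 * t 3) = μ := by
    have h4 : t 2 = μ / P * t 0 := by simp [ht]
    calc c * t 0 * t 1 * t 2 * t 3 * (t 2 * t 3)
        = c * (t 0 * t 1 * t 2 * t 3 * (t 0 * t 3)) * (μ / P) := by
          conv_lhs => rw [show t 2 * t 3 = μ / P * t 0 * t 3 by rw [← h4]]
          ring
      _ = μ := by rw [hcP]; field_simp
  have h5 : t 1 / t 0 = α := by simp [ht]
  have h6 : t 2 / t 3 = β := by simp [ht]; field_simp
  rw [show c * t 0 * t 1 * t 2 * t 3 * (t 0 * t 3) = P by rw [← hcP]; ring, h3, h5, h6] at h1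
  have hv : (fun k => eval t (sextic k)) ≠ 0 := by
    intro h0
    rw [h0, map_zero, smul_zero] at h1
    exact hP (by simpa [klmPoint] using (congrFun h1 4).symm)
  obtain ⟨b, hb⟩ := mem_submodule_iff.1 (represents_mk hv).mem
  rw [← hb, map_smul, smul_smul] at h1
  have hw : projectionMap a (Projectivization.mk ℂ _ hv).rep ≠ 0 := by
    intro h0
    rw [h0, smul_zero] at h1
    exact hP (by simpa [klmPoint] using (congrFun h1 4).symm)
  refine ⟨Projectivization.mk ℂ _ hw, subset_zariskiClosure _ ⟨_, mk_mem_fano13 hv, hw, rfl⟩, ?_⟩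
  exact (represents_mk hw).mem_iff.2 ⟨c * b, h1⟩

/-- The projection in terms of polynomials. -/
theorem eval_projectionMap (a : Fin 14 → ℂ) (c : ℂ) (w : Fin 14 → ℂ) (f : CoordRing 9) :
    eval w (aeval ![C c * (C (a 0) * X 0 + C (a 1) * X 1 + C (a 2) * X 2 + C (a 3) * X 3
      + C (a 4) * X 4), C c * X 5, C c * X 6, C c * X 7, C c * X 8, C c * X 9, C c * X 10,
      C c * X 11, C c * X 12, C c * X 13] f : CoordRing 13) = eval (c • projectionMap a w) f := by
  rw [eval_aeval_eq]
  congr 2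
  ext i
  fin_cases i <;> simp [projectionMap]

/-- Two closures have been taken, of the image of ℙ³ and of its projection. A form on ℙ⁹ pulls back
to one on ℙ¹³, and there vanishing can be tested on the torus. -/
theorem mem_homIdeal_klm9_iff {a : Fin 14 → ℂ} {f : CoordRing 9} : f ∈ homIdeal (klm9 a) ↔
    ∀ P μ α β : ℂ, P ≠ 0 → μ ≠ 0 → α ≠ 0 → β ≠ 0 → eval (klmPoint a P μ α β) f = 0 := by
  constructor
  · intro hf P μ α β hP hμ hα hβ
    obtain ⟨p, hp, hv⟩ := klmPoint_mem_affineCone a hP hμ hα hβ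
    exact mem_homIdeal_iff.1 hf p hp _ hv
  · intro h
    rw [klm9, homIdeal_zariskiClosure, mem_homIdeal_setOf_represents]
    intro w hw _ c
    refine eval_smul_eq_zero (fun c hc => ?_) c
    rw [← eval_projectionMap]
    have hw' : w ∈ zariskiClosure fano13 := subset_zariskiClosure _ hw
    refine mem_zariskiClosure_iff.1 hw' _ ?_ _ (rep_mem_submodule w)
    refine mem_homIdeal_fano13_of_torus fun t d ht hd => ?_
    rw [eval_projectionMap, map_smul, smul_smul, klmPoint_sextic a t ht _ (mul_ne_zero hc hd)]
    have h0 := ht 0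
    have h1 := ht 1
    have h2 := ht 2
    have h3 := ht 3
    refine h _ _ _ _ ?_ ?_ ?_ ?_ <;> simp [*]

/-- The parametrization of the threefold of genus 9 as a homomorphism of rings. -/
def klmHom (a : Fin 14 → ℂ) : CoordRing 9 →ₐ[ℂ] MvPolynomial (Fin 4) ℂ :=
  aeval ![X 0 * X 1 ^ 2 * (C (a 0) * X 2 ^ 2 * X 3 + C (a 1) * X 2 * X 3 ^ 2
      + C (a 2) * X 2 * X 3 + C (a 3) * X 2 + C (a 4) * X 3),
    X 0 * X 1 * X 2 ^ 2 * X 3 ^ 2, X 0 * X 1 * X 2 ^ 2 * X 3, X 0 * X 1 * X 2 * X 3 ^ 2,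
    X 0 * X 1 * X 2 * X 3, X 0 * X 2 ^ 3 * X 3 ^ 2, X 0 * X 2 ^ 2 * X 3 ^ 3,
    X 0 * X 2 ^ 2 * X 3 ^ 2, X 0 * X 2 ^ 2 * X 3, X 0 * X 2 * X 3 ^ 2]

/-- The monomial change P = x₀x₁x₂x₃, μ = x₀(x₂x₃)² of torus coordinates is invertible and removes
all denominators. -/
theorem eval_klmHom (a : Fin 14 → ℂ) (f : CoordRing 9) (x : Fin 4 → ℂ) (hx : ∀ i, x i ≠ 0) :
    eval x (klmHom a f) = eval (klmPoint a (x 0 * x 1 * x 2 * x 3) (x 0 * (x 2 * x 3) ^ 2)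
      (x 2) (x 3)) f := by
  have h0 := hx 0
  have h1 := hx 1
  have h2 := hx 2
  have h3 := hx 3
  rw [klmHom, eval_aeval_eq]
  congr 2
  ext i
  fin_cases i <;> simp [klmPoint] <;> field_simp <;> simp

theorem homIdeal_klm9 (a : Fin 14 → ℂ) : homIdeal (klm9 a) = RingHom.ker (klmHom a) := by
  ext f
  rw [mem_homIdeal_klm9_iff, RingHom.mem_ker]
  constructor
  · intro h
    refine eq_zero_of_eval_torus fun x hx => ?_
    rw [eval_klmHom a f x hx]
    refine h _ _ _ _ ?_ ?_ ?_ ?_ <;> simp [hx]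
  · intro h P μ α β hP hμ hα hβ
    have := eval_klmHom a f ![μ / (α * β) ^ 2, P * (α * β) / μ, α, β] (by
      intro i; fin_cases i <;> simp [*])
    rw [show klmHom a f = 0 from h, map_zero] at this
    rw [this]
    congr 2 <;> simp <;> field_simp

/-- The quotient embeds in a polynomial ring in m variables, which bounds the degree from above; m
coordinates that together take all nonzero values are algebraically independent. -/
theorem trdeg_quotient_ker {m : ℕ} (χ : CoordRing n →ₐ[ℂ] MvPolynomial (Fin m) ℂ)
    (idx : Fin m → Fin (n + 1))
    (h : ∀ y : Fin m → ℂ, (∀ i, y i ≠ 0) → ∃ x : Fin m → ℂ, ∀ i, eval x (χ (X (idx i))) = y i) :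
    Algebra.trdeg ℂ (CoordRing n ⧸ RingHom.ker χ) = m := by
  apply le_antisymm
  · have := trdeg_le_of_injective (Ideal.kerLiftAlg χ) (Ideal.kerLiftAlg_injective χ)
    rwa [MvPolynomial.trdeg_of_isDomain, Cardinal.mk_fin, Cardinal.lift_natCast] at this
  · have hind : AlgebraicIndependent ℂ
        (fun i => Ideal.Quotient.mk (RingHom.ker χ) (X (idx i))) := by
      rw [algebraicIndependent_iff]
      intro p hp
      have h1 : χ (aeval (fun i => X (idx i)) p) = 0 := by
        have h2 : Ideal.Quotient.mkₐ ℂ (RingHom.ker χ) (aeval (fun i => X (idx i)) p) = 0 := by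
          rw [comp_aeval_apply]; exact hp
        exact Ideal.Quotient.eq_zero_iff_mem.1 h2
      refine eq_zero_of_eval_torus fun y hy => ?_
      obtain ⟨x, hx⟩ := h y hy
      rw [comp_aeval_apply] at h1
      have h3 := congrArg (eval x) h1
      rw [eval_aeval_eq, map_zero] at h3
      simpa only [hx] using h3
    have := hind.cardinalMk_le_trdeg
    rwa [Cardinal.mk_fin] at this

theorem isVarietyOfDim_klm9 (a : Fin 14 → ℂ) : IsVarietyOfDim (klm9 a) 3 := by
  refine ⟨zariskiClosure_idem _, ?_, ?_⟩
  · rw [homIdeal_klm9]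
    exact RingHom.ker_isPrime _
  -- These coordinates are P, Pα, Pβ, μ, from which the torus parameters are recovered.
  · rw [homIdeal_klm9, trdeg_quotient_ker _ ![4, 2, 3, 7]]
    · norm_num
    · intro y hy
      have h0 := hy 0
      have h1 := hy 1
      have h2 := hy 2
      have h3 := hy 3
      refine ⟨![y 3 / (y 1 * y 2 / y 0 ^ 2) ^ 2, y 1 * y 2 / (y 0 * y 3), y 1 / y 0, y 2 / y 0],
        fun i => ?_⟩
      fin_cases i <;> simp [klmHom] <;> field_simp

end

section

/-! ### The equations of the threefold of genus 9 -/

/-- The linear form in the equations of degree three. -/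
def klmForm (a : Fin 14 → ℂ) : CoordRing 9 :=
  C (a 0) * X 5 + C (a 1) * X 6 + C (a 2) * X 7 + C (a 3) * X 8 + C (a 4) * X 9

/-- The equations of the threefold of genus 9. -/
def klmRel (a : Fin 14 → ℂ) : Fin 16 → CoordRing 9 :=
  ![X 2 * X 3 - X 1 * X 4, X 5 * X 9 - X 7 * X 7, X 6 * X 8 - X 7 * X 7,
    X 5 * X 4 - X 7 * X 2, X 5 * X 3 - X 7 * X 1, X 9 * X 2 - X 7 * X 4, X 9 * X 1 - X 7 * X 3,
    X 6 * X 4 - X 7 * X 3, X 6 * X 2 - X 7 * X 1, X 8 * X 3 - X 7 * X 4, X 8 * X 1 - X 7 * X 2,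
    X 0 * X 7 - (C (a 0) * (X 1 * X 2) + C (a 1) * (X 1 * X 3) + C (a 2) * (X 1 * X 4)
      + C (a 3) * (X 2 * X 4) + C (a 4) * (X 3 * X 4)),
    X 0 * X 8 * X 9 - X 4 * X 4 * klmForm a, X 0 * X 6 * X 9 - X 3 * X 3 * klmForm a,
    X 0 * X 5 * X 8 - X 2 * X 2 * klmForm a, X 0 * X 5 * X 6 - X 1 * X 1 * klmForm a]

theorem klmRel_mem_homIdeal (a : Fin 14 → ℂ) (i : Fin 16) : klmRel a i ∈ homIdeal (klm9 a) := by
  rw [mem_homIdeal_klm9_iff]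
  intro P μ α β hP hμ hα hβ
  fin_cases i <;> simp [klmRel, klmForm, klmPoint] <;> field_simp <;> ring

theorem klmRel_isHomogeneous (a : Fin 14 → ℂ) (i : Fin 16) :
    (klmRel a i).IsHomogeneous 2 ∨ (klmRel a i).IsHomogeneous 3 := by
  have h2 : ∀ i j : Fin 10, (X i * X j : CoordRing 9).IsHomogeneous 2 := fun i j =>
    (isHomogeneous_X ℂ i).mul (isHomogeneous_X ℂ j)
  have hC : ∀ (c : ℂ) (m : ℕ) (f : CoordRing 9), f.IsHomogeneous m → (C c * f).IsHomogeneous m :=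
    fun c m f hf => by simpa using (isHomogeneous_C (Fin 10) c).mul hf
  have hS : (klmForm a).IsHomogeneous 1 :=
    ((((hC _ _ _ (isHomogeneous_X ℂ _)).add (hC _ _ _ (isHomogeneous_X ℂ _))).add
      (hC _ _ _ (isHomogeneous_X ℂ _))).add (hC _ _ _ (isHomogeneous_X ℂ _))).add
      (hC _ _ _ (isHomogeneous_X ℂ _))
  have h3 : ∀ i j k l : Fin 10,
      (X i * X j * X k - X l * X l * klmForm a : CoordRing 9).IsHomogeneous 3 := fun i j k l =>
    ((h2 i j).mul (isHomogeneous_X ℂ k)).sub ((h2 l l).mul hS)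
  have h22 : ∀ i j k l : Fin 10, (X i * X j - X k * X l : CoordRing 9).IsHomogeneous 2 :=
    fun i j k l => (h2 i j).sub (h2 k l)
  have h5 : ∀ i j k l m p q r s t u v : Fin 10, (X i * X j - (C (a 0) * (X k * X l)
      + C (a 1) * (X m * X p) + C (a 2) * (X q * X r) + C (a 3) * (X s * X t)
      + C (a 4) * (X u * X v)) : CoordRing 9).IsHomogeneous 2 := fun i j k l m p q r s t u v =>
    (h2 i j).sub (((((hC _ _ _ (h2 _ _)).add (hC _ _ _ (h2 _ _))).add (hC _ _ _ (h2 _ _))).add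
      (hC _ _ _ (h2 _ _))).add (hC _ _ _ (h2 _ _)))
  fin_cases i
  exacts [Or.inl (h22 2 3 1 4), Or.inl (h22 5 9 7 7), Or.inl (h22 6 8 7 7), Or.inl (h22 5 4 7 2),
    Or.inl (h22 5 3 7 1), Or.inl (h22 9 2 7 4), Or.inl (h22 9 1 7 3), Or.inl (h22 6 4 7 3),
    Or.inl (h22 6 2 7 1), Or.inl (h22 8 3 7 4), Or.inl (h22 8 1 7 2),
    Or.inl (h5 0 7 1 2 1 3 1 4 2 4 3 4), Or.inr (h3 0 8 9 4), Or.inr (h3 0 6 9 3),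
    Or.inr (h3 0 5 8 2), Or.inr (h3 0 5 6 1)]

/-! ### Rewriting rules -/

section Rules

variable {σ : Type*} {w : σ → ℕ}

/-- The homogeneous polynomials of degree `m` all of whose monomials have weight less than `N`. -/
def lowerTerms (w : σ → ℕ) (m N : ℕ) : Submodule ℂ (MvPolynomial σ ℂ) :=
  restrictSupport ℂ {e : σ →₀ ℕ | e.degree = m ∧ Finsupp.weight w e < N}

theorem C_mul_mem_lowerTerms {m N : ℕ} {f : MvPolynomial σ ℂ} (c : ℂ)
    (hf : f ∈ lowerTerms w m N) : C c * f ∈ lowerTerms w m N := by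
  rw [← smul_eq_C_mul]
  exact Submodule.smul_mem _ _ hf

theorem X_mul_X_mem_lowerTerms {i j : σ} {N : ℕ} (h : w i + w j < N) :
    (X i * X j : MvPolynomial σ ℂ) ∈ lowerTerms w 2 N := by
  rw [X, X, monomial_mul, lowerTerms, monomial_mem_restrictSupport]
  left
  simpa [Finsupp.weight_single] using h

theorem X_mul_X_mul_X_mem_lowerTerms {i j k : σ} {N : ℕ} (h : w i + w j + w k < N) :
    (X i * X j * X k : MvPolynomial σ ℂ) ∈ lowerTerms w 3 N := by
  rw [X, X, X, monomial_mul, monomial_mul, lowerTerms, monomial_mem_restrictSupport]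
  left
  simpa [Finsupp.weight_single] using h

theorem exists_rule_pair {J : Ideal (MvPolynomial σ ℂ)} {i j : σ} (hij : i ≠ j) {d : σ →₀ ℕ}
    (hi : d i ≠ 0) (hj : d j ≠ 0) (r : MvPolynomial σ ℂ) (hr : r ∈ lowerTerms w 2 (w i + w j))
    (hJ : X i * X j - r ∈ J) :
    ∃ s ≤ d, ∃ r ∈ restrictSupport ℂ {e : σ →₀ ℕ | e.degree = s.degree ∧
      Finsupp.weight w e < Finsupp.weight w s}, monomial s 1 - r ∈ J := by
  classical
  refine ⟨Finsupp.single i 1 + Finsupp.single j 1, fun k => ?_, r, ?_, ?_⟩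
  · simp only [Finsupp.add_apply, Finsupp.single_apply]
    split_ifs with h1 h2 h2
    · exact absurd (h1.trans h2.symm) hij
    · subst h1; omega
    · subst h2; omega
    · omega
  · simpa [Finsupp.weight_single, lowerTerms] using hr
  · simpa [X, monomial_mul] using hJ

theorem exists_rule_triple {J : Ideal (MvPolynomial σ ℂ)} {i j k : σ} (hij : i ≠ j) (hik : i ≠ k)
    (hjk : j ≠ k) {d : σ →₀ ℕ} (hi : d i ≠ 0) (hj : d j ≠ 0) (hk : d k ≠ 0)
    (r : MvPolynomial σ ℂ) (hr : r ∈ lowerTerms w 3 (w i + w j + w k))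
    (hJ : X i * X j * X k - r ∈ J) :
    ∃ s ≤ d, ∃ r ∈ restrictSupport ℂ {e : σ →₀ ℕ | e.degree = s.degree ∧
      Finsupp.weight w e < Finsupp.weight w s}, monomial s 1 - r ∈ J := by
  classical
  refine ⟨Finsupp.single i 1 + Finsupp.single j 1 + Finsupp.single k 1, fun l => ?_, r, ?_, ?_⟩
  · simp only [Finsupp.add_apply, Finsupp.single_apply]
    split_ifs with h1 h2 h3 h3 h2 h3 h3
    · exact absurd (h1.trans h2.symm) hij
    · exact absurd (h1.trans h2.symm) hij
    · exact absurd (h1.trans h3.symm) hik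
    · subst h1; omega
    · exact absurd (h2.trans h3.symm) hjk
    · subst h2; omega
    · subst h3; omega
    · omega
  · simpa [Finsupp.weight_single, lowerTerms] using hr
  · simpa [X, monomial_mul] using hJ

end Rules

/-- The standard monomials of the threefold of genus 9. -/
def klmStd : Set (Fin 10 →₀ ℕ) := {d |
  ((d 2 = 0 ∨ d 3 = 0) ∧ (d 5 = 0 ∨ d 9 = 0) ∧ (d 6 = 0 ∨ d 8 = 0) ∧
  (d 5 = 0 ∨ d 4 = 0) ∧ (d 5 = 0 ∨ d 3 = 0) ∧ (d 9 = 0 ∨ d 2 = 0) ∧ (d 9 = 0 ∨ d 1 = 0) ∧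
  (d 6 = 0 ∨ d 4 = 0) ∧ (d 6 = 0 ∨ d 2 = 0) ∧ (d 8 = 0 ∨ d 3 = 0) ∧ (d 8 = 0 ∨ d 1 = 0)) ∧
  (d 0 = 0 ∨ d 7 = 0) ∧ (d 0 = 0 ∨ d 8 = 0 ∨ d 9 = 0) ∧ (d 0 = 0 ∨ d 6 = 0 ∨ d 9 = 0) ∧
  (d 0 = 0 ∨ d 5 = 0 ∨ d 8 = 0) ∧ (d 0 = 0 ∨ d 5 = 0 ∨ d 6 = 0)}

/-- The ideal generated by the equations of the threefold of genus 9. -/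
def klmIdeal (a : Fin 14 → ℂ) : Ideal (CoordRing 9) := Ideal.span (Set.range (klmRel a))

/-- The first monomial of each entry of `klmRel` is its leading one, and `klmStd` consists of the
exponents divisible by none of these. -/
theorem klmIdeal_normalForm (a : Fin 14 → ℂ) (d : Fin 10 →₀ ℕ) :
    ∃ g ∈ restrictSupport ℂ {e | e ∈ klmStd ∧ e.degree = d.degree},
      monomial d 1 - g ∈ klmIdeal a := by
  -- The weights make each leading monomial strictly heaviest: X₀ weighs 5 so that X₀X₇ beats the
  -- products of weight at most 3, and the cubics have weight 9 against at most 6.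
  refine exists_normalForm _ ![5, 1, 2, 2, 1, 2, 2, 0, 2, 2] _ (fun d hd => ?_) d
  have hJ : ∀ (i : Fin 16) {f : CoordRing 9}, f = klmRel a i → f ∈ klmIdeal a := by
    rintro i _ rfl
    exact Ideal.subset_span ⟨i, rfl⟩
  have hcub : ∀ l N, (![5, 1, 2, 2, 1, 2, 2, 0, 2, 2] : Fin 10 → ℕ) l ≤ 2 → 6 < N →
      C (a 0) * (X l * X l * X 5) + C (a 1) * (X l * X l * X 6) + C (a 2) * (X l * X l * X 7)
      + C (a 3) * (X l * X l * X 8) + C (a 4) * (X l * X l * X 9)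
      ∈ lowerTerms (![5, 1, 2, 2, 1, 2, 2, 0, 2, 2] : Fin 10 → ℕ) 3 N := by
    intro l N hl hN
    refine Submodule.add_mem _ (Submodule.add_mem _ (Submodule.add_mem _ (Submodule.add_mem _
      ?_ ?_) ?_) ?_) ?_ <;>
    refine C_mul_mem_lowerTerms _ (X_mul_X_mul_X_mem_lowerTerms ?_) <;> simp <;> omega
  have hcubJ : ∀ l, C (a 0) * (X l * X l * X 5) + C (a 1) * (X l * X l * X 6)
      + C (a 2) * (X l * X l * X 7) + C (a 3) * (X l * X l * X 8) + C (a 4) * (X l * X l * X 9)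
      = (X l * X l * klmForm a : CoordRing 9) := by
    intro l; simp only [klmForm]; ring
  simp only [klmStd, Set.mem_ofPred_eq, not_and_or, not_or] at hd
  rcases hd with (h | h | h | h | h | h | h | h | h | h | h) | h | h | h | h | h
  · exact exists_rule_pair (by decide) h.1 h.2 _ (X_mul_X_mem_lowerTerms (by decide)) (hJ 0 rfl)
  · exact exists_rule_pair (by decide) h.1 h.2 _ (X_mul_X_mem_lowerTerms (by decide)) (hJ 1 rfl)
  · exact exists_rule_pair (by decide) h.1 h.2 _ (X_mul_X_mem_lowerTerms (by decide)) (hJ 2 rfl)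
  · exact exists_rule_pair (by decide) h.1 h.2 _ (X_mul_X_mem_lowerTerms (by decide)) (hJ 3 rfl)
  · exact exists_rule_pair (by decide) h.1 h.2 _ (X_mul_X_mem_lowerTerms (by decide)) (hJ 4 rfl)
  · exact exists_rule_pair (by decide) h.1 h.2 _ (X_mul_X_mem_lowerTerms (by decide)) (hJ 5 rfl)
  · exact exists_rule_pair (by decide) h.1 h.2 _ (X_mul_X_mem_lowerTerms (by decide)) (hJ 6 rfl)
  · exact exists_rule_pair (by decide) h.1 h.2 _ (X_mul_X_mem_lowerTerms (by decide)) (hJ 7 rfl)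
  · exact exists_rule_pair (by decide) h.1 h.2 _ (X_mul_X_mem_lowerTerms (by decide)) (hJ 8 rfl)
  · exact exists_rule_pair (by decide) h.1 h.2 _ (X_mul_X_mem_lowerTerms (by decide)) (hJ 9 rfl)
  · exact exists_rule_pair (by decide) h.1 h.2 _ (X_mul_X_mem_lowerTerms (by decide)) (hJ 10 rfl)
  · refine exists_rule_pair (by decide) h.1 h.2 _ ?_ (hJ 11 rfl)
    refine Submodule.add_mem _ (Submodule.add_mem _ (Submodule.add_mem _ (Submodule.add_mem _
      ?_ ?_) ?_) ?_) ?_ <;>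
    exact C_mul_mem_lowerTerms _ (X_mul_X_mem_lowerTerms (by decide))
  · exact exists_rule_triple (by decide) (by decide) (by decide) h.1 h.2.1 h.2.2 _
      (hcub 4 _ (by decide) (by decide)) (hJ 12 (by rw [hcubJ]; rfl))
  · exact exists_rule_triple (by decide) (by decide) (by decide) h.1 h.2.1 h.2.2 _
      (hcub 3 _ (by decide) (by decide)) (hJ 13 (by rw [hcubJ]; rfl))
  · exact exists_rule_triple (by decide) (by decide) (by decide) h.1 h.2.1 h.2.2 _
      (hcub 2 _ (by decide) (by decide)) (hJ 14 (by rw [hcubJ]; rfl))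
  · exact exists_rule_triple (by decide) (by decide) (by decide) h.1 h.2.1 h.2.2 _
      (hcub 1 _ (by decide) (by decide)) (hJ 15 (by rw [hcubJ]; rfl))

end

section

/-! ### Linear independence of the standard monomials -/

/-- The monomial exponent with given entries in the last two of the four variables. -/
def exp₂ (p q : ℕ) : Fin 4 →₀ ℕ := Finsupp.single 2 p + Finsupp.single 3 q

theorem exp₂_inj {p q r s : ℕ} : exp₂ p q = exp₂ r s ↔ p = r ∧ q = s := by
  refine ⟨fun h => ⟨?_, ?_⟩, by rintro ⟨rfl, rfl⟩; rfl⟩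
  · simpa [exp₂] using DFunLike.congr_fun h 2
  · simpa [exp₂] using DFunLike.congr_fun h 3

/-- The polynomial in the parametrization of the threefold of genus 9. -/
def klmPoly (a : Fin 14 → ℂ) : MvPolynomial (Fin 4) ℂ :=
  monomial (exp₂ 2 1) (a 0) + monomial (exp₂ 1 2) (a 1) + monomial (exp₂ 1 1) (a 2)
    + monomial (exp₂ 1 0) (a 3) + monomial (exp₂ 0 1) (a 4)

theorem klmPoly_eq (a : Fin 14 → ℂ) : klmPoly a = C (a 0) * X 2 ^ 2 * X 3
    + C (a 1) * X 2 * X 3 ^ 2 + C (a 2) * X 2 * X 3 + C (a 3) * X 2 + C (a 4) * X 3 := by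
  have : ∀ p q c, (monomial (exp₂ p q) c : MvPolynomial (Fin 4) ℂ) = C c * X 2 ^ p * X 3 ^ q := by
    intro p q c
    rw [exp₂, monomial_add_single, C_mul_X_pow_eq_monomial]
  simp [klmPoly, this]

/-- The lattice points in the multiples of the Newton polygon of `klmPoly`. -/
def diamond (i : ℕ) : Set (Fin 4 →₀ ℕ) := {e | e 0 = 0 ∧ e 1 = 0 ∧ i ≤ e 2 + e 3 ∧
  e 2 + e 3 ≤ 3 * i ∧ e 2 ≤ e 3 + i ∧ e 3 ≤ e 2 + i}

theorem exp₂_mem_diamond {p q i : ℕ} (h1 : i ≤ p + q) (h2 : p + q ≤ 3 * i) (h3 : p ≤ q + i)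
    (h4 : q ≤ p + i) : exp₂ p q ∈ diamond i := by
  refine ⟨?_, ?_, ?_, ?_, ?_, ?_⟩ <;> simp [exp₂] <;> assumption

theorem klmPoly_mem (a : Fin 14 → ℂ) : klmPoly a ∈ restrictSupport ℂ (diamond 1) := by
  refine Submodule.add_mem _ (Submodule.add_mem _ (Submodule.add_mem _ (Submodule.add_mem _
    ?_ ?_) ?_) ?_) ?_ <;>
  exact (monomial_mem_restrictSupport ℂ).2 (Or.inl (exp₂_mem_diamond (by decide) (by decide)
    (by decide) (by decide)))

open scoped Pointwise in
theorem klmPoly_pow_mem (a : Fin 14 → ℂ) (i : ℕ) :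
    klmPoly a ^ i ∈ restrictSupport ℂ (diamond i) := by
  induction i with
  | zero =>
    rw [pow_zero, ← C_1, C_apply, monomial_mem_restrictSupport]
    left
    simp [diamond]
  | succ i ih =>
    have h : klmPoly a ^ (i + 1) ∈ restrictSupport ℂ (diamond i + diamond 1) := by
      rw [restrictSupport_add, pow_succ]
      exact Submodule.mul_mem_mul ih (klmPoly_mem a)
    refine restrictSupport_mono _ ?_ h
    rintro _ ⟨x, hx, y, hy, rfl⟩
    simp only [diamond, Set.mem_ofPred_eq, Finsupp.add_apply] at *
    omega

/-- The four exponents are vertices of the Newton polygon, so i times such a vertex is a sum of i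
points of the polygon in only one way. -/
theorem coeff_klmPoly_pow (a : Fin 14 → ℂ) (p q : ℕ)
    (hpq : (p, q) = (2, 1) ∨ (p, q) = (1, 2) ∨ (p, q) = (1, 0) ∨ (p, q) = (0, 1)) (i : ℕ) :
    coeff (exp₂ (i * p) (i * q)) (klmPoly a ^ i) = coeff (exp₂ p q) (klmPoly a) ^ i := by
  classical
  induction i with
  | zero => simp [exp₂]
  | succ i ih =>
    rw [pow_succ, coeff_mul, Finset.sum_eq_single (exp₂ (i * p) (i * q), exp₂ p q), ih, pow_succ]
    · rintro ⟨x, y⟩ hxy hne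
      by_contra h0
      have hx := klmPoly_pow_mem a i (mem_support_iff.2 (left_ne_zero_of_mul h0))
      have hy := klmPoly_mem a (mem_support_iff.2 (right_ne_zero_of_mul h0))
      have hs : x + y = exp₂ ((i + 1) * p) ((i + 1) * q) := Finset.HasAntidiagonal.mem_antidiagonal.1 hxy
      have h2 : x 2 + y 2 = (i + 1) * p := by simpa [exp₂] using DFunLike.congr_fun hs 2
      have h3 : x 3 + y 3 = (i + 1) * q := by simpa [exp₂] using DFunLike.congr_fun hs 3
      simp only [diamond, Set.mem_ofPred_eq] at hx hy
      -- Each vertex is the only point where two of the inequalities defining the polygon are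
      -- equalities; equality for the sum forces it for both summands.
      have hall : x 2 = i * p ∧ x 3 = i * q ∧ y 2 = p ∧ y 3 = q := by
        simp only [Prod.mk.injEq] at hpq
        rcases hpq with ⟨rfl, rfl⟩ | ⟨rfl, rfl⟩ | ⟨rfl, rfl⟩ | ⟨rfl, rfl⟩ <;> omega
      refine hne (Prod.ext (Finsupp.ext fun k => ?_) (Finsupp.ext fun k => ?_)) <;>
      fin_cases k <;> simp [exp₂] <;> omega
    · intro h
      refine absurd (Finset.HasAntidiagonal.mem_antidiagonal.2 ?_) h
      ext k
      fin_cases k <;> simp [exp₂] <;> ring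

theorem coeff_klmPoly (a : Fin 14 → ℂ) : coeff (exp₂ 2 1) (klmPoly a) = a 0 ∧
    coeff (exp₂ 1 2) (klmPoly a) = a 1 ∧ coeff (exp₂ 1 0) (klmPoly a) = a 3 ∧
    coeff (exp₂ 0 1) (klmPoly a) = a 4 := by
  classical
  refine ⟨?_, ?_, ?_, ?_⟩ <;> simp [klmPoly, coeff_monomial, exp₂_inj]

/-- The exponents in the parametrization of the threefold of genus 9, apart from the powers of
`klmPoly`. -/
def klmExp (d : Fin 10 →₀ ℕ) : Fin 4 →₀ ℕ := Finsupp.equivFunOnFinite.symm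
  ![d 0 + d 1 + d 2 + d 3 + d 4 + d 5 + d 6 + d 7 + d 8 + d 9,
    2 * d 0 + d 1 + d 2 + d 3 + d 4,
    2 * d 1 + 2 * d 2 + d 3 + d 4 + 3 * d 5 + 2 * d 6 + 2 * d 7 + 2 * d 8 + d 9,
    2 * d 1 + d 2 + 2 * d 3 + d 4 + 2 * d 5 + 3 * d 6 + 2 * d 7 + d 8 + 2 * d 9]

theorem klmHom_monomial (a : Fin 14 → ℂ) (d : Fin 10 →₀ ℕ) :
    klmHom a (monomial d 1) = monomial (klmExp d) 1 * klmPoly a ^ d 0 := by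
  rw [klmHom, aeval_monomial, Finsupp.prod_fintype _ _ (by simp), monomial_eq,
    Finsupp.prod_fintype _ _ (by simp), klmPoly_eq]
  simp only [Fin.prod_univ_succ, klmExp]
  simp
  generalize C (a 0) * X 2 ^ 2 * X 3 + C (a 1) * X 2 * X 3 ^ 2 + C (a 2) * X 2 * X 3 + C (a 3) * X 2
    + C (a 4) * X 3 = G
  simp only [mul_pow, ← pow_mul, pow_add]
  ring

theorem coeff_klmHom (a : Fin 14 → ℂ) (g : CoordRing 9) (E : Fin 4 →₀ ℕ) :
    coeff E (klmHom a g) = ∑ d ∈ g.support, coeff d g *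
      coeff E (monomial (klmExp d) 1 * klmPoly a ^ d 0) := by
  conv_lhs => rw [g.as_sum, map_sum, coeff_sum]
  refine Finset.sum_congr rfl fun d _ => ?_
  rw [← klmHom_monomial, ← mul_one (coeff d g), ← smul_eq_mul, ← smul_monomial, map_smul,
    coeff_smul, smul_eq_mul, smul_eq_mul, mul_one]

/-- If the vertex `(p, q)` singles out one monomial of `g`, then the monomial does not occur in
a relation. -/
theorem coeff_eq_zero_of_klmHom {a : Fin 14 → ℂ} {g : CoordRing 9} (h0 : klmHom a g = 0) (p q : ℕ)
    (hpq : (p, q) = (2, 1) ∨ (p, q) = (1, 2) ∨ (p, q) = (1, 0) ∨ (p, q) = (0, 1))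
    (ha : coeff (exp₂ p q) (klmPoly a) ≠ 0) (d : Fin 10 →₀ ℕ) (hd : d ∈ g.support)
    (h : ∀ d' ∈ g.support, ∀ e ∈ diamond (d' 0),
      klmExp d' + e = klmExp d + exp₂ (d 0 * p) (d 0 * q) → d' = d) : False := by
  classical
  have h1 := coeff_klmHom a g (klmExp d + exp₂ (d 0 * p) (d 0 * q))
  rw [h0, coeff_zero, Finset.sum_eq_single d] at h1
  · rw [coeff_monomial_mul, one_mul, coeff_klmPoly_pow a p q hpq] at h1
    exact mul_ne_zero (mem_support_iff.1 hd) (pow_ne_zero _ ha) h1.symm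
  · intro d' hd' hne
    rw [coeff_monomial_mul']
    split_ifs with hle
    · by_contra hc
      have := klmPoly_pow_mem a (d' 0) (mem_support_iff.2
        (right_ne_zero_of_mul (right_ne_zero_of_mul hc)))
      exact hne (h d' hd' _ this (add_tsub_cancel_of_le hle))
    · simp
  · exact fun hn => absurd hd hn

theorem klmExp_add_eq {d d' : Fin 10 →₀ ℕ} {e : Fin 4 →₀ ℕ} {i p q : ℕ} (he : e ∈ diamond i)
    (h : klmExp d' + e = klmExp d + exp₂ p q) :
    d' 0 + d' 1 + d' 2 + d' 3 + d' 4 + d' 5 + d' 6 + d' 7 + d' 8 + d' 9 =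
      d 0 + d 1 + d 2 + d 3 + d 4 + d 5 + d 6 + d 7 + d 8 + d 9 ∧
    2 * d' 0 + d' 1 + d' 2 + d' 3 + d' 4 = 2 * d 0 + d 1 + d 2 + d 3 + d 4 ∧
    2 * d' 1 + 2 * d' 2 + d' 3 + d' 4 + 3 * d' 5 + 2 * d' 6 + 2 * d' 7 + 2 * d' 8 + d' 9 + e 2 =
      2 * d 1 + 2 * d 2 + d 3 + d 4 + 3 * d 5 + 2 * d 6 + 2 * d 7 + 2 * d 8 + d 9 + p ∧
    2 * d' 1 + d' 2 + 2 * d' 3 + d' 4 + 2 * d' 5 + 3 * d' 6 + 2 * d' 7 + d' 8 + 2 * d' 9 + e 3 =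
      2 * d 1 + d 2 + 2 * d 3 + d 4 + 2 * d 5 + 3 * d 6 + 2 * d 7 + d 8 + 2 * d 9 + q := by
  obtain ⟨h0, h1, -⟩ := he
  have e0 := DFunLike.congr_fun h 0
  have e1 := DFunLike.congr_fun h 1
  have e2 := DFunLike.congr_fun h 2
  have e3 := DFunLike.congr_fun h 3
  simp [klmExp, exp₂, h0, h1] at e0 e1 e2 e3
  exact ⟨e0, e1, e2, e3⟩

theorem exists_max_of_mem_support {g : CoordRing 9} (wt : (Fin 10 →₀ ℕ) → ℕ)
    (Q : (Fin 10 →₀ ℕ) → Prop) (h : ∃ d ∈ g.support, Q d) :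
    ∃ d ∈ g.support, Q d ∧ ∀ d' ∈ g.support, Q d' → wt d' ≤ wt d := by
  classical
  obtain ⟨d, hd, hQ⟩ := h
  obtain ⟨d, hd, hmax⟩ := Finset.exists_max_image (g.support.filter Q) wt
    ⟨d, Finset.mem_filter.2 ⟨hd, hQ⟩⟩
  rw [Finset.mem_filter] at hd
  exact ⟨d, hd.1, hd.2, fun d' hd' hQ' => hmax d' (Finset.mem_filter.2 ⟨hd', hQ'⟩)⟩

variable {a : Fin 14 → ℂ} {g : CoordRing 9}

theorem ext_fin_ten {d d' : Fin 10 →₀ ℕ} (h : d' 0 = d 0 ∧ d' 1 = d 1 ∧ d' 2 = d 2 ∧ d' 3 = d 3 ∧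
    d' 4 = d 4 ∧ d' 5 = d 5 ∧ d' 6 = d 6 ∧ d' 7 = d 7 ∧ d' 8 = d 8 ∧ d' 9 = d 9) : d' = d := by
  ext k
  obtain ⟨h0, h1, h2, h3, h4, h5, h6, h7, h8, h9⟩ := h
  fin_cases k <;> assumption

/-- Exponents are read in P, μ, α, β. Among the monomials of g containing z₀ and z₅, let d have the
largest z₀-exponent, and take its term at the vertex (2, 1). There the α-degree exceeds the P-degree
by `d 5` and the total degree by `d 0`. For any d' producing the same term these excesses are at
most `d' 5` and `d' 0`, so d' contains z₀ and z₅ too. Standardness leaves only z₀, z₁, z₂, z₅ in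
both; maximality makes the z₀-exponents equal, which pins the term of d' to the vertex and
determines d'. The next three lemmas are the images of this one under the symmetries of the square.
-/
theorem no_corner_five (h0 : a 0 ≠ 0) (hg : g ∈ restrictSupport ℂ klmStd)
    (hker : klmHom a g = 0) : ∀ d ∈ g.support, d 0 = 0 ∨ d 5 = 0 := by
  by_contra! hne
  obtain ⟨d, hd, ⟨hd0, hdc⟩, hmax⟩ := exists_max_of_mem_support (fun d => d 0) _ hne
  refine coeff_eq_zero_of_klmHom hker 2 1 (by simp) (by rwa [(coeff_klmPoly a).1]) d hd
    fun d' hd' e he heq => ?_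
  obtain ⟨e0, e1, e2, e3⟩ := klmExp_add_eq he heq
  obtain ⟨-, -, f1, f2, f3, f4⟩ := he
  obtain ⟨r0, r1, r2, r3, r4, r5⟩ :
      d 9 = 0 ∧ d 4 = 0 ∧ d 3 = 0 ∧ d 7 = 0 ∧ d 8 = 0 ∧ d 6 = 0 := by
    obtain ⟨⟨-, s2, -, s4, s5, -, -, -, -, -, -⟩, s12, -, -, s15, s16⟩ := hg hd
    exact ⟨s2.resolve_left hdc, s4.resolve_left hdc, s5.resolve_left hdc, s12.resolve_left hd0, (s15.resolve_left hd0).resolve_left hdc, (s16.resolve_left hd0).resolve_left hdc⟩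
  by_cases z : d' 0 = 0
  · omega
  by_cases c : d' 5 = 0
  · omega
  obtain ⟨q0, q1, q2, q3, q4, q5⟩ :
      d' 9 = 0 ∧ d' 4 = 0 ∧ d' 3 = 0 ∧ d' 7 = 0 ∧ d' 8 = 0 ∧ d' 6 = 0 := by
    obtain ⟨⟨-, t2, -, t4, t5, -, -, -, -, -, -⟩, t12, -, -, t15, t16⟩ := hg hd'
    exact ⟨t2.resolve_left c, t4.resolve_left c, t5.resolve_left c, t12.resolve_left z, (t15.resolve_left z).resolve_left c, (t16.resolve_left z).resolve_left c⟩
  have hm := hmax d' hd' ⟨z, c⟩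
  refine ext_fin_ten ⟨?_, ?_, ?_, ?_, ?_, ?_, ?_, ?_, ?_, ?_⟩ <;> omega

theorem no_corner_six (h1 : a 1 ≠ 0) (hg : g ∈ restrictSupport ℂ klmStd)
    (hker : klmHom a g = 0) : ∀ d ∈ g.support, d 0 = 0 ∨ d 6 = 0 := by
  by_contra! hne
  obtain ⟨d, hd, ⟨hd0, hdc⟩, hmax⟩ := exists_max_of_mem_support (fun d => d 0) _ hne
  refine coeff_eq_zero_of_klmHom hker 1 2 (by simp) (by rwa [(coeff_klmPoly a).2.1]) d hd
    fun d' hd' e he heq => ?_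
  obtain ⟨e0, e1, e2, e3⟩ := klmExp_add_eq he heq
  obtain ⟨-, -, f1, f2, f3, f4⟩ := he
  obtain ⟨r0, r1, r2, r3, r4, r5⟩ :
      d 8 = 0 ∧ d 4 = 0 ∧ d 2 = 0 ∧ d 7 = 0 ∧ d 9 = 0 ∧ d 5 = 0 := by
    obtain ⟨⟨-, -, s3, -, -, -, -, s8, s9, -, -⟩, s12, -, s14, -, s16⟩ := hg hd
    exact ⟨s3.resolve_left hdc, s8.resolve_left hdc, s9.resolve_left hdc, s12.resolve_left hd0, (s14.resolve_left hd0).resolve_left hdc, (s16.resolve_left hd0).resolve_right hdc⟩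
  by_cases z : d' 0 = 0
  · omega
  by_cases c : d' 6 = 0
  · omega
  obtain ⟨q0, q1, q2, q3, q4, q5⟩ :
      d' 8 = 0 ∧ d' 4 = 0 ∧ d' 2 = 0 ∧ d' 7 = 0 ∧ d' 9 = 0 ∧ d' 5 = 0 := by
    obtain ⟨⟨-, -, t3, -, -, -, -, t8, t9, -, -⟩, t12, -, t14, -, t16⟩ := hg hd'
    exact ⟨t3.resolve_left c, t8.resolve_left c, t9.resolve_left c, t12.resolve_left z, (t14.resolve_left z).resolve_left c, (t16.resolve_left z).resolve_right c⟩
  have hm := hmax d' hd' ⟨z, c⟩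
  refine ext_fin_ten ⟨?_, ?_, ?_, ?_, ?_, ?_, ?_, ?_, ?_, ?_⟩ <;> omega

theorem no_corner_eight (h3 : a 3 ≠ 0) (hg : g ∈ restrictSupport ℂ klmStd)
    (hker : klmHom a g = 0) : ∀ d ∈ g.support, d 0 = 0 ∨ d 8 = 0 := by
  by_contra! hne
  obtain ⟨d, hd, ⟨hd0, hdc⟩, hmax⟩ := exists_max_of_mem_support (fun d => d 0) _ hne
  refine coeff_eq_zero_of_klmHom hker 1 0 (by simp) (by rwa [(coeff_klmPoly a).2.2.1]) d hd
    fun d' hd' e he heq => ?_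
  obtain ⟨e0, e1, e2, e3⟩ := klmExp_add_eq he heq
  obtain ⟨-, -, f1, f2, f3, f4⟩ := he
  obtain ⟨r0, r1, r2, r3, r4, r5⟩ :
      d 6 = 0 ∧ d 3 = 0 ∧ d 1 = 0 ∧ d 7 = 0 ∧ d 9 = 0 ∧ d 5 = 0 := by
    obtain ⟨⟨-, -, s3, -, -, -, -, -, -, s10, s11⟩, s12, s13, -, s15, -⟩ := hg hd
    exact ⟨s3.resolve_right hdc, s10.resolve_left hdc, s11.resolve_left hdc, s12.resolve_left hd0, (s13.resolve_left hd0).resolve_left hdc, (s15.resolve_left hd0).resolve_right hdc⟩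
  by_cases z : d' 0 = 0
  · omega
  by_cases c : d' 8 = 0
  · omega
  obtain ⟨q0, q1, q2, q3, q4, q5⟩ :
      d' 6 = 0 ∧ d' 3 = 0 ∧ d' 1 = 0 ∧ d' 7 = 0 ∧ d' 9 = 0 ∧ d' 5 = 0 := by
    obtain ⟨⟨-, -, t3, -, -, -, -, -, -, t10, t11⟩, t12, t13, -, t15, -⟩ := hg hd'
    exact ⟨t3.resolve_right c, t10.resolve_left c, t11.resolve_left c, t12.resolve_left z, (t13.resolve_left z).resolve_left c, (t15.resolve_left z).resolve_right c⟩
  have hm := hmax d' hd' ⟨z, c⟩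
  refine ext_fin_ten ⟨?_, ?_, ?_, ?_, ?_, ?_, ?_, ?_, ?_, ?_⟩ <;> omega

theorem no_corner_nine (h4 : a 4 ≠ 0) (hg : g ∈ restrictSupport ℂ klmStd)
    (hker : klmHom a g = 0) : ∀ d ∈ g.support, d 0 = 0 ∨ d 9 = 0 := by
  by_contra! hne
  obtain ⟨d, hd, ⟨hd0, hdc⟩, hmax⟩ := exists_max_of_mem_support (fun d => d 0) _ hne
  refine coeff_eq_zero_of_klmHom hker 0 1 (by simp) (by rwa [(coeff_klmPoly a).2.2.2]) d hd
    fun d' hd' e he heq => ?_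
  obtain ⟨e0, e1, e2, e3⟩ := klmExp_add_eq he heq
  obtain ⟨-, -, f1, f2, f3, f4⟩ := he
  obtain ⟨r0, r1, r2, r3, r4, r5⟩ :
      d 5 = 0 ∧ d 2 = 0 ∧ d 1 = 0 ∧ d 7 = 0 ∧ d 8 = 0 ∧ d 6 = 0 := by
    obtain ⟨⟨-, s2, -, -, -, s6, s7, -, -, -, -⟩, s12, s13, s14, -, -⟩ := hg hd
    exact ⟨s2.resolve_right hdc, s6.resolve_left hdc, s7.resolve_left hdc, s12.resolve_left hd0, (s13.resolve_left hd0).resolve_right hdc, (s14.resolve_left hd0).resolve_right hdc⟩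
  by_cases z : d' 0 = 0
  · omega
  by_cases c : d' 9 = 0
  · omega
  obtain ⟨q0, q1, q2, q3, q4, q5⟩ :
      d' 5 = 0 ∧ d' 2 = 0 ∧ d' 1 = 0 ∧ d' 7 = 0 ∧ d' 8 = 0 ∧ d' 6 = 0 := by
    obtain ⟨⟨-, t2, -, -, -, t6, t7, -, -, -, -⟩, t12, t13, t14, -, -⟩ := hg hd'
    exact ⟨t2.resolve_right c, t6.resolve_left c, t7.resolve_left c, t12.resolve_left z, (t13.resolve_left z).resolve_right c, (t14.resolve_left z).resolve_right c⟩
  have hm := hmax d' hd' ⟨z, c⟩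
  refine ext_fin_ten ⟨?_, ?_, ?_, ?_, ?_, ?_, ?_, ?_, ?_, ?_⟩ <;> omega

theorem no_corner (h0 : a 0 ≠ 0) (h1 : a 1 ≠ 0) (h3 : a 3 ≠ 0) (h4 : a 4 ≠ 0)
    (hg : g ∈ restrictSupport ℂ klmStd) (hker : klmHom a g = 0) {d : Fin 10 →₀ ℕ}
    (hd : d ∈ g.support) (hd0 : d 0 ≠ 0) : d 5 = 0 ∧ d 6 = 0 ∧ d 7 = 0 ∧ d 8 = 0 ∧ d 9 = 0 :=
  ⟨(no_corner_five h0 hg hker d hd).resolve_left hd0,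
    (no_corner_six h1 hg hker d hd).resolve_left hd0, (hg hd).2.1.resolve_left hd0,
    (no_corner_eight h3 hg hker d hd).resolve_left hd0,
    (no_corner_nine h4 hg hker d hd).resolve_left hd0⟩

/-- With the corners excluded, a monomial containing z₀ has μ-degree `-d 0`, while one without z₀
has μ-degree at least 0; so only monomials with the same z₀-exponent can interfere. The α-degree at
the vertex (2, 1) and the maximality of `d 1 + d 2` then force the vertex, and the rest is
determined because z₂ and z₃ do not occur together. -/
theorem degree_zero_eq_zero (h0 : a 0 ≠ 0) (h1 : a 1 ≠ 0) (h3 : a 3 ≠ 0) (h4 : a 4 ≠ 0)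
    (hg : g ∈ restrictSupport ℂ klmStd) (hker : klmHom a g = 0) :
    ∀ d ∈ g.support, d 0 = 0 := by
  by_contra! hne
  obtain ⟨d, hd, hd0, hmax⟩ := exists_max_of_mem_support (fun d => d 1 + d 2) _ hne
  refine coeff_eq_zero_of_klmHom hker 2 1 (by simp) (by rwa [(coeff_klmPoly a).1]) d hd
    fun d' hd' e he heq => ?_
  obtain ⟨e0, e1, e2, e3⟩ := klmExp_add_eq he heq
  obtain ⟨-, -, f1, f2, f3, f4⟩ := he
  obtain ⟨r5, r6, r7, r8, r9⟩ := no_corner h0 h1 h3 h4 hg hker hd hd0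
  by_cases z : d' 0 = 0
  · omega
  obtain ⟨q5, q6, q7, q8, q9⟩ := no_corner h0 h1 h3 h4 hg hker hd' z
  have hm := hmax d' hd' z
  have s1 := (hg hd).1.1
  have t1 := (hg hd').1.1
  refine ext_fin_ten ⟨?_, ?_, ?_, ?_, ?_, ?_, ?_, ?_, ?_, ?_⟩ <;> omega

/-- Here u + v is the P-degree and u + x - y a degree in α or β. The alternatives say that x is the
excess of the latter over the interval [0, u + v], y its deficit, and that both vanish inside the
interval; so x and y are functions of the two degrees. -/
theorem eq_of_clamp {u v x y u' v' x' y' : ℕ} (h : u' + v' = u + v)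
    (h' : u' + x' + y = u + x + y') (h1 : x = 0 ∨ y = 0) (h2 : x = 0 ∨ v = 0)
    (h3 : y = 0 ∨ u = 0) (h4 : x' = 0 ∨ y' = 0) (h5 : x' = 0 ∨ v' = 0) (h6 : y' = 0 ∨ u' = 0) :
    x' = x ∧ y' = y := by
  omega

/-- Once z₀ is gone, the remaining standard monomials are mapped to pairwise distinct monomials. -/
theorem eq_zero_of_klmHom_eq_zero (h0 : a 0 ≠ 0) (h1 : a 1 ≠ 0) (h3 : a 3 ≠ 0) (h4 : a 4 ≠ 0)
    (hg : g ∈ restrictSupport ℂ klmStd) (hker : klmHom a g = 0) : g = 0 := by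
  have hz := degree_zero_eq_zero h0 h1 h3 h4 hg hker
  rw [← support_eq_empty, Finset.eq_empty_iff_forall_notMem]
  intro d hd
  refine coeff_eq_zero_of_klmHom hker 2 1 (by simp) (by rwa [(coeff_klmPoly a).1]) d hd
    fun d' hd' e he heq => ?_
  obtain ⟨e0, e1, e2, e3⟩ := klmExp_add_eq he heq
  obtain ⟨-, -, f1, f2, f3, f4⟩ := he
  have z := hz d hd
  have z' := hz d' hd'
  rw [z'] at f1 f2 f3 f4
  have g2 : e 2 = 0 := by omega
  have g3 : e 3 = 0 := by omega
  rw [z, g2] at e2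
  rw [z, g3] at e3
  rw [z, z'] at e0 e1
  clear heq f1 f2 f3 f4
  obtain ⟨⟨s1, s2, s3, s4, s5, s6, s7, s8, s9, s10, s11⟩, -⟩ := hg hd
  obtain ⟨⟨t1, t2, t3, t4, t5, t6, t7, t8, t9, t10, t11⟩, -⟩ := hg hd'
  have hM : d' 1 + d' 2 + (d' 3 + d' 4) = d 1 + d 2 + (d 3 + d 4) := by
    clear * - e1; omega
  have hM' : d' 1 + d' 3 + (d' 2 + d' 4) = d 1 + d 3 + (d 2 + d 4) := by
    clear * - e1; omega
  have hA : d' 1 + d' 2 + d' 5 + d 9 = d 1 + d 2 + d 5 + d' 9 := by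
    clear * - e0 e1 e2; omega
  have hB : d' 1 + d' 3 + d' 6 + d 8 = d 1 + d 3 + d 6 + d' 8 := by
    clear * - e0 e1 e3; omega
  -- The α-degree fixes the corners z₅, z₉ and the β-degree fixes z₆, z₈. The degrees left over
  -- determine z₁, …, z₄, because z₂z₃ is not standard, and then z₇.
  have c59 : d' 5 = d 5 ∧ d' 9 = d 9 :=
    eq_of_clamp hM hA s2 (by clear * - s4 s5; omega) (by clear * - s6 s7; omega)
      t2 (by clear * - t4 t5; omega) (by clear * - t6 t7; omega)
  have c68 : d' 6 = d 6 ∧ d' 8 = d 8 :=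
    eq_of_clamp hM' hB s3 (by clear * - s8 s9; omega) (by clear * - s10 s11; omega)
      t3 (by clear * - t8 t9; omega) (by clear * - t10 t11; omega)
  obtain ⟨c5, c9⟩ := c59
  obtain ⟨c6, c8⟩ := c68
  clear s2 s3 s4 s5 s6 s7 s8 s9 s10 s11 t2 t3 t4 t5 t6 t7 t8 t9 t10 t11
  refine ext_fin_ten ⟨?_, ?_, ?_, ?_, ?_, ?_, ?_, ?_, ?_, ?_⟩ <;> omega

theorem homIdeal_klm9_eq_klmIdeal (h0 : a 0 ≠ 0) (h1 : a 1 ≠ 0) (h3 : a 3 ≠ 0) (h4 : a 4 ≠ 0) :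
    homIdeal (klm9 a) = klmIdeal a := by
  have hle : klmIdeal a ≤ homIdeal (klm9 a) := by
    refine Ideal.span_le.2 ?_
    rintro _ ⟨i, rfl⟩
    exact klmRel_mem_homIdeal a i
  refine le_antisymm (le_of_normalForm hle (klmIdeal_normalForm a) fun g hg hI => ?_) hle
  rw [homIdeal_klm9] at hI
  exact eq_zero_of_klmHom_eq_zero h0 h1 h3 h4 hg hI

theorem homIdeal_klm9_eq_span (h0 : a 0 ≠ 0) (h1 : a 1 ≠ 0) (h3 : a 3 ≠ 0) (h4 : a 4 ≠ 0) :
    homIdeal (klm9 a) = Ideal.span {f | f ∈ homIdeal (klm9 a) ∧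
      (f.IsHomogeneous 2 ∨ f.IsHomogeneous 3)} := by
  refine le_antisymm ?_ (Ideal.span_le.2 fun f hf => hf.1)
  conv_lhs => rw [homIdeal_klm9_eq_klmIdeal h0 h1 h3 h4]
  refine Ideal.span_mono ?_
  rintro _ ⟨i, rfl⟩
  exact ⟨klmRel_mem_homIdeal a i, klmRel_isHomogeneous a i⟩

end

section

/-! ### Tangent vectors -/

/-- The derivative of `f` at `z` in the direction `v`. -/
def dirDeriv (z v : Fin (n + 1) → ℂ) (f : CoordRing n) : ℂ := ∑ i, eval z (pderiv i f) * v i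

section

variable (z v : Fin (n + 1) → ℂ)

@[simp] theorem dirDeriv_X (i : Fin (n + 1)) : dirDeriv z v (X i) = v i := by
  rw [dirDeriv, Finset.sum_eq_single i]
  · simp
  · intro j _ hj
    rw [pderiv_X_of_ne hj.symm]
    simp
  · simp

@[simp] theorem dirDeriv_C (c : ℂ) : dirDeriv z v (C c) = 0 := by simp [dirDeriv]

@[simp] theorem dirDeriv_add (f g : CoordRing n) :
    dirDeriv z v (f + g) = dirDeriv z v f + dirDeriv z v g := by
  simp [dirDeriv, add_mul, Finset.sum_add_distrib]

@[simp] theorem dirDeriv_sub (f g : CoordRing n) :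
    dirDeriv z v (f - g) = dirDeriv z v f - dirDeriv z v g := by
  simp [dirDeriv, sub_mul, Finset.sum_sub_distrib]

@[simp] theorem dirDeriv_mul (f g : CoordRing n) :
    dirDeriv z v (f * g) = eval z f * dirDeriv z v g + dirDeriv z v f * eval z g := by
  simp only [dirDeriv, Derivation.leibniz, map_add, smul_eq_mul, map_mul, add_mul,
    Finset.sum_add_distrib, Finset.mul_sum, Finset.sum_mul]
  congr 1 <;> exact Finset.sum_congr rfl fun i _ => by ring

end

theorem dirDeriv_eq_zero {X : Set (PSpace n)} {p : PSpace n} {v : Fin (n + 1) → ℂ}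
    (hv : v ∈ tangentSpace X p) {f : CoordRing n} (hf : f ∈ homIdeal X) :
    dirDeriv p.rep v f = 0 := hv f hf

/-- By the product rule, at a point where the generators vanish the derivative of a multiple is a
multiple of the derivative, so generators suffice. -/
theorem mem_tangentSpace_of_span {X : Set (PSpace n)} {p : PSpace n} {v : Fin (n + 1) → ℂ}
    {ι : Type*} {g : ι → CoordRing n} (hX : homIdeal X = Ideal.span (Set.range g))
    (h0 : ∀ i, eval p.rep (g i) = 0) (h : ∀ i, dirDeriv p.rep v (g i) = 0) :
    v ∈ tangentSpace X p := by
  suffices ∀ f ∈ Ideal.span (Set.range g), eval p.rep f = 0 ∧ dirDeriv p.rep v f = 0 from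
    fun f hf => (this f (hX ▸ hf)).2
  intro f hf
  induction hf using Submodule.span_induction with
  | mem f hf => obtain ⟨i, rfl⟩ := hf; exact ⟨h0 i, h i⟩
  | zero => exact ⟨map_zero _, by simp [dirDeriv]⟩
  | add f g _ _ hf hg => exact ⟨by simp [hf.1, hg.1], by simp [hf.2, hg.2]⟩
  | smul f g _ hg => exact ⟨by simp [hg.1], by simp [hg.1, hg.2]⟩

theorem finrank_le_of_coordinates {m : ℕ} {T : Submodule ℂ (Fin (n + 1) → ℂ)}
    (s : Fin m → Fin (n + 1)) (h : ∀ v ∈ T, (∀ k, v (s k) = 0) → v = 0) :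
    Module.finrank ℂ T ≤ m := by
  have hinj : Function.Injective ((LinearMap.funLeft ℂ ℂ s).domRestrict T) := by
    rw [← LinearMap.ker_eq_bot, LinearMap.ker_eq_bot']
    rintro ⟨v, hv⟩ h0
    exact Subtype.ext (h v hv fun k => congrFun h0 k)
  simpa using LinearMap.finrank_le_finrank_of_injective hinj

theorem le_finrank_of_single_mem {m : ℕ} {T : Submodule ℂ (Fin (n + 1) → ℂ)}
    (s : Fin m → Fin (n + 1)) (hs : Function.Injective s)
    (h : ∀ k, Pi.single (s k) (1 : ℂ) ∈ T) : m ≤ Module.finrank ℂ T := by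
  have h1 : LinearIndependent ℂ fun k => (⟨Pi.single (s k) 1, h k⟩ : T) := by
    refine LinearIndependent.of_comp T.subtype ?_
    have := (Pi.basisFun ℂ (Fin (n + 1))).linearIndependent.comp s hs
    convert this using 1
    ext k i
    simp
  simpa using h1.fintype_card_le_finrank

/-! ### Singular points of the threefold of genus 9 -/

/-- The equations of the threefold of genus 9, in terms of coordinates. -/
structure KlmPoint (b : Fin 5 → ℂ) (z : Fin 10 → ℂ) : Prop where
  e0 : z 2 * z 3 = z 1 * z 4
  e1 : z 5 * z 9 = z 7 * z 7
  e2 : z 6 * z 8 = z 7 * z 7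
  e3 : z 5 * z 4 = z 7 * z 2
  e4 : z 5 * z 3 = z 7 * z 1
  e5 : z 9 * z 2 = z 7 * z 4
  e6 : z 9 * z 1 = z 7 * z 3
  e7 : z 6 * z 4 = z 7 * z 3
  e8 : z 6 * z 2 = z 7 * z 1
  e9 : z 8 * z 3 = z 7 * z 4
  e10 : z 8 * z 1 = z 7 * z 2
  e11 : z 0 * z 7 = b 0 * (z 1 * z 2) + b 1 * (z 1 * z 3) + b 2 * (z 1 * z 4) + b 3 * (z 2 * z 4) + b 4 * (z 3 * z 4)
  e12 : z 0 * z 8 * z 9 = z 4 * z 4 * (b 0 * z 5 + b 1 * z 6 + b 2 * z 7 + b 3 * z 8 + b 4 * z 9)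
  e13 : z 0 * z 6 * z 9 = z 3 * z 3 * (b 0 * z 5 + b 1 * z 6 + b 2 * z 7 + b 3 * z 8 + b 4 * z 9)
  e14 : z 0 * z 5 * z 8 = z 2 * z 2 * (b 0 * z 5 + b 1 * z 6 + b 2 * z 7 + b 3 * z 8 + b 4 * z 9)
  e15 : z 0 * z 5 * z 6 = z 1 * z 1 * (b 0 * z 5 + b 1 * z 6 + b 2 * z 7 + b 3 * z 8 + b 4 * z 9)

/-- The equations of the tangent spaces to the threefold of genus 9, in terms of coordinates. -/
structure KlmTangent (b : Fin 5 → ℂ) (z v : Fin 10 → ℂ) : Prop where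
  e0 : (z 2 * v 3 + v 2 * z 3) = (z 1 * v 4 + v 1 * z 4)
  e1 : (z 5 * v 9 + v 5 * z 9) = (z 7 * v 7 + v 7 * z 7)
  e2 : (z 6 * v 8 + v 6 * z 8) = (z 7 * v 7 + v 7 * z 7)
  e3 : (z 5 * v 4 + v 5 * z 4) = (z 7 * v 2 + v 7 * z 2)
  e4 : (z 5 * v 3 + v 5 * z 3) = (z 7 * v 1 + v 7 * z 1)
  e5 : (z 9 * v 2 + v 9 * z 2) = (z 7 * v 4 + v 7 * z 4)
  e6 : (z 9 * v 1 + v 9 * z 1) = (z 7 * v 3 + v 7 * z 3)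
  e7 : (z 6 * v 4 + v 6 * z 4) = (z 7 * v 3 + v 7 * z 3)
  e8 : (z 6 * v 2 + v 6 * z 2) = (z 7 * v 1 + v 7 * z 1)
  e9 : (z 8 * v 3 + v 8 * z 3) = (z 7 * v 4 + v 7 * z 4)
  e10 : (z 8 * v 1 + v 8 * z 1) = (z 7 * v 2 + v 7 * z 2)
  e11 : z 0 * v 7 + v 0 * z 7 =
    b 0 * (z 1 * v 2 + v 1 * z 2) + b 1 * (z 1 * v 3 + v 1 * z 3) + b 2 * (z 1 * v 4 + v 1 * z 4) + b 3 * (z 2 * v 4 + v 2 * z 4) + b 4 * (z 3 * v 4 + v 3 * z 4)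
  e12 : v 0 * z 8 * z 9 + z 0 * v 8 * z 9 + z 0 * z 8 * v 9 =
    2 * z 4 * v 4 * (b 0 * z 5 + b 1 * z 6 + b 2 * z 7 + b 3 * z 8 + b 4 * z 9) + z 4 * z 4 *
      (b 0 * v 5 + b 1 * v 6 + b 2 * v 7 + b 3 * v 8 + b 4 * v 9)
  e13 : v 0 * z 6 * z 9 + z 0 * v 6 * z 9 + z 0 * z 6 * v 9 =
    2 * z 3 * v 3 * (b 0 * z 5 + b 1 * z 6 + b 2 * z 7 + b 3 * z 8 + b 4 * z 9) + z 3 * z 3 *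
      (b 0 * v 5 + b 1 * v 6 + b 2 * v 7 + b 3 * v 8 + b 4 * v 9)
  e14 : v 0 * z 5 * z 8 + z 0 * v 5 * z 8 + z 0 * z 5 * v 8 =
    2 * z 2 * v 2 * (b 0 * z 5 + b 1 * z 6 + b 2 * z 7 + b 3 * z 8 + b 4 * z 9) + z 2 * z 2 *
      (b 0 * v 5 + b 1 * v 6 + b 2 * v 7 + b 3 * v 8 + b 4 * v 9)
  e15 : v 0 * z 5 * z 6 + z 0 * v 5 * z 6 + z 0 * z 5 * v 6 =
    2 * z 1 * v 1 * (b 0 * z 5 + b 1 * z 6 + b 2 * z 7 + b 3 * z 8 + b 4 * z 9) + z 1 * z 1 *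
      (b 0 * v 5 + b 1 * v 6 + b 2 * v 7 + b 3 * v 8 + b 4 * v 9)

theorem klmPoint_iff {a : Fin 14 → ℂ} {z : Fin 10 → ℂ} :
    KlmPoint ![a 0, a 1, a 2, a 3, a 4] z ↔ ∀ i, eval z (klmRel a i) = 0 := by
  constructor
  · intro h i
    rw [klmRel]
    fin_cases i
    · have := h.e0
      simp [klmForm] at this ⊢
      linear_combination this
    · have := h.e1
      simp [klmForm] at this ⊢
      linear_combination this
    · have := h.e2
      simp [klmForm] at this ⊢
      linear_combination this
    · have := h.e3
      simp [klmForm] at this ⊢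
      linear_combination this
    · have := h.e4
      simp [klmForm] at this ⊢
      linear_combination this
    · have := h.e5
      simp [klmForm] at this ⊢
      linear_combination this
    · have := h.e6
      simp [klmForm] at this ⊢
      linear_combination this
    · have := h.e7
      simp [klmForm] at this ⊢
      linear_combination this
    · have := h.e8
      simp [klmForm] at this ⊢
      linear_combination this
    · have := h.e9
      simp [klmForm] at this ⊢
      linear_combination this
    · have := h.e10
      simp [klmForm] at this ⊢
      linear_combination this
    · have := h.e11
      simp [klmForm] at this ⊢
      linear_combination this
    · have := h.e12
      simp [klmForm] at this ⊢
      linear_combination this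
    · have := h.e13
      simp [klmForm] at this ⊢
      linear_combination this
    · have := h.e14
      simp [klmForm] at this ⊢
      linear_combination this
    · have := h.e15
      simp [klmForm] at this ⊢
      linear_combination this
  · intro h
    constructor
    · have := h 0
      simp [klmRel, klmForm] at this ⊢
      linear_combination this
    · have := h 1
      simp [klmRel, klmForm] at this ⊢
      linear_combination this
    · have := h 2
      simp [klmRel, klmForm] at this ⊢
      linear_combination this
    · have := h 3
      simp [klmRel, klmForm] at this ⊢
      linear_combination this
    · have := h 4
      simp [klmRel, klmForm] at this ⊢
      linear_combination this
    · have := h 5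
      simp [klmRel, klmForm] at this ⊢
      linear_combination this
    · have := h 6
      simp [klmRel, klmForm] at this ⊢
      linear_combination this
    · have := h 7
      simp [klmRel, klmForm] at this ⊢
      linear_combination this
    · have := h 8
      simp [klmRel, klmForm] at this ⊢
      linear_combination this
    · have := h 9
      simp [klmRel, klmForm] at this ⊢
      linear_combination this
    · have := h 10
      simp [klmRel, klmForm] at this ⊢
      linear_combination this
    · have := h 11
      simp [klmRel, klmForm] at this ⊢
      linear_combination this
    · have := h 12
      simp [klmRel, klmForm] at this ⊢
      linear_combination this
    · have := h 13
      simp [klmRel, klmForm] at this ⊢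
      linear_combination this
    · have := h 14
      simp [klmRel, klmForm] at this ⊢
      linear_combination this
    · have := h 15
      simp [klmRel, klmForm] at this ⊢
      linear_combination this

theorem klmTangent_iff {a : Fin 14 → ℂ} {z v : Fin 10 → ℂ} :
    KlmTangent ![a 0, a 1, a 2, a 3, a 4] z v ↔ ∀ i, dirDeriv z v (klmRel a i) = 0 := by
  constructor
  · intro h i
    rw [klmRel]
    fin_cases i
    · have := h.e0
      simp [klmForm] at this ⊢
      linear_combination this
    · have := h.e1
      simp [klmForm] at this ⊢
      linear_combination this
    · have := h.e2
      simp [klmForm] at this ⊢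
      linear_combination this
    · have := h.e3
      simp [klmForm] at this ⊢
      linear_combination this
    · have := h.e4
      simp [klmForm] at this ⊢
      linear_combination this
    · have := h.e5
      simp [klmForm] at this ⊢
      linear_combination this
    · have := h.e6
      simp [klmForm] at this ⊢
      linear_combination this
    · have := h.e7
      simp [klmForm] at this ⊢
      linear_combination this
    · have := h.e8
      simp [klmForm] at this ⊢
      linear_combination this
    · have := h.e9
      simp [klmForm] at this ⊢
      linear_combination this
    · have := h.e10
      simp [klmForm] at this ⊢
      linear_combination this
    · have := h.e11
      simp [klmForm] at this ⊢
      linear_combination this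
    · have := h.e12
      simp [klmForm] at this ⊢
      linear_combination this
    · have := h.e13
      simp [klmForm] at this ⊢
      linear_combination this
    · have := h.e14
      simp [klmForm] at this ⊢
      linear_combination this
    · have := h.e15
      simp [klmForm] at this ⊢
      linear_combination this
  · intro h
    constructor
    · have := h 0
      simp [klmRel, klmForm] at this ⊢
      linear_combination this
    · have := h 1
      simp [klmRel, klmForm] at this ⊢
      linear_combination this
    · have := h 2
      simp [klmRel, klmForm] at this ⊢
      linear_combination this
    · have := h 3
      simp [klmRel, klmForm] at this ⊢
      linear_combination this
    · have := h 4
      simp [klmRel, klmForm] at this ⊢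
      linear_combination this
    · have := h 5
      simp [klmRel, klmForm] at this ⊢
      linear_combination this
    · have := h 6
      simp [klmRel, klmForm] at this ⊢
      linear_combination this
    · have := h 7
      simp [klmRel, klmForm] at this ⊢
      linear_combination this
    · have := h 8
      simp [klmRel, klmForm] at this ⊢
      linear_combination this
    · have := h 9
      simp [klmRel, klmForm] at this ⊢
      linear_combination this
    · have := h 10
      simp [klmRel, klmForm] at this ⊢
      linear_combination this
    · have := h 11
      simp [klmRel, klmForm] at this ⊢
      linear_combination this
    · have := h 12
      simp [klmRel, klmForm] at this ⊢
      linear_combination this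
    · have := h 13
      simp [klmRel, klmForm] at this ⊢
      linear_combination this
    · have := h 14
      simp [klmRel, klmForm] at this ⊢
      linear_combination this
    · have := h 15
      simp [klmRel, klmForm] at this ⊢
      linear_combination this

/-- The symmetry of the coordinates which inverts the first toric parameter. -/
def flipPerm : Fin 10 → Fin 10 := ![0, 3, 4, 1, 2, 9, 6, 7, 8, 5]

/-- The substitution α ↦ 1/α, P ↦ Pα preserves the parametrization and exchanges b₀ with b₄, since
α²G(1/α, β) is G with these two coefficients exchanged. -/
theorem KlmPoint.flip {b : Fin 5 → ℂ} {z : Fin 10 → ℂ} (h : KlmPoint b z) :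
    KlmPoint (b ∘ (![4, 1, 2, 3, 0] : Fin 5 → Fin 5)) (z ∘ flipPerm) := by
  constructor
  · simp [flipPerm]; linear_combination -h.e0
  · simp [flipPerm]; linear_combination h.e1
  · simp [flipPerm]; linear_combination h.e2
  · simp [flipPerm]; linear_combination h.e5
  · simp [flipPerm]; linear_combination h.e6
  · simp [flipPerm]; linear_combination h.e3
  · simp [flipPerm]; linear_combination h.e4
  · simp [flipPerm]; linear_combination h.e8
  · simp [flipPerm]; linear_combination h.e7
  · simp [flipPerm]; linear_combination h.e10
  · simp [flipPerm]; linear_combination h.e9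
  -- The term z₁z₄ of the quadric turns into z₃z₂, which is brought back by the equation of the
  -- square.
  · simp [flipPerm]; linear_combination h.e11 - b 2 * h.e0
  · simp [flipPerm]; linear_combination h.e14
  · simp [flipPerm]; linear_combination h.e15
  · simp [flipPerm]; linear_combination h.e12
  · simp [flipPerm]; linear_combination h.e13

theorem KlmTangent.flip {b : Fin 5 → ℂ} {z v : Fin 10 → ℂ} (h : KlmTangent b z v) :
    KlmTangent (b ∘ (![4, 1, 2, 3, 0] : Fin 5 → Fin 5)) (z ∘ flipPerm) (v ∘ flipPerm) := by
  constructor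
  · simp [flipPerm]; linear_combination -h.e0
  · simp [flipPerm]; linear_combination h.e1
  · simp [flipPerm]; linear_combination h.e2
  · simp [flipPerm]; linear_combination h.e5
  · simp [flipPerm]; linear_combination h.e6
  · simp [flipPerm]; linear_combination h.e3
  · simp [flipPerm]; linear_combination h.e4
  · simp [flipPerm]; linear_combination h.e8
  · simp [flipPerm]; linear_combination h.e7
  · simp [flipPerm]; linear_combination h.e10
  · simp [flipPerm]; linear_combination h.e9
  · simp [flipPerm]; linear_combination h.e11 - b 2 * h.e0
  · simp [flipPerm]; linear_combination h.e14
  · simp [flipPerm]; linear_combination h.e15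
  · simp [flipPerm]; linear_combination h.e12
  · simp [flipPerm]; linear_combination h.e13

/-- The symmetry of the coordinates which exchanges the toric parameters. -/
def swapPerm : Fin 10 → Fin 10 := ![0, 1, 3, 2, 4, 6, 5, 7, 9, 8]

/-- Exchanging α and β exchanges b₀ with b₁ and b₃ with b₄. -/
theorem KlmPoint.swap {b : Fin 5 → ℂ} {z : Fin 10 → ℂ} (h : KlmPoint b z) :
    KlmPoint (b ∘ (![1, 0, 2, 4, 3] : Fin 5 → Fin 5)) (z ∘ swapPerm) := by
  constructor
  · simp [swapPerm]; linear_combination h.e0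
  · simp [swapPerm]; linear_combination h.e2
  · simp [swapPerm]; linear_combination h.e1
  · simp [swapPerm]; linear_combination h.e7
  · simp [swapPerm]; linear_combination h.e8
  · simp [swapPerm]; linear_combination h.e9
  · simp [swapPerm]; linear_combination h.e10
  · simp [swapPerm]; linear_combination h.e3
  · simp [swapPerm]; linear_combination h.e4
  · simp [swapPerm]; linear_combination h.e5
  · simp [swapPerm]; linear_combination h.e6
  · simp [swapPerm]; linear_combination h.e11
  · simp [swapPerm]; linear_combination h.e12
  · simp [swapPerm]; linear_combination h.e14
  · simp [swapPerm]; linear_combination h.e13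
  · simp [swapPerm]; linear_combination h.e15

theorem KlmTangent.swap {b : Fin 5 → ℂ} {z v : Fin 10 → ℂ} (h : KlmTangent b z v) :
    KlmTangent (b ∘ (![1, 0, 2, 4, 3] : Fin 5 → Fin 5)) (z ∘ swapPerm) (v ∘ swapPerm) := by
  constructor
  · simp [swapPerm]; linear_combination h.e0
  · simp [swapPerm]; linear_combination h.e2
  · simp [swapPerm]; linear_combination h.e1
  · simp [swapPerm]; linear_combination h.e7
  · simp [swapPerm]; linear_combination h.e8
  · simp [swapPerm]; linear_combination h.e9
  · simp [swapPerm]; linear_combination h.e10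
  · simp [swapPerm]; linear_combination h.e3
  · simp [swapPerm]; linear_combination h.e4
  · simp [swapPerm]; linear_combination h.e5
  · simp [swapPerm]; linear_combination h.e6
  · simp [swapPerm]; linear_combination h.e11
  · simp [swapPerm]; linear_combination h.e12
  · simp [swapPerm]; linear_combination h.e14
  · simp [swapPerm]; linear_combination h.e13
  · simp [swapPerm]; linear_combination h.e15

end

/-! ### Regular points and determination of the singular locus -/

section

/-- The tangent space at `z` is cut out in coordinates by at most four free parameters. -/
def KlmRegular (b : Fin 5 → ℂ) (z : Fin 10 → ℂ) : Prop :=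
  ∃ s : Fin 4 → Fin 10, ∀ v, KlmTangent b z v → (∀ k, v (s k) = 0) → v = 0

theorem KlmRegular.of_flip {b : Fin 5 → ℂ} {z : Fin 10 → ℂ}
    (h : KlmRegular (b ∘ ![4, 1, 2, 3, 0]) (z ∘ flipPerm)) : KlmRegular b z := by
  obtain ⟨s, hs⟩ := h
  refine ⟨flipPerm ∘ s, fun v hv h0 => ?_⟩
  have h1 := hs _ hv.flip h0
  have h2 : ∀ i, flipPerm (flipPerm i) = i := by decide
  ext i
  simpa [h2] using congrFun h1 (flipPerm i)

theorem KlmRegular.of_swap {b : Fin 5 → ℂ} {z : Fin 10 → ℂ}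
    (h : KlmRegular (b ∘ ![1, 0, 2, 4, 3]) (z ∘ swapPerm)) : KlmRegular b z := by
  obtain ⟨s, hs⟩ := h
  refine ⟨swapPerm ∘ s, fun v hv h0 => ?_⟩
  have h1 := hs _ hv.swap h0
  have h2 : ∀ i, swapPerm (swapPerm i) = i := by decide
  ext i
  simpa [h2] using congrFun h1 (swapPerm i)

/-- The conditions on the coefficients of the sextic surface. -/
structure KlmGeneral (b : Fin 5 → ℂ) : Prop where
  h0 : b 0 ≠ 0
  h1 : b 1 ≠ 0
  h3 : b 3 ≠ 0
  h4 : b 4 ≠ 0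
  disc : (b 2 ^ 2 - 4 * b 0 * b 4 - 4 * b 1 * b 3) ^ 2 ≠ 64 * b 0 * b 1 * b 3 * b 4

theorem KlmGeneral.flip {b : Fin 5 → ℂ} (h : KlmGeneral b) :
    KlmGeneral (b ∘ ![4, 1, 2, 3, 0]) := by
  refine ⟨h.h4, h.h1, h.h3, h.h0, fun e => h.disc ?_⟩
  simp at e
  linear_combination e

theorem KlmGeneral.swap {b : Fin 5 → ℂ} (h : KlmGeneral b) :
    KlmGeneral (b ∘ ![1, 0, 2, 4, 3]) := by
  refine ⟨h.h1, h.h0, h.h4, h.h3, fun e => h.disc ?_⟩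
  simp at e
  linear_combination e

variable {b : Fin 5 → ℂ} {z : Fin 10 → ℂ}

theorem vec_ten_eq_zero {v : Fin 10 → ℂ} (h : v 0 = 0 ∧ v 1 = 0 ∧ v 2 = 0 ∧ v 3 = 0 ∧ v 4 = 0 ∧
    v 5 = 0 ∧ v 6 = 0 ∧ v 7 = 0 ∧ v 8 = 0 ∧ v 9 = 0) : v = 0 := by
  ext i
  obtain ⟨h0, h1, h2, h3, h4, h5, h6, h7, h8, h9⟩ := h
  fin_cases i <;> assumption

theorem four_eq_zero {v : Fin 10 → ℂ} {i j k l : Fin 10} (h : ∀ m, v (![i, j, k, l] m) = 0) :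
    v i = 0 ∧ v j = 0 ∧ v k = 0 ∧ v l = 0 := ⟨h 0, h 1, h 2, h 3⟩

/-- Where z₇ ≠ 0 also z₅ and z₆ are nonzero, and the equations express all coordinates rationally in
z₄, z₅, z₆, z₇. -/
theorem klmRegular_of_seven (hz : KlmPoint b z) (h7 : z 7 ≠ 0) : KlmRegular b z := by
  have h5 : z 5 ≠ 0 := fun h => h7 (by simpa [h] using hz.e1)
  have h6 : z 6 ≠ 0 := fun h => h7 (by simpa [h] using hz.e2)
  refine ⟨![4, 5, 6, 7], fun v hv h0 => ?_⟩
  obtain ⟨v4, v5, v6, v7⟩ := four_eq_zero h0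
  have v9 : v 9 = 0 := by simpa [v5, v7, h5] using hv.e1
  have v8 : v 8 = 0 := by simpa [v6, v7, h6] using hv.e2
  have v2 : v 2 = 0 := by simpa [v4, v5, v7, h7] using hv.e3
  have v3 : v 3 = 0 := by simpa [v4, v6, v7, h7] using hv.e7
  have v1 : v 1 = 0 := by simpa [v3, v5, v7, h7] using hv.e4
  have v0 : v 0 = 0 := by simpa [v1, v2, v3, v4, v7, h7] using hv.e11
  exact vec_ten_eq_zero ⟨v0, v1, v2, v3, v4, v5, v6, v7, v8, v9⟩

/-- Near the ninth coordinate point with z₇ = 0, not both z₆ and z₈ are nonzero. If one of them is,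
a cubic determines `v 0`; if neither is, the point lies on the line joining the coordinate points 9
and 0, and being different from the former it has z₀ ≠ 0. -/
theorem klmRegular_of_nine (hb : KlmGeneral b) (hz : KlmPoint b z) (h7 : z 7 = 0) (h9 : z 9 ≠ 0)
    (hne : ∃ i, i ≠ 9 ∧ z i ≠ 0) : KlmRegular b z := by
  have h5 : z 5 = 0 := by simpa [h7, h9] using hz.e1
  have h2 : z 2 = 0 := by simpa [h7, h9] using hz.e5
  have h1 : z 1 = 0 := by simpa [h7, h9] using hz.e6
  by_cases h8 : z 8 = 0
  · by_cases h6 : z 6 = 0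
    · have h4 : z 4 = 0 := by simpa [h5, h6, h7, h8, h9, hb.h4] using hz.e12
      have h3 : z 3 = 0 := by simpa [h5, h6, h7, h8, h9, hb.h4] using hz.e13
      have hz0 : z 0 ≠ 0 := by
        rintro hz0
        obtain ⟨i, hi, hi'⟩ := hne
        fin_cases i <;> simp_all
      refine ⟨![0, 3, 4, 9], fun v hv h0 => ?_⟩
      obtain ⟨v0, v3, v4, v9⟩ := four_eq_zero h0
      have v5 : v 5 = 0 := by simpa [h5, h7, h9] using hv.e1
      have v2 : v 2 = 0 := by simpa [h2, h4, h7, h9] using hv.e5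
      have v1 : v 1 = 0 := by simpa [h1, h3, h7, h9] using hv.e6
      have v7 : v 7 = 0 := by simpa [h1, h2, h3, h4, h7, hz0] using hv.e11
      have v8 : v 8 = 0 := by simpa [h4, h8, hz0, h9] using hv.e12
      have v6 : v 6 = 0 := by simpa [h3, h6, hz0, h9] using hv.e13
      exact vec_ten_eq_zero ⟨v0, v1, v2, v3, v4, v5, v6, v7, v8, v9⟩
    · have h4 : z 4 = 0 := by simpa [h7, h6] using hz.e7
      refine ⟨![3, 6, 7, 9], fun v hv h0 => ?_⟩
      obtain ⟨v3, v6, v7, v9⟩ := four_eq_zero h0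
      have v5 : v 5 = 0 := by simpa [h5, h7, h9] using hv.e1
      have v2 : v 2 = 0 := by simpa [h2, h4, h7, h9, v7, v9] using hv.e5
      have v1 : v 1 = 0 := by simpa [h1, h7, h9, v7, v9] using hv.e6
      have v4 : v 4 = 0 := by simpa [h4, h6, h7, v7, v6] using hv.e7
      have v8 : v 8 = 0 := by simpa [h6, h8, h7, v7, v6] using hv.e2
      have v0 : v 0 = 0 := by
        simpa [h5, h7, h8, h6, h9, v3, v5, v6, v7, v8, v9] using hv.e13
      exact vec_ten_eq_zero ⟨v0, v1, v2, v3, v4, v5, v6, v7, v8, v9⟩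
  · have h6 : z 6 = 0 := by simpa [h7, h8] using hz.e2
    have h3 : z 3 = 0 := by simpa [h7, h8] using hz.e9
    refine ⟨![4, 7, 8, 9], fun v hv h0 => ?_⟩
    obtain ⟨v4, v7, v8, v9⟩ := four_eq_zero h0
    have v5 : v 5 = 0 := by simpa [h5, h7, h9] using hv.e1
    have v2 : v 2 = 0 := by simpa [h2, h7, h9, v7, v9] using hv.e5
    have v1 : v 1 = 0 := by simpa [h1, h7, h9, v7, v9] using hv.e6
    have v3 : v 3 = 0 := by simpa [h3, h8, h7, v7, v8] using hv.e9
    have v6 : v 6 = 0 := by simpa [h6, h8, h7, v7, v8] using hv.e2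
    have v0 : v 0 = 0 := by
      simpa [h5, h7, h8, h6, h9, v4, v5, v6, v7, v8, v9] using hv.e12
    exact vec_ten_eq_zero ⟨v0, v1, v2, v3, v4, v5, v6, v7, v8, v9⟩

/-- The conditions on the coefficients say that the curve of genus one is nonsingular. -/
theorem KlmGeneral.gradient_ne_zero (hb : KlmGeneral b) {x y w : ℂ} (hx : x ≠ 0) (hy : y ≠ 0)
    (hw : w ≠ 0)
    (hG : b 0 * x ^ 2 * y + b 1 * x * y ^ 2 + b 2 * x * y * w + b 3 * x * w ^ 2 + b 4 * y * w ^ 2 = 0)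
    (hA : 2 * b 0 * x * y + b 1 * y ^ 2 + b 2 * y * w + b 3 * w ^ 2 = 0)
    (hB : b 0 * x ^ 2 + 2 * b 1 * x * y + b 2 * x * w + b 4 * w ^ 2 = 0) : False := by
  -- Up to the factors y and x, these are the combinations xA - G and yB - G of the cubic with its
  -- partial derivatives. Together with the value of b₂w they determine x², y² and xy up to w², and
  -- squaring the last one produces the excluded discriminant.
  have h1 : b 0 * x ^ 2 = b 4 * w ^ 2 := by
    have : y * (b 0 * x ^ 2 - b 4 * w ^ 2) = 0 := by linear_combination x * hA - hG
    linear_combination (mul_eq_zero.1 this).resolve_left hy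
  have h2 : b 1 * y ^ 2 = b 3 * w ^ 2 := by
    have : x * (b 1 * y ^ 2 - b 3 * w ^ 2) = 0 := by linear_combination y * hB - hG
    linear_combination (mul_eq_zero.1 this).resolve_left hx
  have h3 : b 2 * w = -(2 * b 0 * x + 2 * b 1 * y) := by
    have : x * (b 2 * w + (2 * b 0 * x + 2 * b 1 * y)) = 0 := by
      linear_combination hB + h1
    linear_combination (mul_eq_zero.1 this).resolve_left hx
  refine hb.disc (mul_right_cancel₀ (pow_ne_zero 4 hw) ?_)
  have h4 : (b 2 ^ 2 - 4 * b 0 * b 4 - 4 * b 1 * b 3) * w ^ 2 = 8 * b 0 * b 1 * x * y := by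
    linear_combination (b 2 * w - (2 * b 0 * x + 2 * b 1 * y)) * h3 + 4 * b 0 * h1 + 4 * b 1 * h2
  calc (b 2 ^ 2 - 4 * b 0 * b 4 - 4 * b 1 * b 3) ^ 2 * w ^ 4
      = ((b 2 ^ 2 - 4 * b 0 * b 4 - 4 * b 1 * b 3) * w ^ 2) ^ 2 := by ring
    _ = 64 * b 0 * b 1 * (b 0 * x ^ 2) * (b 1 * y ^ 2) := by rw [h4]; ring
    _ = 64 * b 0 * b 1 * b 3 * b 4 * w ^ 4 := by rw [h1, h2]; ring

/-- Such a point lies on the cone, with vertex the coordinate point 0, over the curve z₂z₃ = z₁z₄, G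
= 0. If z₂ ≠ 0, the four directions are those of z₀ and z₄ (vertex and scale), one along the
nonsingular curve, and z₇; the point with z₂ = 0 is treated separately. -/
theorem klmRegular_of_four (hb : KlmGeneral b) (hz : KlmPoint b z) (h5 : z 5 = 0) (h6 : z 6 = 0)
    (h7 : z 7 = 0) (h8 : z 8 = 0) (h9 : z 9 = 0) (h4 : z 4 ≠ 0) : KlmRegular b z := by
  have hG := hz.e11
  have h14 := hz.e0
  by_cases h2 : z 2 = 0
  · have h1 : z 1 = 0 := by simpa [h2, h4] using h14
    have h3 : z 3 = 0 := by simpa [h1, h2, h7, h4, hb.h4] using hG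
    refine ⟨![0, 2, 4, 8], fun v hv h0 => ?_⟩
    obtain ⟨v0, v2, v4, v8⟩ := four_eq_zero h0
    have v1 : v 1 = 0 := by simpa [h1, h2, h3, v2, v4, h4] using hv.e0
    have v5 : v 5 = 0 := by simpa [h5, h2, h7, v2, v4, h4] using hv.e3
    have v6 : v 6 = 0 := by simpa [h6, h3, h7, v4, h4] using hv.e7
    have v7 : v 7 = 0 := by simpa [h8, h3, h7, v4, v8, h4] using hv.e9
    have v3 : v 3 = 0 := by simpa [h1, h2, h3, v1, v2, v4, v7, v0, h4, hb.h4] using hv.e11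
    have v9 : v 9 = 0 := by
      simpa [h5, h6, h7, h8, h9, v4, v5, v6, v7, v8, h4, hb.h4] using hv.e12
    exact vec_ten_eq_zero ⟨v0, v1, v2, v3, v4, v5, v6, v7, v8, v9⟩
  have h3 : z 3 ≠ 0 := by
    intro h3
    have h1 : z 1 = 0 := by simpa [h3, h4] using h14
    simp [h1, h3, h7, h4, h2, hb.h3] at hG
  -- Eliminating z₁ = z₂z₃/z₄ leaves the plane cubic in (z₂, z₃, z₄), whose partial derivatives are
  -- the coefficients of `v 2` and `v 3`. They do not both vanish, by `KlmGeneral.gradient_ne_zero`.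
  have hvan : ∀ v, KlmTangent b z v → v 0 = 0 → v 4 = 0 → v 7 = 0 →
      (v 5 = 0 ∧ v 6 = 0 ∧ v 8 = 0 ∧ v 9 = 0) ∧ v 1 * z 4 = z 2 * v 3 + v 2 * z 3 ∧
      (2 * b 0 * z 2 * z 3 + b 1 * z 3 ^ 2 + b 2 * z 3 * z 4 + b 3 * z 4 ^ 2) * v 2 +
      (b 0 * z 2 ^ 2 + 2 * b 1 * z 2 * z 3 + b 2 * z 2 * z 4 + b 4 * z 4 ^ 2) * v 3 = 0 := by
    intro v hv v0 v4 v7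
    refine ⟨⟨?_, ?_, ?_, ?_⟩, ?_, ?_⟩
    · simpa [h5, h7, v7, v4, h4] using hv.e3
    · simpa [h6, h7, v7, v4, h4] using hv.e7
    · simpa [h8, h7, v7, v4, h3] using hv.e9
    · simpa [h9, h7, v7, v4, h2] using hv.e5
    · have := hv.e0
      rw [v4] at this
      linear_combination -this
    · have e0 := hv.e0
      have e11 := hv.e11
      rw [v4] at e0
      rw [v0, v4, v7] at e11
      linear_combination (-z 4) * e11 + (b 0 * v 2 + b 1 * v 3) * h14
        + (b 0 * z 2 + b 1 * z 3 + b 2 * z 4) * e0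
  by_cases hA : 2 * b 0 * z 2 * z 3 + b 1 * z 3 ^ 2 + b 2 * z 3 * z 4 + b 3 * z 4 ^ 2 = 0
  · by_cases hB : b 0 * z 2 ^ 2 + 2 * b 1 * z 2 * z 3 + b 2 * z 2 * z 4 + b 4 * z 4 ^ 2 = 0
    · refine (hb.gradient_ne_zero h2 h3 h4 ?_ hA hB).elim
      rw [h7] at hG
      linear_combination (-z 4) * hG + (b 0 * z 2 + b 1 * z 3 + b 2 * z 4) * h14
    · refine ⟨![0, 2, 4, 7], fun v hv h0 => ?_⟩
      obtain ⟨v0, v2, v4, v7⟩ := four_eq_zero h0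
      obtain ⟨⟨v5, v6, v8, v9⟩, e1, e2⟩ := hvan v hv v0 v4 v7
      have v3 : v 3 = 0 := by simpa [v2, hB] using e2
      have v1 : v 1 = 0 := by simpa [v2, v3, h4] using e1
      exact vec_ten_eq_zero ⟨v0, v1, v2, v3, v4, v5, v6, v7, v8, v9⟩
  · refine ⟨![0, 3, 4, 7], fun v hv h0 => ?_⟩
    obtain ⟨v0, v3, v4, v7⟩ := four_eq_zero h0
    obtain ⟨⟨v5, v6, v8, v9⟩, e1, e2⟩ := hvan v hv v0 v4 v7
    have v2 : v 2 = 0 := by simpa [v3, hA] using e2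
    have v1 : v 1 = 0 := by simpa [v2, v3, h4] using e1
    exact vec_ten_eq_zero ⟨v0, v1, v2, v3, v4, v5, v6, v7, v8, v9⟩

/-- The two symmetries permute transitively the corners 5, 6, 8, 9 and the coordinates 1, 2, 3, 4,
so one corner and one of the latter suffice. -/
theorem klmRegular_of_point (hb : KlmGeneral b) (hz : KlmPoint b z)
    (hne : ∀ j : Fin 10, j = 5 ∨ j = 9 ∨ j = 6 ∨ j = 8 ∨ j = 0 → ∃ i, i ≠ j ∧ z i ≠ 0) :
    KlmRegular b z := by
  by_cases h7 : z 7 = 0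
  swap
  · exact klmRegular_of_seven hz h7
  by_cases h9 : z 9 = 0
  swap
  · exact klmRegular_of_nine hb hz h7 h9 (hne 9 (by simp))
  have hperm : ∀ (σ : Fin 10 → Fin 10) (j : Fin 10), (∀ i, σ (σ i) = i) →
      j = 5 ∨ j = 9 ∨ j = 6 ∨ j = 8 ∨ j = 0 → ∃ i, i ≠ σ j ∧ (z ∘ σ) i ≠ 0 := by
    intro σ j hσ hj
    obtain ⟨i, hi, hi'⟩ := hne j hj
    exact ⟨σ i, fun h => hi (by rw [← hσ i, h, hσ]), by simpa [hσ] using hi'⟩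
  by_cases h5 : z 5 = 0
  swap
  · exact .of_flip (klmRegular_of_nine hb.flip hz.flip h7 h5
      (hperm flipPerm 5 (by decide) (by simp)))
  by_cases h8 : z 8 = 0
  swap
  · exact .of_swap (klmRegular_of_nine hb.swap hz.swap h7 h8
      (hperm swapPerm 8 (by decide) (by simp)))
  by_cases h6 : z 6 = 0
  swap
  · obtain ⟨i, hi, hi'⟩ := hperm swapPerm 6 (by decide) (by simp)
    refine .of_swap (.of_flip (klmRegular_of_nine hb.swap.flip hz.swap.flip h7 h6
      ⟨flipPerm i, fun h => hi ?_, ?_⟩))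
    · have h2 : ∀ i, flipPerm (flipPerm i) = i := by decide
      rw [← h2 i, h]; rfl
    · have h2 : ∀ i, flipPerm (flipPerm i) = i := by decide
      simpa [h2] using hi'
  by_cases h4 : z 4 = 0
  swap
  · exact klmRegular_of_four hb hz h5 h6 h7 h8 h9 h4
  by_cases h2 : z 2 = 0
  swap
  · exact .of_flip (klmRegular_of_four hb.flip hz.flip h9 h6 h7 h8 h5 h2)
  by_cases h3 : z 3 = 0
  swap
  · exact .of_swap (.of_flip (klmRegular_of_four hb.swap.flip hz.swap.flip h8 h5 h7 h9 h6 h3))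
  by_cases h1 : z 1 = 0
  swap
  · exact .of_flip (.of_swap (.of_flip (klmRegular_of_four hb.flip.swap.flip hz.flip.swap.flip
      h8 h9 h7 h5 h6 h1)))
  obtain ⟨i, hi, hi'⟩ := hne 0 (by simp)
  fin_cases i <;> simp_all

theorem klmGeneral_of {a : Fin 14 → ℂ} (h0 : a 0 ≠ 0) (h1 : a 1 ≠ 0) (h3 : a 3 ≠ 0) (h4 : a 4 ≠ 0)
    (hdisc : (a 2 ^ 2 - 4 * a 0 * a 4 - 4 * a 1 * a 3) ^ 2 ≠ 64 * a 0 * a 1 * a 3 * a 4) :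
    KlmGeneral ![a 0, a 1, a 2, a 3, a 4] := ⟨h0, h1, h3, h4, hdisc⟩

theorem coordPoint_mem_singularLocus {a : Fin 14 → ℂ} (hI : homIdeal (klm9 a) = klmIdeal a)
    (j : Fin 10) (s : Fin 5 → Fin 10) (hs : Function.Injective s)
    (h0 : ∀ c : ℂ, KlmPoint ![a 0, a 1, a 2, a 3, a 4] (Pi.single j c))
    (h : ∀ (c : ℂ) (k : Fin 5),
      KlmTangent ![a 0, a 1, a 2, a 3, a 4] (Pi.single j c) (Pi.single (s k) 1)) :
    coordPoint j ∈ singularLocus (klm9 a) 3 := by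
  obtain ⟨c, -, hc⟩ := coordPoint_rep j
  have hv : ∀ i, eval (coordPoint j).rep (klmRel a i) = 0 := by
    rw [hc]; exact klmPoint_iff.1 (h0 c)
  refine ⟨?_, le_finrank_of_single_mem s hs fun k => mem_tangentSpace_of_span hI hv ?_⟩
  · rw [← (isVarietyOfDim_klm9 a).1]
    refine fun f hf => ?_
    rw [hI] at hf
    exact (Ideal.span_le.2 (by rintro _ ⟨i, rfl⟩; exact hv i) :
      klmIdeal a ≤ RingHom.ker (eval (coordPoint j).rep)) hf
  · rw [hc]; exact klmTangent_iff.1 (h c k)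

theorem singularLocus_klm9 {a : Fin 14 → ℂ} (h0 : a 0 ≠ 0) (h1 : a 1 ≠ 0) (h3 : a 3 ≠ 0)
    (h4 : a 4 ≠ 0)
    (hdisc : (a 2 ^ 2 - 4 * a 0 * a 4 - 4 * a 1 * a 3) ^ 2 ≠ 64 * a 0 * a 1 * a 3 * a 4) :
    singularLocus (klm9 a) 3 =
      {coordPoint 5, coordPoint 9, coordPoint 6, coordPoint 8, coordPoint 0} := by
  have hI := homIdeal_klm9_eq_klmIdeal h0 h1 h3 h4
  apply Set.Subset.antisymm
  · rintro p ⟨hp, hfin⟩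
    by_contra hne
    simp only [Set.mem_insert_iff, Set.mem_singleton_iff, not_or] at hne
    have hz : KlmPoint ![a 0, a 1, a 2, a 3, a 4] p.rep := klmPoint_iff.2 fun i =>
      mem_homIdeal_iff.1 (klmRel_mem_homIdeal a i) p hp _ (rep_mem_submodule p)
    obtain ⟨s, hs⟩ := klmRegular_of_point (klmGeneral_of h0 h1 h3 h4 hdisc) hz (by
      intro j hj
      by_contra! hall
      have := eq_coordPoint_of_represents (represents_rep p) hall
      rcases hj with rfl | rfl | rfl | rfl | rfl <;> simp [this] at hne)
    have := finrank_le_of_coordinates (T := tangentSpace (klm9 a) p) s fun v hv =>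
      hs v (klmTangent_iff.2 fun i => dirDeriv_eq_zero hv (klmRel_mem_homIdeal a i))
    omega
  -- At a coordinate point only the equations linear in the remaining coordinates restrict tangent
  -- vectors: X₅ occurs so with X₃, X₄, X₉ only, and X₀ with X₇ only. Five free coordinates exceed
  -- the dimension 4 of the tangent space at a regular point.
  · have key : ∀ (j : Fin 10) (s : Fin 5 → Fin 10), (j = 5 ∧ s = ![5, 0, 1, 2, 7]) ∨
        (j = 9 ∧ s = ![9, 0, 3, 4, 7]) ∨ (j = 6 ∧ s = ![6, 0, 1, 3, 7]) ∨
        (j = 8 ∧ s = ![8, 0, 2, 4, 7]) ∨ (j = 0 ∧ s = ![0, 1, 2, 3, 4]) →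
        coordPoint j ∈ singularLocus (klm9 a) 3 := by
      intro j s hjs
      refine coordPoint_mem_singularLocus hI j s ?_ (fun c => ?_) fun c k => ?_
      · rcases hjs with ⟨-, rfl⟩ | ⟨-, rfl⟩ | ⟨-, rfl⟩ | ⟨-, rfl⟩ | ⟨-, rfl⟩ <;> decide
      · rcases hjs with ⟨rfl, -⟩ | ⟨rfl, -⟩ | ⟨rfl, -⟩ | ⟨rfl, -⟩ | ⟨rfl, -⟩ <;>
        constructor <;> simp
      · rcases hjs with ⟨rfl, rfl⟩ | ⟨rfl, rfl⟩ | ⟨rfl, rfl⟩ | ⟨rfl, rfl⟩ | ⟨rfl, rfl⟩ <;>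
        fin_cases k <;> constructor <;> simp
    rintro p (rfl | rfl | rfl | rfl | rfl)
    · exact key 5 ![5, 0, 1, 2, 7] (by simp)
    · exact key 9 ![9, 0, 3, 4, 7] (by simp)
    · exact key 6 ![6, 0, 1, 3, 7] (by simp)
    · exact key 8 ![8, 0, 2, 4, 7] (by simp)
    · exact key 0 ![0, 1, 2, 3, 4] (by simp)

end

section

/-! ### The curve of genus one -/

theorem alongEdge_sextic (k : Fin 14) (t : Fin 4 → ℂ) : alongEdge (sextic k) t =
    if sexticTable k 2 + sexticTable k 3 = 2 then t 0 ^ sexticTable k 0 * t 1 ^ sexticTable k 1 *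
      t 2 ^ sexticTable k 2 * t 3 ^ sexticTable k 3 else 0 := by
  rw [alongEdge, sextic_eq_prod]
  generalize sexticTable k = e
  simp only [map_mul, map_pow, aeval_X]
  simp only [Matrix.cons_val, mul_pow]
  have : (Polynomial.C (t 0) ^ e 0 * Polynomial.C (t 1) ^ e 1 *
      (Polynomial.X ^ e 2 * Polynomial.C (t 2) ^ e 2) *
      (Polynomial.X ^ e 3 * Polynomial.C (t 3) ^ e 3) : Polynomial ℂ)
      = Polynomial.C (t 0 ^ e 0 * t 1 ^ e 1 * t 2 ^ e 2 * t 3 ^ e 3)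
        * Polynomial.X ^ (e 2 + e 3) := by
    simp only [map_mul, map_pow, pow_add]; ring
  rw [this, Polynomial.coeff_C_mul_X_pow]
  simp only [eq_comm]

theorem alongEdge_sum (a : Fin 14 → ℂ) (t : Fin 4 → ℂ) :
    alongEdge (∑ k, C (a k) * sextic k) t = ∑ k, a k * alongEdge (sextic k) t := by
  simp only [alongEdge, map_sum, map_mul, Polynomial.finsetSum_coeff]
  refine Finset.sum_congr rfl fun k _ => ?_
  rw [← algebraMap_eq, AlgHom.commutes, Polynomial.algebraMap_eq, Polynomial.coeff_C_mul]

/-- Only w₀, …, w₄ have degree exactly two in t₂, t₃; the other sextics vanish to higher order along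
the edge. -/
theorem alongEdge_vec (t : Fin 4 → ℂ) : (fun k => alongEdge (sextic k) t) =
    ![t 0 * t 1 ^ 3 * t 2 * t 3, t 0 ^ 2 * t 1 ^ 2 * t 2 ^ 2, t 0 ^ 2 * t 1 ^ 2 * t 2 * t 3,
      t 0 ^ 2 * t 1 ^ 2 * t 3 ^ 2, t 0 ^ 3 * t 1 * t 2 * t 3, 0, 0, 0, 0, 0, 0, 0, 0, 0] := by
  ext k
  rw [alongEdge_sextic]
  fin_cases k <;> simp [sexticTable]

theorem mem_homIdeal_curveE3_iff {a : Fin 14 → ℂ} {f : CoordRing 13} :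
    f ∈ homIdeal (curveE3 a) ↔ ∀ t : Fin 4 → ℂ, (t 0 ≠ 0 ∧ t 1 ≠ 0 ∧ (t 2 ≠ 0 ∨ t 3 ≠ 0) ∧
      alongEdge (∑ k, C (a k) * sextic k) t = 0) → (fun k => alongEdge (sextic k) t) ≠ 0 →
      ∀ c : ℂ, eval (c • fun k => alongEdge (sextic k) t) f = 0 := by
  rw [curveE3, homIdeal_zariskiClosure, ← mem_homIdeal_setOf_represents]
  simp only [and_assoc]

/-- The points of the double cover of the plane which parametrizes the cone over the curve. -/
def curvePoint (a : Fin 14 → ℂ) (p q w : ℂ) : Fin 14 → ℂ :=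
  ![-(a 1 * p ^ 2 + a 2 * p * q + a 3 * q ^ 2 + a 4 * w) / a 0, p ^ 2, p * q, q ^ 2, w,
    0, 0, 0, 0, 0, 0, 0, 0, 0]

/-- The equation of the double cover of the plane. -/
def doubleCover (a : Fin 14 → ℂ) : Polynomial (MvPolynomial (Fin 2) ℂ) :=
  Polynomial.X ^ 2 + (Polynomial.C (C (a 4)⁻¹ * (C (a 1) * X 0 ^ 2 + C (a 2) * X 0 * X 1
    + C (a 3) * X 1 ^ 2)) * Polynomial.X + Polynomial.C (C ((a 4)⁻¹ * a 0) * (X 0 * X 1) ^ 2))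

/-- The parametrization of the cone over the curve, before taking the quotient by the equation of
the double cover. -/
def curveHom (a : Fin 14 → ℂ) : CoordRing 13 →ₐ[ℂ] Polynomial (MvPolynomial (Fin 2) ℂ) :=
  aeval ![Polynomial.C (C (-(a 0)⁻¹)) * (Polynomial.C (C (a 1) * X 0 ^ 2 + C (a 2) * X 0 * X 1
      + C (a 3) * X 1 ^ 2) + Polynomial.C (C (a 4)) * Polynomial.X),
    Polynomial.C (X 0 ^ 2), Polynomial.C (X 0 * X 1), Polynomial.C (X 1 ^ 2), Polynomial.X,
    0, 0, 0, 0, 0, 0, 0, 0, 0]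

/-- Evaluation at a point of affine three-space. -/
def evalThree (p q w : ℂ) : Polynomial (MvPolynomial (Fin 2) ℂ) →ₐ[ℂ] ℂ :=
  Polynomial.eval₂AlgHom (aeval ![p, q]) w fun _ => Commute.all _ _

theorem evalThree_C (p q w : ℂ) (f : MvPolynomial (Fin 2) ℂ) :
    evalThree p q w (Polynomial.C f) = eval ![p, q] f := by
  simp [evalThree]

theorem evalThree_X (p q w : ℂ) : evalThree p q w Polynomial.X = w := by
  simp [evalThree]

theorem evalThree_doubleCover {a : Fin 14 → ℂ} (h4 : a 4 ≠ 0) (p q w : ℂ) :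
    a 4 * evalThree p q w (doubleCover a) =
      w * (a 1 * p ^ 2 + a 2 * p * q + a 3 * q ^ 2 + a 4 * w) + a 0 * (p * q) ^ 2 := by
  simp only [doubleCover, map_add, map_mul, map_pow, evalThree_C, evalThree_X]
  simp
  field_simp
  ring

theorem evalThree_curveHom (a : Fin 14 → ℂ) (p q w : ℂ) (f : CoordRing 13) :
    evalThree p q w (curveHom a f) = eval (curvePoint a p q w) f := by
  have : (evalThree p q w).comp (curveHom a) = aeval (curvePoint a p q w) := by
    ext i
    simp only [curveHom, AlgHom.comp_apply, aeval_X]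
    fin_cases i <;> simp [curvePoint, evalThree_C, evalThree_X]
    field_simp
    ring
  simpa [aeval_eq_eval] using DFunLike.congr_fun this f

theorem monic_doubleCover (a : Fin 14 → ℂ) : (doubleCover a).Monic := by
  refine Polynomial.monic_X_pow_add ?_
  exact lt_of_le_of_lt Polynomial.degree_linear_le (by decide)

theorem natDegree_doubleCover (a : Fin 14 → ℂ) : (doubleCover a).natDegree = 2 := by
  have : (doubleCover a).natDegree = (Polynomial.X ^ 2 :
      Polynomial (MvPolynomial (Fin 2) ℂ)).natDegree := by
    refine Polynomial.natDegree_add_eq_left_of_degree_lt ?_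
    rw [Polynomial.degree_X_pow]
    exact lt_of_le_of_lt Polynomial.degree_linear_le (by decide)
  rw [this, Polynomial.natDegree_X_pow]

/-- With c² = b₀b₄ the right-hand side is the product of the quadratics b₁x² + (b₂ ∓ 2c)x + b₃. A
root x of the first is nonzero as b₃ ≠ 0; it is simple because the product of the two discriminants
is the quantity excluded by `hb.disc`; and the second factor takes there the value 4cx ≠ 0. A square
has no simple root. -/
theorem not_isSquare_discriminant {b : Fin 5 → ℂ} (hb : KlmGeneral b) (s : Polynomial ℂ)
    (hs : s ^ 2 = (Polynomial.C (b 1) * Polynomial.X ^ 2 + Polynomial.C (b 2) * Polynomial.X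
      + Polynomial.C (b 3)) ^ 2 - Polynomial.C (4 * b 0 * b 4) * Polynomial.X ^ 2) : False := by
  obtain ⟨c, hc⟩ := IsAlgClosed.exists_pow_nat_eq (b 0 * b 4) (n := 2) (by norm_num)
  have hc0 : c ≠ 0 := by
    rintro rfl
    exact mul_ne_zero hb.h0 hb.h4 (by rw [← hc]; norm_num)
  obtain ⟨d, hd⟩ := IsAlgClosed.exists_pow_nat_eq ((b 2 - 2 * c) ^ 2 - 4 * b 1 * b 3) (n := 2)
    (by norm_num)
  have hd0 : d ≠ 0 := by
    rintro rfl
    refine hb.disc ?_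
    have h1 : 64 * b 0 * b 1 * b 3 * b 4 = 64 * c ^ 2 * b 1 * b 3 := by rw [hc]; ring
    have h2 : (b 2 ^ 2 - 4 * b 0 * b 4 - 4 * b 1 * b 3) = b 2 ^ 2 - 4 * c ^ 2 - 4 * b 1 * b 3 := by
      rw [hc]; ring
    rw [h1, h2]
    linear_combination (-((b 2 + 2 * c) ^ 2 - 4 * b 1 * b 3)) * hd
  have h1 := hb.h1
  obtain ⟨x, hx1⟩ : ∃ x, 2 * b 1 * x + (b 2 - 2 * c) = d :=
    ⟨(-(b 2 - 2 * c) + d) / (2 * b 1), by field_simp; ring⟩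
  have hx2 : b 1 * x ^ 2 + (b 2 - 2 * c) * x + b 3 = 0 := by
    have : 4 * b 1 * (b 1 * x ^ 2 + (b 2 - 2 * c) * x + b 3) = 0 := by
      linear_combination (2 * b 1 * x + (b 2 - 2 * c) + d) * hx1 + hd
    simpa [h1] using this
  have hx0 : x ≠ 0 := by
    intro h
    rw [h] at hx2
    exact hb.h3 (by simpa using hx2)
  have hs0 : s.eval x = 0 := by
    have := congrArg (Polynomial.eval x) hs
    simp at this
    refine pow_eq_zero_iff (two_ne_zero) |>.1 (this.trans ?_)
    linear_combination (b 1 * x ^ 2 + (b 2 + 2 * c) * x + b 3) * hx2 + 4 * x ^ 2 * hc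
  have hs' := congrArg (fun f => (Polynomial.derivative f).eval x) hs
  simp [hs0, Polynomial.derivative_pow] at hs'
  have : d * (4 * c * x) = 0 := by
    linear_combination (-1) * hs' - 8 * x * hc - (4 * b 1 * x + 2 * b 2) * hx2 - 4 * c * x * hx1
  exact mul_ne_zero hd0 (mul_ne_zero (mul_ne_zero (by norm_num) hc0) hx0) this

end

/-! ### Primality of the double cover and the ideal of the curve -/

section

variable {a : Fin 14 → ℂ}

/-- A monic quadratic polynomial over a domain is irreducible unless it has a root. Completing the
square at a root, and setting the second variable to 1, would make the discriminant a square. -/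
theorem prime_doubleCover (hb : KlmGeneral ![a 0, a 1, a 2, a 3, a 4]) :
    Prime (doubleCover a) := by
  refine Irreducible.prime ?_
  rw [(monic_doubleCover a).irreducible_iff_roots_eq_zero_of_degree_le_three
    (by rw [natDegree_doubleCover]) (by rw [natDegree_doubleCover]; norm_num),
    Multiset.eq_zero_iff_forall_notMem]
  intro r hr
  have hr0 := (Polynomial.mem_roots'.1 hr).2
  rw [Polynomial.IsRoot.def] at hr0
  have h4 : a 4 ≠ 0 := hb.h4
  set φ : MvPolynomial (Fin 2) ℂ →ₐ[ℂ] Polynomial ℂ := aeval ![Polynomial.X, 1] with hφ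
  have h1 := congrArg φ hr0
  simp only [doubleCover, Polynomial.eval_add, Polynomial.eval_mul, Polynomial.eval_pow,
    Polynomial.eval_X, Polynomial.eval_C, map_add, map_mul, map_pow, map_zero] at h1
  have hC : ∀ c : ℂ, φ (C c) = Polynomial.C c := fun c => by simp [hφ]
  have hX0 : φ (X 0) = Polynomial.X := by simp [hφ]
  have hX1 : φ (X 1) = 1 := by simp [hφ]
  simp only [hC, hX0, hX1] at h1
  refine not_isSquare_discriminant hb (Polynomial.C (2 * a 4) * φ r
    + (Polynomial.C (a 1) * Polynomial.X ^ 2 + Polynomial.C (a 2) * Polynomial.X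
      + Polynomial.C (a 3))) ?_
  have hinv : (Polynomial.C (a 4) * Polynomial.C (a 4)⁻¹ : Polynomial ℂ) = 1 := by
    rw [← Polynomial.C_mul, mul_inv_cancel₀ h4, Polynomial.C_1]
  simp only [Matrix.cons_val, Polynomial.C_mul] at h1 ⊢
  have h2 : (Polynomial.C 2 : Polynomial ℂ) = 2 := rfl
  have h3 : (Polynomial.C 4 : Polynomial ℂ) = 4 := rfl
  rw [h2, h3]
  linear_combination (4 * Polynomial.C (a 4) ^ 2) * h1
    - (4 * Polynomial.C (a 4) * (φ r * (Polynomial.C (a 1) * Polynomial.X ^ 2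
      + Polynomial.C (a 2) * Polynomial.X + Polynomial.C (a 3))
      + Polynomial.C (a 0) * Polynomial.X ^ 2)) * hinv

theorem eval_curvePoint_eq_zero {f : CoordRing 13} (hf : doubleCover a ∣ curveHom a f)
    (h4 : a 4 ≠ 0) {p q w : ℂ}
    (h : w * (a 1 * p ^ 2 + a 2 * p * q + a 3 * q ^ 2 + a 4 * w) + a 0 * (p * q) ^ 2 = 0) :
    eval (curvePoint a p q w) f = 0 := by
  rw [← evalThree_curveHom]
  obtain ⟨H, hH⟩ := hf
  rw [← evalThree_doubleCover h4] at h
  rw [hH, map_mul, (mul_eq_zero.1 h).resolve_left h4, zero_mul]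

theorem exists_curvePoint (h0 : a 0 ≠ 0) {v : Fin 14 → ℂ} (h1 : v 0 * v 4 = v 2 ^ 2)
    (h2 : v 1 * v 3 = v 2 ^ 2)
    (h3 : a 0 * v 0 + a 1 * v 1 + a 2 * v 2 + a 3 * v 3 + a 4 * v 4 = 0)
    (h5 : ∀ k : Fin 14, 5 ≤ k → v k = 0) : ∃ p q w : ℂ, curvePoint a p q w = v ∧
      w * (a 1 * p ^ 2 + a 2 * p * q + a 3 * q ^ 2 + a 4 * w) + a 0 * (p * q) ^ 2 = 0 := by
  obtain ⟨p, hp⟩ := IsAlgClosed.exists_pow_nat_eq (v 1) (n := 2) (by norm_num)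
  obtain ⟨q, hq⟩ : ∃ q : ℂ, q ^ 2 = v 3 ∧ p * q = v 2 := by
    obtain ⟨q, hq⟩ := IsAlgClosed.exists_pow_nat_eq (v 3) (n := 2) (by norm_num)
    -- The square root q is determined up to sign, and one of the two signs gives pq = v₂.
    have : (p * q - v 2) * (p * q + v 2) = 0 := by
      linear_combination q ^ 2 * hp + v 1 * hq + h2
    rcases mul_eq_zero.1 this with h | h
    · exact ⟨q, hq, by linear_combination h⟩
    · exact ⟨-q, by linear_combination hq, by linear_combination -h⟩
  refine ⟨p, q, v 4, ?_, ?_⟩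
  · have e0 : v 0 = -(a 1 * p ^ 2 + a 2 * p * q + a 3 * q ^ 2 + a 4 * v 4) / a 0 := by
      rw [eq_div_iff h0, mul_assoc (a 2), hp, hq.1, hq.2]
      linear_combination h3
    ext k
    fin_cases k
    · exact e0.symm
    · exact hp
    · exact hq.2
    · exact hq.1
    · rfl
    all_goals exact (h5 _ (by decide)).symm
  · rw [mul_assoc (a 2), hp, hq.1, hq.2]
    linear_combination v 4 * h3 - a 0 * h1

/-- The remainder modulo the monic quadratic is Bw + A. Over a general (p, q) it vanishes at two
different values of w, so B = 0, and then A = 0. -/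
theorem curveHom_mem_of_vanishing (h0 : a 0 ≠ 0) (h1 : a 1 ≠ 0) (h4 : a 4 ≠ 0) {f : CoordRing 13}
    (hf : ∀ p q w : ℂ, p ≠ 0 → q ≠ 0 → w ≠ 0 →
      w * (a 1 * p ^ 2 + a 2 * p * q + a 3 * q ^ 2 + a 4 * w) + a 0 * (p * q) ^ 2 = 0 →
      eval (curvePoint a p q w) f = 0) : doubleCover a ∣ curveHom a f := by
  rw [← Polynomial.modByMonic_eq_zero_iff_dvd (monic_doubleCover a)]
  have hdeg : (curveHom a f %ₘ doubleCover a).natDegree ≤ 1 := by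
    have := Polynomial.natDegree_modByMonic_lt (curveHom a f) (monic_doubleCover a) (by
      intro h
      have := natDegree_doubleCover a
      rw [h] at this
      simp at this)
    rw [natDegree_doubleCover] at this
    omega
  obtain ⟨B, A, hAB⟩ := Polynomial.exists_eq_X_add_C_of_natDegree_le_one hdeg
  have hvan : ∀ p q w : ℂ, p ≠ 0 → q ≠ 0 →
      w * (a 1 * p ^ 2 + a 2 * p * q + a 3 * q ^ 2 + a 4 * w) + a 0 * (p * q) ^ 2 = 0 →
      eval ![p, q] B * w + eval ![p, q] A = 0 := by
    intro p q w hp hq hw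
    have hw0 : w ≠ 0 := by
      rintro rfl
      simp [h0, hp, hq] at hw
    have e1 := hf p q w hp hq hw0 hw
    rw [← evalThree_curveHom, ← Polynomial.modByMonic_add_div (curveHom a f) (doubleCover a),
      hAB] at e1
    rw [← evalThree_doubleCover h4] at hw
    simp only [map_add, map_mul, evalThree_C, evalThree_X,
      (mul_eq_zero.1 hw).resolve_left h4, zero_mul, add_zero] at e1
    exact e1
  set T : MvPolynomial (Fin 2) ℂ := C (a 1) * X 0 ^ 2 + C (a 2) * X 0 * X 1
    + C (a 3) * X 1 ^ 2 with hT
  set D : MvPolynomial (Fin 2) ℂ := T ^ 2 - C (4 * a 0 * a 4) * (X 0 * X 1) ^ 2 with hD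
  -- At (1, 0) the discriminant equals a₁².
  have hD0 : D ≠ 0 := by
    intro h
    have := congrArg (eval ![1, 0]) h
    simp [hD, hT, h1] at this
  have hB : B = 0 := by
    suffices B * D = 0 from (mul_eq_zero.1 this).resolve_right hD0
    refine eq_zero_of_eval_torus fun x hx => ?_
    obtain ⟨p, q, rfl⟩ : ∃ p q, x = ![p, q] := ⟨x 0, x 1, by ext i; fin_cases i <;> rfl⟩
    have hp : p ≠ 0 := hx 0
    have hq : q ≠ 0 := hx 1
    obtain ⟨d, hd⟩ := IsAlgClosed.exists_pow_nat_eq (eval ![p, q] D) (n := 2) (by norm_num)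
    have hd' : d ^ 2 = (a 1 * p ^ 2 + a 2 * p * q + a 3 * q ^ 2) ^ 2
        - 4 * a 0 * a 4 * (p * q) ^ 2 := by
      rw [hd]; simp [hD, hT]
    have e1 := hvan p q ((-(a 1 * p ^ 2 + a 2 * p * q + a 3 * q ^ 2) + d) / (2 * a 4)) hp hq (by
      field_simp; linear_combination hd')
    have e2 := hvan p q ((-(a 1 * p ^ 2 + a 2 * p * q + a 3 * q ^ 2) - d) / (2 * a 4)) hp hq (by
      field_simp; linear_combination hd')
    have e3 : eval ![p, q] B * d = 0 := by
      field_simp at e1 e2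
      linear_combination (e1 - e2) / 2
    rw [map_mul, ← hd, sq, ← mul_assoc, e3, zero_mul]
  have hA : A = 0 := by
    refine eq_zero_of_eval_torus fun x hx => ?_
    obtain ⟨p, q, rfl⟩ : ∃ p q, x = ![p, q] := ⟨x 0, x 1, by ext i; fin_cases i <;> rfl⟩
    obtain ⟨d, hd⟩ := IsAlgClosed.exists_pow_nat_eq (eval ![p, q] D) (n := 2) (by norm_num)
    have hd' : d ^ 2 = (a 1 * p ^ 2 + a 2 * p * q + a 3 * q ^ 2) ^ 2
        - 4 * a 0 * a 4 * (p * q) ^ 2 := by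
      rw [hd]; simp [hD, hT]
    have e1 := hvan p q ((-(a 1 * p ^ 2 + a 2 * p * q + a 3 * q ^ 2) + d) / (2 * a 4)) (hx 0)
      (hx 1) (by field_simp; linear_combination hd')
    simpa [hB] using e1
  rw [hAB, hA, hB]
  simp

theorem mem_homIdeal_curveE3 (h0 : a 0 ≠ 0) (h1 : a 1 ≠ 0) (h4 : a 4 ≠ 0) {f : CoordRing 13} :
    f ∈ homIdeal (curveE3 a) ↔ doubleCover a ∣ curveHom a f := by
  have hsum : ∀ t, alongEdge (∑ k, C (a k) * sextic k) t =
      a 0 * (t 0 * t 1 ^ 3 * t 2 * t 3) + a 1 * (t 0 ^ 2 * t 1 ^ 2 * t 2 ^ 2)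
      + a 2 * (t 0 ^ 2 * t 1 ^ 2 * t 2 * t 3) + a 3 * (t 0 ^ 2 * t 1 ^ 2 * t 3 ^ 2)
      + a 4 * (t 0 ^ 3 * t 1 * t 2 * t 3) := by
    intro t
    have h := fun k => congrFun (alongEdge_vec t) k
    simp only [alongEdge_sum, h]
    simp [Fin.sum_univ_succ]
    ring
  rw [mem_homIdeal_curveE3_iff]
  constructor
  · intro hf
    refine curveHom_mem_of_vanishing h0 h1 h4 fun p q w hp hq hw h => ?_
    -- Here t₁/t₀ = pq/w and t₂/t₃ = p/q. After division by w²p²q² the sextics w₁, …, w₄ become p²,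
    -- pq, q², w, and w₀ becomes (pq)²/w, which the curve equation identifies with the required
    -- value.
    have h2 := hf ![w, p * q, p, q]
    rw [hsum, alongEdge_vec] at h2
    have h3 := h2 ⟨hw, mul_ne_zero hp hq, Or.inl hp, by
      simp
      linear_combination (w * p ^ 2 * q ^ 2) * h⟩
      (fun h => mul_ne_zero (mul_ne_zero (mul_ne_zero hw (pow_ne_zero 3 (mul_ne_zero hp hq))) hp) hq
        (congrFun h 0)) (1 / (w ^ 2 * p ^ 2 * q ^ 2))
    rw [← h3]
    congr 2
    ext k
    fin_cases k <;> simp [curvePoint] <;> field_simp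
    linear_combination -h
  · rintro hf t ⟨-, -, -, ht⟩ - c
    rw [hsum] at ht
    rw [alongEdge_vec]
    obtain ⟨p, q, w, hv, hw⟩ := exists_curvePoint (a := a) h0 (v := c • ![t 0 * t 1 ^ 3 * t 2 * t 3,
      t 0 ^ 2 * t 1 ^ 2 * t 2 ^ 2, t 0 ^ 2 * t 1 ^ 2 * t 2 * t 3, t 0 ^ 2 * t 1 ^ 2 * t 3 ^ 2,
      t 0 ^ 3 * t 1 * t 2 * t 3, 0, 0, 0, 0, 0, 0, 0, 0, 0]) (by simp; ring) (by simp; ring)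
      (by simp; linear_combination c * ht) (by
        intro k hk
        fin_cases k <;> first | exact absurd hk (by decide) | simp)
    rw [← hv]
    exact eval_curvePoint_eq_zero hf h4 hw

end

/-! ### The coordinate ring of the curve, its dimension and its span -/

section

variable {a : Fin 14 → ℂ}

/-- The parametrization of the cone over the curve by the coordinate ring of the double cover. -/
def curveQuotientHom (a : Fin 14 → ℂ) : CoordRing 13 →ₐ[ℂ] AdjoinRoot (doubleCover a) :=
  ((AdjoinRoot.mkₐ (doubleCover a)).restrictScalars ℂ).comp (curveHom a)

theorem homIdeal_curveE3_eq_ker (h0 : a 0 ≠ 0) (h1 : a 1 ≠ 0) (h4 : a 4 ≠ 0) :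
    homIdeal (curveE3 a) = RingHom.ker (curveQuotientHom a) := by
  ext f
  rw [mem_homIdeal_curveE3 h0 h1 h4, RingHom.mem_ker]
  exact AdjoinRoot.mk_eq_zero.symm

/-- The homogeneous coordinate ring embeds in the ring of the double cover, a domain finite over a
polynomial ring in two variables. Conversely w₁ = p² and w₃ = q² take arbitrary values, so they are
independent. -/
theorem isVarietyOfDim_curveE3 (hb : KlmGeneral ![a 0, a 1, a 2, a 3, a 4]) :
    IsVarietyOfDim (curveE3 a) 1 := by
  have hprime := prime_doubleCover hb
  have : IsDomain (AdjoinRoot (doubleCover a)) := AdjoinRoot.isDomain_of_prime hprime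
  refine ⟨zariskiClosure_idem _, ?_, ?_⟩
  · rw [homIdeal_curveE3_eq_ker hb.h0 hb.h1 hb.h4]
    exact RingHom.ker_isPrime _
  · rw [homIdeal_curveE3_eq_ker hb.h0 hb.h1 hb.h4]
    apply le_antisymm
    · have h1 := trdeg_le_of_injective (Ideal.kerLiftAlg (curveQuotientHom a))
        (Ideal.kerLiftAlg_injective _)
      have hfin : Module.Finite (MvPolynomial (Fin 2) ℂ) (AdjoinRoot (doubleCover a)) :=
        (monic_doubleCover a).finite_adjoinRoot
      have hinj : FaithfulSMul (MvPolynomial (Fin 2) ℂ) (AdjoinRoot (doubleCover a)) := by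
        rw [faithfulSMul_iff_algebraMap_injective]
        refine AdjoinRoot.of.injective_of_degree_ne_zero fun h => ?_
        have := natDegree_doubleCover a
        rw [Polynomial.natDegree_eq_of_degree_eq_some h] at this
        exact absurd this (by norm_num)
      have h2 := trdeg_add_eq ℂ (MvPolynomial (Fin 2) ℂ) (A := AdjoinRoot (doubleCover a))
      have h3 : Algebra.trdeg (MvPolynomial (Fin 2) ℂ) (AdjoinRoot (doubleCover a)) = 0 :=
        trdeg_eq_zero
      rw [h3, add_zero, MvPolynomial.trdeg_of_isDomain, Cardinal.mk_fin] at h2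
      rw [← h2] at h1
      refine h1.trans ?_
      norm_num
    · have hind : AlgebraicIndependent ℂ (fun i : Fin 2 =>
          Ideal.Quotient.mk (RingHom.ker (curveQuotientHom a)) (X (![1, 3] i))) := by
        rw [algebraicIndependent_iff]
        intro p hp
        have h2 : Ideal.Quotient.mkₐ ℂ (RingHom.ker (curveQuotientHom a))
            (aeval (fun i => X (![1, 3] i)) p) = 0 := by
          rw [comp_aeval_apply]; exact hp
        have h3 : doubleCover a ∣ curveHom a (aeval (fun i => X (![1, 3] i)) p) :=
          AdjoinRoot.mk_eq_zero.1 (Ideal.Quotient.eq_zero_iff_mem.1 h2)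
        refine eq_zero_of_eval_torus fun y hy => ?_
        obtain ⟨x0, hx0⟩ := IsAlgClosed.exists_pow_nat_eq (y 0) (n := 2) (by norm_num)
        obtain ⟨x1, hx1⟩ := IsAlgClosed.exists_pow_nat_eq (y 1) (n := 2) (by norm_num)
        obtain ⟨w, hw⟩ : ∃ w : ℂ, w * (a 1 * x0 ^ 2 + a 2 * x0 * x1 + a 3 * x1 ^ 2 + a 4 * w)
            + a 0 * (x0 * x1) ^ 2 = 0 := by
          have h4 : a 4 ≠ 0 := hb.h4
          obtain ⟨d, hd⟩ := IsAlgClosed.exists_pow_nat_eq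
            ((a 1 * x0 ^ 2 + a 2 * x0 * x1 + a 3 * x1 ^ 2) ^ 2
              - 4 * a 0 * a 4 * (x0 * x1) ^ 2) (n := 2) (by norm_num)
          refine ⟨(-(a 1 * x0 ^ 2 + a 2 * x0 * x1 + a 3 * x1 ^ 2) + d) / (2 * a 4), ?_⟩
          field_simp
          linear_combination hd
        have h4 := eval_curvePoint_eq_zero h3 hb.h4 hw
        rw [eval_aeval_eq] at h4
        rw [← h4]
        congr 2
        ext i
        fin_cases i <;> simp [curvePoint, hx0, hx1]
      have := hind.cardinalMk_le_trdeg
      rw [Cardinal.mk_fin] at this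
      refine le_trans ?_ this
      norm_num

/-! ### The curve as a linear section -/

theorem surjective_projectionMap (h0 : a 0 ≠ 0) : Function.Surjective (projectionMap a) := by
  intro y
  refine ⟨![y 0 / a 0, 0, 0, 0, 0, y 1, y 2, y 3, y 4, y 5, y 6, y 7, y 8, y 9], ?_⟩
  ext i
  fin_cases i <;> simp [projectionMap]
  field_simp

theorem mem_ker_projectionMap {v : Fin 14 → ℂ} : v ∈ LinearMap.ker (projectionMap a) ↔
    a 0 * v 0 + a 1 * v 1 + a 2 * v 2 + a 3 * v 3 + a 4 * v 4 = 0 ∧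
      ∀ k : Fin 14, 5 ≤ k → v k = 0 := by
  rw [LinearMap.mem_ker]
  constructor
  · intro h
    refine ⟨by simpa [projectionMap] using congrFun h 0, fun k hk => ?_⟩
    obtain ⟨i, hi⟩ : ∃ i : Fin 9, k = i.natAdd 5 := ⟨k.subNat 5 hk, by ext; simp; omega⟩
    have := congrFun h i.succ
    subst hi
    fin_cases i <;> simpa [projectionMap] using this
  · rintro ⟨h, h'⟩
    ext i
    fin_cases i
    · simpa [projectionMap] using h
    all_goals
      simp [projectionMap]
      exact h' _ (by decide)

/-- The equations of the cone over the curve. -/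
structure CurveCone (a v : Fin 14 → ℂ) : Prop where
  mem_ker : v ∈ LinearMap.ker (projectionMap a)
  edge : v 0 * v 4 = v 2 ^ 2
  normal : v 1 * v 3 = v 2 ^ 2

theorem CurveCone.exists_curvePoint {v : Fin 14 → ℂ} (hv : CurveCone a v) (h0 : a 0 ≠ 0) :
    ∃ p q w : ℂ, curvePoint a p q w = v ∧
      w * (a 1 * p ^ 2 + a 2 * p * q + a 3 * q ^ 2 + a 4 * w) + a 0 * (p * q) ^ 2 = 0 :=
  EnriquesFano.exists_curvePoint h0 hv.edge hv.normal (mem_ker_projectionMap.1 hv.mem_ker).1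
    (mem_ker_projectionMap.1 hv.mem_ker).2

theorem curveCone_curvePoint (h0 : a 0 ≠ 0) {p q w : ℂ}
    (h : w * (a 1 * p ^ 2 + a 2 * p * q + a 3 * q ^ 2 + a 4 * w) + a 0 * (p * q) ^ 2 = 0) :
    CurveCone a (curvePoint a p q w) := by
  refine ⟨mem_ker_projectionMap.2 ⟨?_, fun k hk => ?_⟩, ?_, ?_⟩
  · simp [curvePoint]
    field_simp
    ring
  · fin_cases k <;> first | exact absurd hk (by decide) | rfl
  · simp [curvePoint]
    field_simp
    linear_combination -h
  · simp [curvePoint]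
    ring

/-- The linear equations and the two quadrics of `CurveCone` pass to the closure, and every vector
satisfying them is a point of the double cover. -/
theorem mem_affineCone_curveE3 (h0 : a 0 ≠ 0) (h1 : a 1 ≠ 0) (h4 : a 4 ≠ 0) {v : Fin 14 → ℂ} :
    v ∈ affineCone (curveE3 a) ↔ CurveCone a v := by
  constructor
  · rintro ⟨p, hp, hv⟩
    have key : ∀ f, (∀ p q w : ℂ, CurveCone a (curvePoint a p q w) →
        eval (curvePoint a p q w) f = 0) → eval v f = 0 := fun f hf =>
      mem_homIdeal_iff.1 ((mem_homIdeal_curveE3 h0 h1 h4).2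
        (curveHom_mem_of_vanishing h0 h1 h4 fun p q w _ _ _ h =>
          hf p q w (curveCone_curvePoint h0 h))) p hp v hv
    refine ⟨mem_ker_projectionMap.2 ⟨?_, fun k hk => ?_⟩, ?_, ?_⟩
    · have := key (C (a 0) * X 0 + C (a 1) * X 1 + C (a 2) * X 2 + C (a 3) * X 3
        + C (a 4) * X 4) fun p q w h => by simpa using (mem_ker_projectionMap.1 h.mem_ker).1
      simpa using this
    · simpa using key (X k) fun p q w h => by simpa using (mem_ker_projectionMap.1 h.mem_ker).2 k hk
    · have := key (X 0 * X 4 - X 2 ^ 2) fun p q w h => by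
        simpa [sub_eq_zero] using h.edge
      simpa [sub_eq_zero] using this
    · have := key (X 1 * X 3 - X 2 ^ 2) fun p q w h => by
        simpa [sub_eq_zero] using h.normal
      simpa [sub_eq_zero] using this
  · have key : ∀ v ≠ 0, CurveCone a v → v ∈ affineCone (curveE3 a) := fun v hv0 hv => by
      refine ⟨_, mem_zariskiClosure_of_represents (represents_mk hv0) fun f hf => ?_,
        (represents_mk hv0).mem⟩
      rw [← homIdeal_zariskiClosure, ← curveE3, mem_homIdeal_curveE3 h0 h1 h4] at hf
      obtain ⟨p, q, w, rfl, h⟩ := hv.exists_curvePoint h0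
      exact eval_curvePoint_eq_zero hf h4 h
    intro hv
    rcases eq_or_ne v 0 with rfl | hv0
    -- The zero vector belongs to the affine cone only because the curve has a point.
    · obtain ⟨p, hp, -⟩ := key (curvePoint a 1 0 0) (fun h => one_ne_zero (α := ℂ) (by
        simpa [curvePoint] using congrFun h 1)) (curveCone_curvePoint h0 (by ring))
      exact ⟨p, hp, Submodule.zero_mem _⟩
    · exact key v hv0 hv

theorem span_affineCone_curveE3 (h0 : a 0 ≠ 0) (h1 : a 1 ≠ 0) (h3 : a 3 ≠ 0) (h4 : a 4 ≠ 0) :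
    Submodule.span ℂ (affineCone (curveE3 a)) = LinearMap.ker (projectionMap a) := by
  refine le_antisymm (Submodule.span_le.2 fun v hv =>
    ((mem_affineCone_curveE3 h0 h1 h4).1 hv).mem_ker) fun v hv => ?_
  have hmem : ∀ p q w : ℂ,
      w * (a 1 * p ^ 2 + a 2 * p * q + a 3 * q ^ 2 + a 4 * w) + a 0 * (p * q) ^ 2 = 0 →
      curvePoint a p q w ∈ Submodule.span ℂ (affineCone (curveE3 a)) := fun p q w h =>
    Submodule.subset_span ((mem_affineCone_curveE3 h0 h1 h4).2 (curveCone_curvePoint h0 h))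
  obtain ⟨d, hd⟩ := IsAlgClosed.exists_pow_nat_eq ((a 1 + a 2 + a 3) ^ 2 - 4 * a 0 * a 4) (n := 2)
    (by norm_num)
  obtain ⟨w, hw⟩ : ∃ w : ℂ, w * (a 1 + a 2 + a 3 + a 4 * w) + a 0 = 0 := by
    refine ⟨(-(a 1 + a 2 + a 3) + d) / (2 * a 4), ?_⟩
    field_simp
    linear_combination hd
  obtain ⟨hv, hv'⟩ := mem_ker_projectionMap.1 hv
  -- Four explicit points of the curve span: those over (1, 0) and (0, 1) with w = 0, the second one
  -- over (0, 1), and one over (1, 1).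
  have : v = v 2 • curvePoint a 1 1 w + ((v 1 - v 2) • curvePoint a 1 0 0
      + ((v 3 - v 2 - (v 2 * w - v 4) * a 4 / a 3) • curvePoint a 0 1 0
        + ((v 2 * w - v 4) * a 4 / a 3) • curvePoint a 0 1 (-a 3 / a 4))) := by
    ext k
    fin_cases k
    · simp [curvePoint]
      field_simp
      linear_combination hv
    all_goals try (simp [curvePoint]; done)
    · simp [curvePoint]
      field_simp
      ring
    all_goals
      simp [curvePoint]
      exact hv' _ (by decide)
  rw [this]
  refine Submodule.add_mem _ (Submodule.smul_mem _ _ (hmem _ _ _ ?_)) (Submodule.add_mem _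
    (Submodule.smul_mem _ _ (hmem _ _ _ ?_)) (Submodule.add_mem _
    (Submodule.smul_mem _ _ (hmem _ _ _ ?_)) (Submodule.smul_mem _ _ (hmem _ _ _ ?_))))
  · linear_combination hw
  · ring
  · ring
  · field_simp
    ring

theorem finrank_span_curveE3 (h0 : a 0 ≠ 0) (h1 : a 1 ≠ 0) (h3 : a 3 ≠ 0) (h4 : a 4 ≠ 0) :
    Module.finrank ℂ (Submodule.span ℂ (affineCone (curveE3 a))) = 4 := by
  rw [span_affineCone_curveE3 h0 h1 h3 h4]
  have := (projectionMap a).finrank_range_add_finrank_ker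
  rw [LinearMap.range_eq_top.2 (surjective_projectionMap h0), finrank_top, Module.finrank_fin_fun,
    Module.finrank_fin_fun] at this
  exact Nat.add_left_cancel (n := 10) this

/-- Replacing t₂, t₃ by et₂, et₃ and dividing by e², the point of the threefold tends as e → 0 to
the vector of leading coefficients along the edge. A form that vanishes for e ≠ 0 vanishes in the
limit. -/
theorem homIdeal_fano13_le_homIdeal_curveE3 : homIdeal fano13 ≤ homIdeal (curveE3 a) := by
  intro f hf
  rw [mem_homIdeal_curveE3_iff]
  rintro t - ht c
  -- The degree of each sextic in t₂, t₃, diminished by 2.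
  set E : Fin 14 → ℕ := ![0, 0, 0, 0, 0, 1, 1, 1, 1, 2, 2, 2, 2, 2] with hE
  have hcont : Continuous fun e : ℂ => eval (fun k => c * (e ^ E k * eval t (sextic k))) f :=
    (MvPolynomial.continuous_eval f).comp (by fun_prop)
  have hsextic : ∀ e : ℂ, ∀ k, eval ![t 0, t 1, e * t 2, e * t 3] (sextic k)
      = e ^ 2 * (e ^ E k * eval t (sextic k)) := by
    intro e k
    fin_cases k <;> simp [sextic, hE] <;> ring
  have hvec : ∀ k, alongEdge (sextic k) t = 0 ^ E k * eval t (sextic k) := fun k => by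
    refine (congrFun (alongEdge_vec t) k).trans ?_
    fin_cases k <;> simp [sextic, hE]
  have h0 := congrFun (hcont.ext_on (dense_compl_singleton (0 : ℂ)) continuous_const
    (g := fun _ => 0) fun e he => ?_) 0
  · refine Eq.trans (congrArg (fun v => eval v f) (funext fun k => ?_)) h0
    simp only [Pi.smul_apply, hvec, smul_eq_mul]
  · have he : e ≠ 0 := he
    have hne : (fun k => eval ![t 0, t 1, e * t 2, e * t 3] (sextic k)) ≠ 0 := by
      intro h
      refine ht (funext fun k => ?_)
      have := congrFun h k
      simp only [hsextic] at this
      rw [hvec]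
      have h2 : eval t (sextic k) = 0 := by simpa [he] using this
      rw [h2, mul_zero]; rfl
    have := mem_homIdeal_fano13_iff.1 hf _ (c / e ^ 2) hne
    refine Eq.trans (congrArg (fun v => eval v f) (funext fun k => ?_)) this
    simp only [Pi.smul_apply, hsextic, smul_eq_mul]
    field_simp

/-- Both quadrics X₀X₄ - X₂² and X₁X₃ - X₂² already vanish on the threefold, so on the span they cut
out the curve. -/
theorem curveE3_eq_inter (h0 : a 0 ≠ 0) (h1 : a 1 ≠ 0) (h3 : a 3 ≠ 0) (h4 : a 4 ≠ 0) :
    curveE3 a = fano13 ∩ linearSubspace (Submodule.span ℂ (affineCone (curveE3 a))) := by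
  ext p
  constructor
  · intro hp
    refine ⟨?_, fun v hv => Submodule.subset_span ⟨p, hp, hv⟩⟩
    rw [fano13, ← zariskiClosure_idem, ← fano13]
    exact fun f hf => mem_homIdeal_iff.1 (homIdeal_fano13_le_homIdeal_curveE3 hf) p hp _
      (rep_mem_submodule p)
  · rintro ⟨hp, hL⟩
    rw [span_affineCone_curveE3 h0 h1 h3 h4] at hL
    have hF : ∀ f ∈ homIdeal fano13, eval p.rep f = 0 := fun f hf =>
      mem_homIdeal_iff.1 hf p hp _ (rep_mem_submodule p)
    have hcone : CurveCone a p.rep := by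
      refine ⟨hL (rep_mem_submodule p), ?_, ?_⟩
      · have := hF (X 0 * X 4 - X 2 ^ 2) (mem_homIdeal_fano13_iff.2 fun t c _ => by
          simp [sextic]; ring)
        simpa [sub_eq_zero] using this
      · have := hF (X 1 * X 3 - X 2 ^ 2) (mem_homIdeal_fano13_iff.2 fun t c _ => by
          simp [sextic]; ring)
        simpa [sub_eq_zero] using this
    rw [curveE3, ← zariskiClosure_idem, ← curveE3]
    intro f hf
    rw [mem_homIdeal_curveE3 h0 h1 h4] at hf
    obtain ⟨x, y, w, h, hw⟩ := hcone.exists_curvePoint h0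
    rw [← h]
    exact eval_curvePoint_eq_zero hf h4 hw

end

/-! ### Smoothness and Hilbert polynomial of the curve -/

section

section Rules

variable {σ : Type*} {w : σ → ℕ}

theorem X_mem_lowerTerms {i : σ} {N : ℕ} (h : w i < N) :
    (X i : MvPolynomial σ ℂ) ∈ lowerTerms w 1 N := by
  rw [X, lowerTerms, monomial_mem_restrictSupport]
  left
  simpa [Finsupp.weight_single] using h

theorem exists_rule_single {J : Ideal (MvPolynomial σ ℂ)} {i : σ} {d : σ →₀ ℕ}
    (hi : d i ≠ 0) (r : MvPolynomial σ ℂ) (hr : r ∈ lowerTerms w 1 (w i)) (hJ : X i - r ∈ J) :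
    ∃ s ≤ d, ∃ r ∈ restrictSupport ℂ {e : σ →₀ ℕ | e.degree = s.degree ∧
      Finsupp.weight w e < Finsupp.weight w s}, monomial s 1 - r ∈ J := by
  refine ⟨Finsupp.single i 1, ?_, r, ?_, hJ⟩
  · rw [Finsupp.single_le_iff]; omega
  · simpa [Finsupp.weight_single, lowerTerms] using hr

theorem exists_rule_sq {J : Ideal (MvPolynomial σ ℂ)} {i : σ} {d : σ →₀ ℕ}
    (hi : 2 ≤ d i) (r : MvPolynomial σ ℂ) (hr : r ∈ lowerTerms w 2 (2 * w i))
    (hJ : X i ^ 2 - r ∈ J) :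
    ∃ s ≤ d, ∃ r ∈ restrictSupport ℂ {e : σ →₀ ℕ | e.degree = s.degree ∧
      Finsupp.weight w e < Finsupp.weight w s}, monomial s 1 - r ∈ J := by
  refine ⟨Finsupp.single i 2, ?_, r, ?_, by rwa [← X_pow_eq_monomial]⟩
  · rw [Finsupp.single_le_iff]; omega
  · simpa [Finsupp.weight_single, lowerTerms] using hr

end Rules

variable {a : Fin 14 → ℂ}

/-! ### The curve is nonsingular -/

theorem singularLocus_curveE3 (hb : KlmGeneral ![a 0, a 1, a 2, a 3, a 4]) :
    singularLocus (curveE3 a) 1 = ∅ := by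
  have h0 : a 0 ≠ 0 := hb.h0
  have h1 : a 1 ≠ 0 := hb.h1
  have h3 : a 3 ≠ 0 := hb.h3
  have h4 : a 4 ≠ 0 := hb.h4
  rw [Set.eq_empty_iff_forall_notMem]
  rintro p ⟨hp, hT⟩
  have hz := (mem_affineCone_curveE3 h0 h1 h4).1 ⟨p, hp, rep_mem_submodule p⟩
  have hz0 := p.rep_nonzero
  have hI : ∀ f : CoordRing 13, (∀ v, CurveCone a v → eval v f = 0) →
      f ∈ homIdeal (curveE3 a) := fun f hf => by
    rw [homIdeal, mem_vanishingIdeal_iff]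
    intro v hv
    rw [aeval_eq_eval]
    exact hf v ((mem_affineCone_curveE3 h0 h1 h4).1 hv)
  have hv : ∀ v ∈ tangentSpace (curveE3 a) p,
      (a 0 * v 0 + a 1 * v 1 + a 2 * v 2 + a 3 * v 3 + a 4 * v 4 = 0 ∧
        ∀ k : Fin 14, 5 ≤ k → v k = 0) ∧
      p.rep 0 * v 4 + v 0 * p.rep 4 = p.rep 2 * v 2 + v 2 * p.rep 2 ∧
      p.rep 1 * v 3 + v 1 * p.rep 3 = p.rep 2 * v 2 + v 2 * p.rep 2 := by
    intro v hv
    refine ⟨⟨?_, fun k hk => ?_⟩, ?_, ?_⟩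
    · have := dirDeriv_eq_zero hv (hI (C (a 0) * X 0 + C (a 1) * X 1 + C (a 2) * X 2 + C (a 3) * X 3
        + C (a 4) * X 4) fun v h => by simpa using (mem_ker_projectionMap.1 h.mem_ker).1)
      simpa using this
    · have := dirDeriv_eq_zero hv (hI (X k) fun v h => by
        simpa using (mem_ker_projectionMap.1 h.mem_ker).2 k hk)
      simpa using this
    · have := dirDeriv_eq_zero hv (hI (X 0 * X 4 - X 2 * X 2) fun v h => by
        simpa [sub_eq_zero, ← sq] using h.edge)
      simpa [sub_eq_zero] using this
    · have := dirDeriv_eq_zero hv (hI (X 1 * X 3 - X 2 * X 2) fun v h => by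
        simpa [sub_eq_zero, ← sq] using h.normal)
      simpa [sub_eq_zero] using this
  refine hT.not_ge ?_
  generalize p.rep = z at *
  generalize tangentSpace (curveE3 a) p = T at *
  obtain ⟨hz1, hz2, hz3⟩ := hz
  rw [mem_ker_projectionMap] at hz1
  have hext : ∀ v : Fin 14 → ℂ, (∀ k : Fin 14, 5 ≤ k → v k = 0) → v 0 = 0 → v 1 = 0 → v 2 = 0 →
      v 3 = 0 → v 4 = 0 → v = 0 := by
    intro v h h0 h1 h2 h3 h4
    ext k
    by_cases hk : 5 ≤ k
    · exact h k hk
    · fin_cases k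
      exacts [h0, h1, h2, h3, h4, h _ (by decide), h _ (by decide), h _ (by decide),
        h _ (by decide), h _ (by decide), h _ (by decide), h _ (by decide), h _ (by decide),
        h _ (by decide)]
  by_cases z2 : z 2 = 0
  · have hne : ¬ (z 0 = 0 ∧ z 1 = 0 ∧ z 3 = 0 ∧ z 4 = 0) := fun h =>
      hz0 (hext z hz1.2 h.1 h.2.1 z2 h.2.2.1 h.2.2.2)
    have hL := hz1.1
    simp only [z2, mul_zero, zero_mul, add_zero] at hv hz2 hz3 hL
    rw [zero_pow two_ne_zero, mul_eq_zero] at hz2 hz3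
    -- If w₂ = 0, one factor of each of w₀w₄ and w₁w₃ vanishes, and the linear equation makes the
    -- two remaining coordinates nonzero.
    rcases hz2 with e1 | e1 <;> rcases hz3 with e2 | e2 <;>
      simp only [e1, e2, mul_zero, zero_mul, add_zero, zero_add, true_and, and_true] at hL hne hv
    · have e3 : z 3 ≠ 0 := fun h => hne ⟨h, by simpa [h, h4] using hL⟩
      have e4 : z 4 ≠ 0 := fun h => hne ⟨by simpa [h, h3] using hL, h⟩
      refine finrank_le_of_coordinates ![3, 2] fun v hvT hc => ?_
      obtain ⟨⟨l, l'⟩, m1, m2⟩ := hv v hvT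
      have c0 : v 3 = 0 := hc 0
      have c1 : v 2 = 0 := hc 1
      have c2 : v 0 = 0 := (mul_eq_zero.1 m1).resolve_right e4
      have c3 : v 1 = 0 := (mul_eq_zero.1 m2).resolve_right e3
      exact hext v l' c2 c3 c1 c0 (by simpa [c0, c1, c2, c3, h4] using l)
    · have e3 : z 1 ≠ 0 := fun h => hne ⟨h, by simpa [h, h4] using hL⟩
      have e4 : z 4 ≠ 0 := fun h => hne ⟨by simpa [h, h1] using hL, h⟩
      refine finrank_le_of_coordinates ![1, 2] fun v hvT hc => ?_
      obtain ⟨⟨l, l'⟩, m1, m2⟩ := hv v hvT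
      have c0 : v 1 = 0 := hc 0
      have c1 : v 2 = 0 := hc 1
      have c2 : v 0 = 0 := (mul_eq_zero.1 m1).resolve_right e4
      have c3 : v 3 = 0 := (mul_eq_zero.1 m2).resolve_left e3
      exact hext v l' c2 c0 c1 c3 (by simpa [c0, c1, c2, c3, h4] using l)
    · have e3 : z 3 ≠ 0 := fun h => hne ⟨by simpa [h, h0] using hL, h⟩
      have e4 : z 0 ≠ 0 := fun h => hne ⟨h, by simpa [h, h3] using hL⟩
      refine finrank_le_of_coordinates ![3, 2] fun v hvT hc => ?_
      obtain ⟨⟨l, l'⟩, m1, m2⟩ := hv v hvT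
      have c0 : v 3 = 0 := hc 0
      have c1 : v 2 = 0 := hc 1
      have c2 : v 4 = 0 := (mul_eq_zero.1 m1).resolve_left e4
      have c3 : v 1 = 0 := (mul_eq_zero.1 m2).resolve_right e3
      exact hext v l' (by simpa [c0, c1, c2, c3, h0] using l) c3 c1 c0 c2
    · have e3 : z 1 ≠ 0 := fun h => hne ⟨by simpa [h, h0] using hL, h⟩
      have e4 : z 0 ≠ 0 := fun h => hne ⟨h, by simpa [h, h1] using hL⟩
      refine finrank_le_of_coordinates ![1, 2] fun v hvT hc => ?_
      obtain ⟨⟨l, l'⟩, m1, m2⟩ := hv v hvT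
      have c0 : v 1 = 0 := hc 0
      have c1 : v 2 = 0 := hc 1
      have c2 : v 4 = 0 := (mul_eq_zero.1 m1).resolve_left e4
      have c3 : v 3 = 0 := (mul_eq_zero.1 m2).resolve_left e3
      exact hext v l' (by simpa [c0, c1, c2, c3, h0] using l) c0 c1 c3 c2
  · have e0 : z 0 ≠ 0 := fun h => z2 (by simpa [h, eq_comm (a := (0 : ℂ))] using hz2)
    have e1 : z 1 ≠ 0 := fun h => z2 (by simpa [h, eq_comm (a := (0 : ℂ))] using hz3)
    -- For tangent vectors with `v 2 = 0` the three conditions degenerate only if a₁w₁ = a₃w₃ and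
    -- a₀w₀ = a₄w₄. Together these contradict the discriminant condition.
    by_cases hd1 : a 1 * z 1 = a 3 * z 3
    · by_cases hd0 : a 0 * z 0 = a 4 * z 4
      · exfalso
        have k1 : a 2 * z 2 = -2 * (a 0 * z 0 + a 1 * z 1) := by
          linear_combination hz1.1 + hd1 + hd0
        have k2 : (a 0 * z 0) ^ 2 = a 0 * a 4 * z 2 ^ 2 := by
          linear_combination a 0 * z 0 * hd0 + a 0 * a 4 * hz2
        have k3 : (a 1 * z 1) ^ 2 = a 1 * a 3 * z 2 ^ 2 := by
          linear_combination a 1 * z 1 * hd1 + a 1 * a 3 * hz3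
        have k4 : (a 2 ^ 2 - 4 * a 0 * a 4 - 4 * a 1 * a 3) * z 2 ^ 2
            = 8 * (a 0 * z 0) * (a 1 * z 1) := by
          linear_combination (a 2 * z 2 - 2 * (a 0 * z 0 + a 1 * z 1)) * k1 + 4 * k2 + 4 * k3
        refine hb.disc (mul_right_cancel₀ (pow_ne_zero 4 z2) ?_)
        simp only [Matrix.cons_val]
        linear_combination ((a 2 ^ 2 - 4 * a 0 * a 4 - 4 * a 1 * a 3) * z 2 ^ 2
          + 8 * (a 0 * z 0) * (a 1 * z 1)) * k4 + 64 * (a 1 * z 1) ^ 2 * k2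
          + 64 * (a 0 * a 4 * z 2 ^ 2) * k3
      · refine finrank_le_of_coordinates ![1, 2] fun v hvT hc => ?_
        obtain ⟨⟨l, l'⟩, m1, m2⟩ := hv v hvT
        have c0 : v 1 = 0 := hc 0
        have c1 : v 2 = 0 := hc 1
        simp only [c0, c1, mul_zero, zero_mul, add_zero] at l m1 m2
        have c3 : v 3 = 0 := (mul_eq_zero.1 m2).resolve_left e1
        have c4 : v 4 * (a 0 * z 0 - a 4 * z 4) = 0 := by
          rw [c3] at l
          linear_combination a 0 * m1 - z 4 * l
        have c4 := (mul_eq_zero.1 c4).resolve_right (sub_ne_zero.2 hd0)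
        exact hext v l' (by simpa [c3, c4, h0] using l) c0 c1 c3 c4
    · refine finrank_le_of_coordinates ![0, 2] fun v hvT hc => ?_
      obtain ⟨⟨l, l'⟩, m1, m2⟩ := hv v hvT
      have c0 : v 0 = 0 := hc 0
      have c1 : v 2 = 0 := hc 1
      simp only [c0, c1, mul_zero, zero_mul, add_zero, zero_add] at l m1 m2
      have c4 : v 4 = 0 := (mul_eq_zero.1 m1).resolve_left e0
      have c3 : v 3 * (a 1 * z 1 - a 3 * z 3) = 0 := by
        rw [c4] at l
        linear_combination a 1 * m2 - z 3 * l
      have c3 := (mul_eq_zero.1 c3).resolve_right (sub_ne_zero.2 hd1)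
      exact hext v l' c0 (by simpa [c3, c4, h1] using l) c1 c3 c4

/-! ### The Hilbert polynomial of the curve -/

/-- The standard monomials of the curve. -/
def curveStd : Set (Fin 14 →₀ ℕ) :=
  {d | d 0 = 0 ∧ (d 1 = 0 ∨ d 3 = 0) ∧ d 4 ≤ 1 ∧ ∀ k, 5 ≤ k → d k = 0}

/-- The rule for X₄² is the linear relation multiplied by X₄, in which X₀X₄ has been replaced by
X₂²; X₁X₃ becomes X₂², and X₀ is eliminated linearly. The weights 3, 1, 0, 1, 2 of X₀, …, X₄
decrease under each rule. -/
theorem curve_normalForm (h0 : a 0 ≠ 0) (h1 : a 1 ≠ 0) (h4 : a 4 ≠ 0) (d : Fin 14 →₀ ℕ) :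
    ∃ g ∈ restrictSupport ℂ {e | e ∈ curveStd ∧ e.degree = d.degree},
      monomial d 1 - g ∈ homIdeal (curveE3 a) := by
  refine exists_normalForm _ ![3, 1, 0, 1, 2, 1, 1, 1, 1, 1, 1, 1, 1, 1] _ (fun d hd => ?_) d
  have hI : ∀ f : CoordRing 13, (∀ v, CurveCone a v → eval v f = 0) →
      f ∈ homIdeal (curveE3 a) := fun f hf => by
    rw [homIdeal, mem_vanishingIdeal_iff]
    intro v hv
    rw [aeval_eq_eval]
    exact hf v ((mem_affineCone_curveE3 h0 h1 h4).1 hv)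
  simp only [curveStd, Set.mem_ofPred_eq, not_and_or, not_or, not_forall, not_le] at hd
  rcases hd with h | h | h | ⟨k, hk, h⟩
  · refine exists_rule_single h (C (-(a 0)⁻¹ * a 1) * X 1 + C (-(a 0)⁻¹ * a 2) * X 2
      + C (-(a 0)⁻¹ * a 3) * X 3 + C (-(a 0)⁻¹ * a 4) * X 4) ?_ (hI _ fun v hv => ?_)
    · refine Submodule.add_mem _ (Submodule.add_mem _ (Submodule.add_mem _ ?_ ?_) ?_) ?_ <;>
      exact C_mul_mem_lowerTerms _ (X_mem_lowerTerms (by decide))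
    · have := (mem_ker_projectionMap.1 hv.mem_ker).1
      simp
      field_simp
      linear_combination this
  · refine exists_rule_pair (by decide) h.1 h.2 (X 2 * X 2) (X_mul_X_mem_lowerTerms (by decide))
      (hI _ fun v hv => ?_)
    simpa [sub_eq_zero, ← sq] using hv.normal
  · refine exists_rule_sq h (C (-(a 4)⁻¹ * a 1) * (X 1 * X 4) + C (-(a 4)⁻¹ * a 2) * (X 2 * X 4)
      + C (-(a 4)⁻¹ * a 3) * (X 3 * X 4) + C (-(a 4)⁻¹ * a 0) * (X 2 * X 2)) ?_ (hI _ fun v hv => ?_)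
    · refine Submodule.add_mem _ (Submodule.add_mem _ (Submodule.add_mem _ ?_ ?_) ?_) ?_ <;>
      exact C_mul_mem_lowerTerms _ (X_mul_X_mem_lowerTerms (by decide))
    · have := (mem_ker_projectionMap.1 hv.mem_ker).1
      simp
      field_simp
      linear_combination v 4 * this - a 0 * hv.edge
  · refine exists_rule_single h 0 (Submodule.zero_mem _) (hI _ fun v hv => ?_)
    simpa using (mem_ker_projectionMap.1 hv.mem_ker).2 k hk

/-- The double cover in terms of polynomials in three variables. -/
def flattenThree : Polynomial (MvPolynomial (Fin 2) ℂ) →ₐ[ℂ] MvPolynomial (Fin 3) ℂ :=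
  Polynomial.eval₂AlgHom (aeval ![X 0, X 1]) (X 2) fun _ => Commute.all _ _

theorem curveHom_monomial {d : Fin 14 →₀ ℕ} (hd : d ∈ curveStd) : curveHom a (monomial d 1) =
    Polynomial.C (X 0 ^ (2 * d 1 + d 2) * X 1 ^ (d 2 + 2 * d 3)) * Polynomial.X ^ d 4 := by
  obtain ⟨h0, -, -, h⟩ := hd
  rw [curveHom, aeval_monomial, Finsupp.prod_fintype _ _ (by simp)]
  simp only [Fin.prod_univ_succ]
  simp [h0, h]
  ring

/-- A combination of standard monomials has degree at most one in w, so a multiple of the monic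
quadratic polynomial among them is zero; and distinct standard monomials have distinct images. -/
theorem eq_zero_of_doubleCover_dvd {g : CoordRing 13} (hg : g ∈ restrictSupport ℂ curveStd)
    (h : doubleCover a ∣ curveHom a g) : g = 0 := by
  have h0 : curveHom a g = 0 := by
    by_contra hne
    refine (monic_doubleCover a).not_dvd_of_natDegree_lt hne ?_ h
    rw [natDegree_doubleCover, Nat.lt_succ_iff, g.as_sum, map_sum]
    refine Polynomial.natDegree_sum_le_of_forall_le _ _ fun d hd => ?_
    rw [← mul_one (coeff d g), ← smul_eq_mul, ← smul_monomial, map_smul, curveHom_monomial (hg hd)]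
    refine (Polynomial.natDegree_smul_le _ _).trans ((Polynomial.natDegree_C_mul_X_pow_le _ _).trans
      (hg hd).2.2.1)
  ext d
  by_cases hd : d ∈ curveStd
  · refine coeff_eq_zero_of_monomialMap (B := curveStd) (ρ := flattenThree.comp (curveHom a))
      (A := curveStd) (fun d => Finsupp.equivFunOnFinite.symm ![2 * d 1 + d 2, d 2 + 2 * d 3, d 4])
      (fun _ => 1) (fun _ _ => one_ne_zero) (fun d hd => ?_) (fun d h h' => absurd h h') ?_ hg (by simp [h0]) hd
    · rw [AlgHom.comp_apply, curveHom_monomial hd, monomial_eq,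
        Finsupp.prod_fintype _ _ (by simp)]
      have hC : ∀ f, flattenThree (Polynomial.C f) = aeval ![X 0, X 1] f := by simp [flattenThree]
      have hX : flattenThree Polynomial.X = X 2 := by simp [flattenThree]
      rw [map_mul, map_pow, hC, hX]
      simp [Fin.prod_univ_succ]
      ring
    · rintro d ⟨hd, -⟩ e ⟨he, -⟩ hde
      have k0 := DFunLike.congr_fun hde 0
      have k1 := DFunLike.congr_fun hde 1
      have k2 := DFunLike.congr_fun hde 2
      simp at k0 k1 k2
      obtain ⟨d0, d1, -, dk⟩ := hd
      obtain ⟨e0, e1, -, ek⟩ := he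
      ext k
      by_cases hk : 5 ≤ k
      · rw [dk k hk, ek k hk]
      · fin_cases k
        · exact d0.trans e0.symm
        · change d 1 = e 1; omega
        · change d 2 = e 2; omega
        · change d 3 = e 3; omega
        · exact k2
        all_goals exact absurd (by decide) hk
  · by_contra hne
    exact hd (hg (mem_support_iff.2 hne))

theorem hasHilbertPolynomial_curveE3 (h0 : a 0 ≠ 0) (h1 : a 1 ≠ 0) (h4 : a 4 ≠ 0) :
    HasHilbertPolynomial (homIdeal (curveE3 a)) (4 * Polynomial.X) := by
  rw [HasHilbertPolynomial, Filter.eventually_atTop]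
  refine ⟨1, fun k hk => ?_⟩
  -- Degree 0 is excluded: the Hilbert function is 1 there, not 0.
  obtain ⟨m, rfl⟩ : ∃ m, k = m + 1 := ⟨k - 1, by omega⟩
  -- The two summands have exponent 0 and 1 of X₄. Since X₁X₃ is not standard, the index i records
  -- the difference of the exponents of X₁ and X₃, shifted; by truncated subtraction one of the two
  -- is zero, and X₂ fills up the degree.
  let E : Fin (2 * m + 3) ⊕ Fin (2 * m + 1) → (Fin 14 →₀ ℕ) := Sum.elim
    (fun i => Finsupp.equivFunOnFinite.symm ![0, i - (m + 1), (m + 1) - (i - (m + 1)) - (m + 1 - i),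
      m + 1 - i, 0, 0, 0, 0, 0, 0, 0, 0, 0, 0])
    (fun i => Finsupp.equivFunOnFinite.symm ![0, i - m, m - (i - m) - (m - i),
      m - i, 1, 0, 0, 0, 0, 0, 0, 0, 0, 0])
  rw [hilbertFunction_eq_card (curve_normalForm h0 h1 h4) (fun g hg hgI =>
    eq_zero_of_doubleCover_dvd hg ((mem_homIdeal_curveE3 h0 h1 h4).1 hgI)) E ?_ ?_]
  · simp
    ring
  · rintro (i | i) (j | j) hij
    · have h1 := DFunLike.congr_fun hij 1
      have h3 := DFunLike.congr_fun hij 3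
      simp [E] at h1 h3
      congr 1
      ext
      omega
    · have h4 := DFunLike.congr_fun hij 4
      simp [E] at h4
    · have h4 := DFunLike.congr_fun hij 4
      simp [E] at h4
    · have h1 := DFunLike.congr_fun hij 1
      have h3 := DFunLike.congr_fun hij 3
      simp [E] at h1 h3
      congr 1
      ext
      omega
  · ext e
    constructor
    · rintro ⟨i | i, rfl⟩
      · refine ⟨⟨rfl, ?_, ?_, fun k hk => ?_⟩, ?_⟩
        · simp [E]; omega
        · simp [E]
        · fin_cases k <;> first | exact absurd hk (by decide) | rfl
        · simp [E, Finsupp.degree_eq_sum, Fin.sum_univ_succ]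
          omega
      · refine ⟨⟨rfl, ?_, ?_, fun k hk => ?_⟩, ?_⟩
        · simp [E]; omega
        · simp [E]
        · fin_cases k <;> first | exact absurd hk (by decide) | rfl
        · simp [E, Finsupp.degree_eq_sum, Fin.sum_univ_succ]
          omega
    · rintro ⟨⟨e0, e13, e4, ek⟩, hdeg⟩
      rw [Finsupp.degree_eq_sum] at hdeg
      simp [Fin.sum_univ_succ, e0, ek] at hdeg
      rcases Nat.le_one_iff_eq_zero_or_eq_one.1 e4 with h4 | h4
      · refine ⟨Sum.inl ⟨m + 1 + e 1 - e 3, by omega⟩, ?_⟩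
        ext k
        by_cases hk : 5 ≤ k
        · rw [ek k hk]
          fin_cases k <;> first | exact absurd hk (by decide) | rfl
        · fin_cases k
          · exact e0.symm
          · simp [E]; omega
          · simp [E]; omega
          · simp [E]; omega
          · exact h4.symm
          all_goals exact absurd (by decide) hk
      · refine ⟨Sum.inr ⟨m + e 1 - e 3, by omega⟩, ?_⟩
        ext k
        by_cases hk : 5 ≤ k
        · rw [ek k hk]
          fin_cases k <;> first | exact absurd hk (by decide) | rfl
        · fin_cases k
          · exact e0.symm
          · simp [E]; omega
          · simp [E]; omega
          · simp [E]; omega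
          · exact h4.symm
          all_goals exact absurd (by decide) hk

theorem isEllipticQuartic_curveE3 (hb : KlmGeneral ![a 0, a 1, a 2, a 3, a 4]) :
    IsEllipticQuartic (curveE3 a) :=
  ⟨isVarietyOfDim_curveE3 hb, singularLocus_curveE3 hb,
    hasHilbertPolynomial_curveE3 hb.h0 hb.h1 hb.h4⟩

end

section

/-! ### Cones and initial forms at coordinate points -/

theorem mem_homIdeal_coneOver {j : Fin (n + 1)} {Y : Set (PSpace n)} {f : CoordRing n} :
    f ∈ homIdeal (coneOver (coordPoint j) Y) ↔
      ∀ v ∈ affineCone Y, ∀ y : ℂ, eval (v + y • Pi.single j 1) f = 0 := by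
  rw [mem_homIdeal_iff]
  constructor
  · rintro h v ⟨q, hq, hv⟩ y
    have hmem : v + y • Pi.single j 1 ∈ (coordPoint j).submodule ⊔ q.submodule := by
      rw [add_comm v]
      exact Submodule.add_mem_sup (Submodule.smul_mem _ _ (represents_coordPoint j).mem) hv
    by_cases h0 : v + y • Pi.single j 1 = 0
    · rw [h0]
      exact h q ⟨q, hq, le_sup_right⟩ 0 (Submodule.zero_mem _)
    · refine h _ ⟨q, hq, ?_⟩ _ (represents_mk h0).mem
      rw [(represents_mk h0).submodule_eq, Submodule.span_singleton_le_iff_mem]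
      exact hmem
  · rintro h x ⟨q, hq, hx⟩ v hv
    obtain ⟨y, hy, w, hw, rfl⟩ := Submodule.mem_sup.1 (hx hv)
    obtain ⟨c, rfl⟩ := (represents_coordPoint j).mem_iff.1 hy
    rw [add_comm _ w]
    exact h w ⟨q, hq, hw⟩ c

/-- A form that does not involve the j-th variable is its own initial form at the j-th coordinate
point. -/
theorem mem_tangentConeIdeal_of_isHomogeneous {Z : Set (PSpace n)} {j : Fin (n + 1)}
    {f : CoordRing n} {m : ℕ} (hf : f ∈ homIdeal Z)
    (hm : f.IsHomogeneous m) (ht : ∀ c : ℂ, translate (Pi.single j c) f = f) :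
    f ∈ tangentConeIdeal Z (coordPoint j) := by
  obtain ⟨c, -, hc⟩ := coordPoint_rep j
  exact mem_tangentConeIdeal hf (H := 0) (m' := m + 1) (by rw [hc, ht, add_zero]) hm
    (isHomogeneous_zero _ _ _) (Nat.lt_succ_self _)

/-- Translation by c in the variable X_j turns X_jG + H into cG + (X_jG + H), whose part of lowest
degree is cG. -/
theorem mem_tangentConeIdeal_of_mul_add {Z : Set (PSpace n)} {j : Fin (n + 1)}
    {G H : CoordRing n} {m : ℕ} (hf : X j * G + H ∈ homIdeal Z)
    (hG : G.IsHomogeneous m) (hH : H.IsHomogeneous (m + 1))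
    (tG : ∀ c : ℂ, translate (Pi.single j c) G = G)
    (tH : ∀ c : ℂ, translate (Pi.single j c) H = H) : G ∈ tangentConeIdeal Z (coordPoint j) := by
  obtain ⟨c, h0, hc⟩ := coordPoint_rep j
  have h1 : C c * G ∈ tangentConeIdeal Z (coordPoint j) := by
    refine mem_tangentConeIdeal hf (H := X j * G + H) (m := m) (m' := m + 1) ?_ ?_ ?_
      (Nat.lt_succ_self _)
    · rw [hc, map_add, map_mul, tG, tH]
      simp [translate]
      ring
    · simpa using (isHomogeneous_C _ c).mul hG
    · refine IsHomogeneous.add ?_ hH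
      exact add_comm 1 m ▸ (isHomogeneous_X ℂ j).mul hG
  have h2 := Ideal.mul_mem_left _ (C c⁻¹) h1
  rwa [← mul_assoc, ← C_mul, inv_mul_cancel₀ h0, C_1, one_mul] at h2

/-! ### Cones over Veronese surfaces -/

/-- The parametrization of a cone over a Veronese surface. -/
def veronesePoint (c x₀ x₁ x₂ y : ℂ) : Fin 10 → ℂ :=
  ![c * x₀ ^ 2, x₀ * x₁, x₀ * x₂, x₁ ^ 2, x₁ * x₂, x₂ ^ 2, 0, 0, 0, y]

/-- The standard monomial in the quadratic monomials of three variables with given exponents. -/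
def veroneseExp (e₀ e₁ e₂ : ℕ) : Fin 6 → ℕ :=
  ![(e₀ - e₁ - e₂) / 2, (e₀ + e₁ - e₂) / 2 - (e₀ - e₁ - e₂) / 2 - (e₁ - e₀ - e₂) / 2,
    (e₀ + e₂ - e₁) / 2 - (e₀ - e₁ - e₂) / 2 - (e₂ - e₀ - e₁) / 2, (e₁ - e₀ - e₂) / 2,
    (e₁ + e₂ - e₀) / 2 - (e₁ - e₀ - e₂) / 2 - (e₂ - e₀ - e₁) / 2, (e₂ - e₀ - e₁) / 2]

/-- The exponents of the standard monomials in the quadratic monomials of three variables. -/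
def VeroneseStd (d : Fin 6 → ℕ) : Prop := (d 0 = 0 ∨ d 3 = 0) ∧
  (d 0 = 0 ∨ d 5 = 0) ∧ (d 3 = 0 ∨ d 5 = 0) ∧ (d 0 = 0 ∨ d 4 = 0) ∧
  (d 3 = 0 ∨ d 2 = 0) ∧ (d 5 = 0 ∨ d 1 = 0)

/-- A monomial of even degree in x₀, x₁, x₂ uses the square x₀² only if e₀ > e₁ + e₂, and then (e₀ -
e₁ - e₂)/2 times; likewise for the other squares. With at most one kind of square, the exponents of
the mixed products are determined. The formulas rely on truncated subtraction. -/
theorem VeroneseStd.veroneseExp_eq {d : Fin 6 → ℕ} (hd : VeroneseStd d) :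
    veroneseExp (2 * d 0 + d 1 + d 2) (2 * d 3 + d 1 + d 4) (2 * d 5 + d 2 + d 4) = d := by
  obtain ⟨d03, d05, d35, d04, d32, d51⟩ := hd
  have : (d 0 = 0 ∧ d 3 = 0 ∧ d 5 = 0) ∨ (d 3 = 0 ∧ d 5 = 0 ∧ d 4 = 0) ∨
    (d 0 = 0 ∧ d 5 = 0 ∧ d 2 = 0) ∨ (d 0 = 0 ∧ d 3 = 0 ∧ d 1 = 0) := by tauto
  clear d03 d05 d35 d04 d32 d51
  generalize h0 : d 0 = x0 at *
  generalize h1 : d 1 = x1 at *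
  generalize h2 : d 2 = x2 at *
  generalize h3 : d 3 = x3 at *
  generalize h4 : d 4 = x4 at *
  generalize h5 : d 5 = x5 at *
  have a0 : (2 * x0 + x1 + x2 - (2 * x3 + x1 + x4) - (2 * x5 + x2 + x4)) / 2 = x0 := by omega
  have a1 : (2 * x3 + x1 + x4 - (2 * x0 + x1 + x2) - (2 * x5 + x2 + x4)) / 2 = x3 := by omega
  have a2 : (2 * x5 + x2 + x4 - (2 * x0 + x1 + x2) - (2 * x3 + x1 + x4)) / 2 = x5 := by omega
  have b0 : (2 * x0 + x1 + x2 + (2 * x3 + x1 + x4) - (2 * x5 + x2 + x4)) / 2 = x0 + x3 + x1 := by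
    omega
  have b1 : (2 * x0 + x1 + x2 + (2 * x5 + x2 + x4) - (2 * x3 + x1 + x4)) / 2 = x0 + x5 + x2 := by
    omega
  have b2 : (2 * x3 + x1 + x4 + (2 * x5 + x2 + x4) - (2 * x0 + x1 + x2)) / 2 = x3 + x5 + x4 := by
    omega
  rw [veroneseExp, a0, a1, a2, b0, b1, b2, Nat.add_assoc, Nat.add_sub_cancel_left,
    Nat.add_sub_cancel_left, Nat.add_assoc, Nat.add_sub_cancel_left,
    Nat.add_sub_cancel_left, Nat.add_assoc, Nat.add_sub_cancel_left, Nat.add_sub_cancel_left]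
  ext i
  fin_cases i
  exacts [h0.symm, h1.symm, h2.symm, h3.symm, h4.symm, h5.symm]

theorem veroneseStd_veroneseExp {e₀ e₁ e₂ m : ℕ} (h : e₀ + e₁ + e₂ = 2 * m) :
    VeroneseStd (veroneseExp e₀ e₁ e₂) ∧
    2 * veroneseExp e₀ e₁ e₂ 0 + veroneseExp e₀ e₁ e₂ 1 + veroneseExp e₀ e₁ e₂ 2 = e₀ ∧
    2 * veroneseExp e₀ e₁ e₂ 3 + veroneseExp e₀ e₁ e₂ 1 + veroneseExp e₀ e₁ e₂ 4 = e₁ ∧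
    2 * veroneseExp e₀ e₁ e₂ 5 + veroneseExp e₀ e₁ e₂ 2 + veroneseExp e₀ e₁ e₂ 4 = e₂ := by
  simp only [VeroneseStd, veroneseExp]
  simp
  rcases lt_or_ge (e₁ + e₂) e₀ with h0 | h0
  · obtain ⟨t, rfl⟩ : ∃ t, e₀ = e₁ + e₂ + 2 * t := ⟨m - e₁ - e₂, by omega⟩
    refine ⟨⟨?_, ?_, ?_, ?_, ?_, ?_⟩, ?_, ?_, ?_⟩ <;> omega
  rcases lt_or_ge (e₀ + e₂) e₁ with h1 | h1
  · obtain ⟨t, rfl⟩ : ∃ t, e₁ = e₀ + e₂ + 2 * t := ⟨m - e₀ - e₂, by omega⟩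
    refine ⟨⟨?_, ?_, ?_, ?_, ?_, ?_⟩, ?_, ?_, ?_⟩ <;> omega
  rcases lt_or_ge (e₀ + e₁) e₂ with h2 | h2
  · obtain ⟨t, rfl⟩ : ∃ t, e₂ = e₀ + e₁ + 2 * t := ⟨m - e₀ - e₁, by omega⟩
    refine ⟨⟨?_, ?_, ?_, ?_, ?_, ?_⟩, ?_, ?_, ?_⟩ <;> omega
  refine ⟨⟨?_, ?_, ?_, ?_, ?_, ?_⟩, ?_, ?_, ?_⟩ <;> omega

/-- The standard monomials of a cone over a Veronese surface. -/
def veroneseStd (σ : Equiv.Perm (Fin 10)) : Set (Fin 10 →₀ ℕ) := {d |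
  (d (σ 6) = 0 ∧ d (σ 7) = 0 ∧ d (σ 8) = 0) ∧
    VeroneseStd ![d (σ 0), d (σ 1), d (σ 2), d (σ 3), d (σ 4), d (σ 5)]}

/-- The ideal `J` contains the equations of a cone over a Veronese surface. -/
structure VeroneseRel (σ : Equiv.Perm (Fin 10)) (c : ℂ) (J : Ideal (CoordRing 9)) : Prop where
  r6 : X (σ 6) ∈ J
  r7 : X (σ 7) ∈ J
  r8 : X (σ 8) ∈ J
  r03 : X (σ 0) * X (σ 3) - C c * (X (σ 1) * X (σ 1)) ∈ J
  r05 : X (σ 0) * X (σ 5) - C c * (X (σ 2) * X (σ 2)) ∈ J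
  r35 : X (σ 3) * X (σ 5) - X (σ 4) * X (σ 4) ∈ J
  r04 : X (σ 0) * X (σ 4) - C c * (X (σ 1) * X (σ 2)) ∈ J
  r32 : X (σ 3) * X (σ 2) - X (σ 1) * X (σ 4) ∈ J
  r51 : X (σ 5) * X (σ 1) - X (σ 2) * X (σ 4) ∈ J

variable {σ : Equiv.Perm (Fin 10)} {c : ℂ} {J : Ideal (CoordRing 9)}

theorem VeroneseRel.normalForm (h : VeroneseRel σ c J) (d : Fin 10 →₀ ℕ) :
    ∃ g ∈ restrictSupport ℂ {e | e ∈ veroneseStd σ ∧ e.degree = d.degree},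
      monomial d 1 - g ∈ J := by
  -- The squares have weight 2 and the mixed products weight 1, so every rule replaces squares by
  -- mixed products.
  refine exists_normalForm _ (![2, 1, 1, 2, 1, 2, 1, 1, 1, 1] ∘ σ.symm) _ (fun d hd => ?_) d
  simp only [veroneseStd, VeroneseStd, Set.mem_ofPred_eq, not_and_or, not_or] at hd
  have hne : ∀ {i j : Fin 10}, i ≠ j → σ i ≠ σ j := fun h => σ.injective.ne h
  have h2 : ∀ i j k l : Fin 10, (![2, 1, 1, 2, 1, 2, 1, 1, 1, 1] i : ℕ)
      + ![2, 1, 1, 2, 1, 2, 1, 1, 1, 1] j < ![2, 1, 1, 2, 1, 2, 1, 1, 1, 1] k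
        + ![2, 1, 1, 2, 1, 2, 1, 1, 1, 1] l →
      (X (σ i) * X (σ j) : CoordRing 9) ∈ lowerTerms (![2, 1, 1, 2, 1, 2, 1, 1, 1, 1] ∘ σ.symm) 2
        ((![2, 1, 1, 2, 1, 2, 1, 1, 1, 1] ∘ σ.symm) (σ k)
          + (![2, 1, 1, 2, 1, 2, 1, 1, 1, 1] ∘ σ.symm) (σ l)) := fun i j k l h =>
    X_mul_X_mem_lowerTerms (by simpa using h)
  rcases hd with (hd | hd | hd) | hd | hd | hd | hd | hd | hd
  · exact exists_rule_single hd 0 (Submodule.zero_mem _) (by simpa using h.r6)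
  · exact exists_rule_single hd 0 (Submodule.zero_mem _) (by simpa using h.r7)
  · exact exists_rule_single hd 0 (Submodule.zero_mem _) (by simpa using h.r8)
  · exact exists_rule_pair (hne (by decide)) hd.1 hd.2 _
      (C_mul_mem_lowerTerms _ (h2 _ _ _ _ (by decide))) h.r03
  · exact exists_rule_pair (hne (by decide)) hd.1 hd.2 _
      (C_mul_mem_lowerTerms _ (h2 _ _ _ _ (by decide))) h.r05
  · exact exists_rule_pair (hne (by decide)) hd.1 hd.2 _ (h2 _ _ _ _ (by decide)) h.r35
  · exact exists_rule_pair (hne (by decide)) hd.1 hd.2 _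
      (C_mul_mem_lowerTerms _ (h2 _ _ _ _ (by decide))) h.r04
  · exact exists_rule_pair (hne (by decide)) hd.1 hd.2 _ (h2 _ _ _ _ (by decide)) h.r32
  · exact exists_rule_pair (hne (by decide)) hd.1 hd.2 _ (h2 _ _ _ _ (by decide)) h.r51

/-- The parametrization of a cone over a Veronese surface, as a ring homomorphism. -/
def veroneseHom (σ : Equiv.Perm (Fin 10)) (c : ℂ) : CoordRing 9 →ₐ[ℂ] MvPolynomial (Fin 4) ℂ :=
  aeval (![C c * X 0 ^ 2, X 0 * X 1, X 0 * X 2, X 1 ^ 2, X 1 * X 2, X 2 ^ 2, 0, 0, 0, X 3] ∘ σ.symm)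

theorem eval_veroneseHom (x : Fin 4 → ℂ) (f : CoordRing 9) : eval x (veroneseHom σ c f) =
    eval (veronesePoint c (x 0) (x 1) (x 2) (x 3) ∘ σ.symm) f := by
  rw [veroneseHom, eval_aeval_eq]
  congr 2
  ext i
  simp only [Function.comp_apply]
  generalize σ.symm i = k
  fin_cases k <;> simp [veronesePoint]

theorem veroneseHom_monomial {d : Fin 10 →₀ ℕ} (hd : d ∈ veroneseStd σ) :
    veroneseHom σ c (monomial d 1) = monomial (Finsupp.equivFunOnFinite.symm
      ![2 * d (σ 0) + d (σ 1) + d (σ 2), 2 * d (σ 3) + d (σ 1) + d (σ 4),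
        2 * d (σ 5) + d (σ 2) + d (σ 4), d (σ 9)]) (c ^ d (σ 0)) := by
  obtain ⟨⟨h6, h7, h8⟩, -⟩ := hd
  rw [veroneseHom, aeval_monomial, Finsupp.prod_fintype _ _ (by simp), ← Equiv.prod_comp σ,
    monomial_eq, Finsupp.prod_fintype _ _ (by simp)]
  simp only [Function.comp_apply, Equiv.symm_apply_apply, Fin.prod_univ_succ]
  simp [h6, h7, h8]
  ring

theorem eq_zero_of_veroneseHom (hc : c ≠ 0) {g : CoordRing 9}
    (hg : g ∈ restrictSupport ℂ (veroneseStd σ)) (h : veroneseHom σ c g = 0) : g = 0 := by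
  ext d
  by_cases hd : d ∈ veroneseStd σ
  · refine coeff_eq_zero_of_monomialMap (B := veroneseStd σ) (A := veroneseStd σ) _ _
      (fun d _ => pow_ne_zero _ hc) (fun d hd => veroneseHom_monomial hd) (fun d h h' => absurd h h')
      ?_ hg h hd
    rintro d ⟨hd, -⟩ e ⟨he, -⟩ hde
    have k0 := DFunLike.congr_fun hde 0
    have k1 := DFunLike.congr_fun hde 1
    have k2 := DFunLike.congr_fun hde 2
    have k3 := DFunLike.congr_fun hde 3
    simp at k0 k1 k2 k3
    obtain ⟨⟨d6, d7, d8⟩, hd⟩ := hd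
    obtain ⟨⟨e6, e7, e8⟩, he⟩ := he
    have hde := hd.veroneseExp_eq.symm.trans (Eq.trans (congr (congr (congrArg _ k0) k1) k2)
      he.veroneseExp_eq)
    ext k
    obtain ⟨k, rfl⟩ := σ.surjective k
    fin_cases k
    exacts [congrFun hde 0, congrFun hde 1, congrFun hde 2, congrFun hde 3, congrFun hde 4,
      congrFun hde 5, d6.trans e6.symm, d7.trans e7.symm, d8.trans e8.symm, k3]
  · by_contra hne
    exact hd (hg (mem_support_iff.2 hne))

/-- The inner sum counts the monomials of degree 2m in three variables; the outer one runs over the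
possible exponents k - m of the vertex coordinate. The leading coefficient 2/3 is 4/3!. -/
theorem card_veronese (k : ℕ) : ∑ m ∈ Finset.range (k + 1), ∑ i ∈ Finset.range (2 * m + 1),
    ((i : ℚ) + 1) = 2 / 3 * k ^ 3 + 5 / 2 * k ^ 2 + 17 / 6 * k + 1 := by
  have h (m : ℕ) : ∑ i ∈ Finset.range m, ((i : ℚ) + 1) = m * (m + 1) / 2 := by
    induction m with
    | zero => simp
    | succ m ih => rw [Finset.sum_range_succ, ih]; push_cast; ring
  simp only [h]
  induction k with
  | zero => norm_num
  | succ k ih => rw [Finset.sum_range_succ, ih]; push_cast; ring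

theorem VeroneseRel.hasDimDegree (hJ : VeroneseRel σ c J) (hc : c ≠ 0)
    (h : J ≤ RingHom.ker (veroneseHom σ c)) : HasDimDegree J 3 4 := by
  refine ⟨Polynomial.C (2 / 3) * Polynomial.X ^ 3 + Polynomial.C (5 / 2) * Polynomial.X ^ 2
    + Polynomial.C (17 / 6) * Polynomial.X + Polynomial.C 1, Filter.Eventually.of_forall fun k => ?_,
    Polynomial.natDegree_cubic (by norm_num), ?_⟩
  -- The index (m, i, j) stands for x₀^(2m-i) x₁^(i-j) x₂^j, a standard monomial of degree m in the
  -- Veronese coordinates.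
  · let e : (Σ m : Fin (k + 1), Σ i : Fin (2 * m + 1), Fin (i + 1)) → Fin 6 → ℕ :=
      fun x => veroneseExp (2 * x.1 - x.2.1) (x.2.1 - x.2.2) x.2.2
    have he : ∀ x, VeroneseStd (e x) ∧ 2 * e x 0 + e x 1 + e x 2 = 2 * x.1 - x.2.1 ∧
        2 * e x 3 + e x 1 + e x 4 = x.2.1 - x.2.2 ∧ 2 * e x 5 + e x 2 + e x 4 = x.2.2 := fun x =>
      veroneseStd_veroneseExp (m := x.1) (by
        have h1 := x.2.1.2
        have h2 := x.2.2.2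
        omega)
    let E : (Σ m : Fin (k + 1), Σ i : Fin (2 * m + 1), Fin (i + 1)) → (Fin 10 →₀ ℕ) :=
      fun x => Finsupp.equivFunOnFinite.symm
        (![e x 0, e x 1, e x 2, e x 3, e x 4, e x 5, 0, 0, 0, k - x.1] ∘ σ.symm)
    have hE : ∀ x, ∀ i, E x (σ i) =
        ![e x 0, e x 1, e x 2, e x 3, e x 4, e x 5, 0, 0, 0, k - x.1] i := fun x i => by
      simp only [E, Finsupp.coe_equivFunOnFinite_symm, Function.comp_apply, Equiv.symm_apply_apply]
    rw [hilbertFunction_eq_card hJ.normalForm (fun g hg hgI => eq_zero_of_veroneseHom hc hg (h hgI))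
      E ?_ ?_]
    · rw [Fintype.card_sigma]
      simp only [Fintype.card_sigma, Fintype.card_fin]
      rw [Fin.sum_univ_eq_sum_range (fun m => ∑ i : Fin (2 * m + 1), ((i : ℕ) + 1))]
      simp only [Fin.sum_univ_eq_sum_range (fun i => i + 1)]
      push_cast
      rw [card_veronese]
      simp
    · intro x x' hx
      have hx' := fun l => (hE x l).symm.trans ((DFunLike.congr_fun hx (σ l)).trans (hE x' l))
      have h0 : e x 0 = e x' 0 := hx' 0
      have h1 : e x 1 = e x' 1 := hx' 1
      have h2 : e x 2 = e x' 2 := hx' 2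
      have h3 : e x 3 = e x' 3 := hx' 3
      have h4 : e x 4 = e x' 4 := hx' 4
      have h5 : e x 5 = e x' 5 := hx' 5
      have h6 : k - x.1 = k - x'.1 := hx' 9
      obtain ⟨-, a0, a1, a2⟩ := he x
      obtain ⟨-, b0, b1, b2⟩ := he x'
      rw [h0, h1, h2] at a0
      rw [h3, h1, h4] at a1
      rw [h5, h2, h4] at a2
      rw [a0] at b0
      rw [a1] at b1
      rw [a2] at b2
      clear_value e E
      obtain ⟨⟨m, hm⟩, ⟨i, hi⟩, ⟨j, hj⟩⟩ := x
      obtain ⟨⟨m', hm'⟩, ⟨i', hi'⟩, ⟨j', hj'⟩⟩ := x'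
      simp only at b0 b1 b2 h6 hi hi' hj hj'
      obtain rfl : m = m' := by omega
      obtain rfl : i = i' := by omega
      obtain rfl : j = j' := by omega
      rfl
    · ext d
      constructor
      · rintro ⟨x, rfl⟩
        obtain ⟨h0, h1, h2, h3⟩ := he x
        have hx1 := x.1.2
        have hx2 := x.2.1.2
        have hx3 := x.2.2.2
        refine ⟨⟨⟨hE x 6, hE x 7, hE x 8⟩, ?_⟩, ?_⟩
        · simp only [hE]
          exact h0
        · rw [Finsupp.degree_eq_sum, ← Equiv.sum_comp σ]
          simp only [hE, Fin.sum_univ_succ]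
          simp
          omega
      · rintro ⟨⟨⟨d6, d7, d8⟩, hstd⟩, hdeg⟩
        rw [Finsupp.degree_eq_sum, ← Equiv.sum_comp σ] at hdeg
        simp [Fin.sum_univ_succ, d6, d7, d8] at hdeg
        refine ⟨⟨⟨d (σ 0) + d (σ 1) + d (σ 2) + d (σ 3) + d (σ 4) + d (σ 5), by omega⟩,
          ⟨2 * d (σ 3) + d (σ 1) + 2 * d (σ 4) + 2 * d (σ 5) + d (σ 2), by simp; omega⟩,
          ⟨2 * d (σ 5) + d (σ 2) + d (σ 4), by simp; omega⟩⟩, ?_⟩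
        have h1 := hstd.veroneseExp_eq
        ext l
        obtain ⟨l, rfl⟩ := σ.surjective l
        rw [hE]
        have h2 : e ⟨⟨d (σ 0) + d (σ 1) + d (σ 2) + d (σ 3) + d (σ 4) + d (σ 5), by omega⟩,
          ⟨2 * d (σ 3) + d (σ 1) + 2 * d (σ 4) + 2 * d (σ 5) + d (σ 2), by simp; omega⟩,
          ⟨2 * d (σ 5) + d (σ 2) + d (σ 4), by simp; omega⟩⟩ =
            ![d (σ 0), d (σ 1), d (σ 2), d (σ 3), d (σ 4), d (σ 5)] := by
          refine Eq.trans ?_ h1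
          simp only [e]
          congr 1
          · simp; omega
          · simp; omega
        rw [h2]
        fin_cases l
        · rfl
        · rfl
        · rfl
        · rfl
        · rfl
        · rfl
        · exact d6.symm
        · exact d7.symm
        · exact d8.symm
        · simp; omega
  · rw [Polynomial.leadingCoeff_cubic (by norm_num)]
    norm_num [Nat.factorial]

end

/-! ### Veronese tangent cones at the quadruple points -/

section

variable {σ : Equiv.Perm (Fin 10)} {c : ℂ}

/-- The linear coordinates in which the Veronese surface is embedded. -/
def veroneseMap (σ : Equiv.Perm (Fin 10)) (c : ℂ) : (Fin 6 → ℂ) →ₗ[ℂ] (Fin 10 → ℂ) :=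
  LinearMap.pi (![c • LinearMap.proj 0, LinearMap.proj 1, LinearMap.proj 2, LinearMap.proj 3,
    LinearMap.proj 4, LinearMap.proj 5, 0, 0, 0, 0] ∘ σ.symm)

theorem veroneseMap_apply (z : Fin 6 → ℂ) :
    veroneseMap σ c z = ![c * z 0, z 1, z 2, z 3, z 4, z 5, 0, 0, 0, 0] ∘ σ.symm := by
  ext i
  simp only [veroneseMap, LinearMap.pi_apply, Function.comp_apply]
  generalize σ.symm i = k
  fin_cases k <;> simp

theorem veroneseMap_injective (hc : c ≠ 0) : Function.Injective (veroneseMap σ c) := by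
  intro z z' h
  rw [veroneseMap_apply, veroneseMap_apply] at h
  have h := fun k => congrFun h (σ k)
  simp only [Function.comp_apply, Equiv.symm_apply_apply] at h
  ext i
  fin_cases i
  exacts [mul_left_cancel₀ hc (h 0), h 1, h 2, h 3, h 4, h 5]

theorem veroneseMap_veroneseVector (x : Fin 3 → ℂ) (y : ℂ) :
    veroneseMap σ c (veroneseVector x) + y • Pi.single (σ 9) 1
      = veronesePoint c (x 0) (x 1) (x 2) y ∘ σ.symm := by
  rw [veroneseMap_apply]
  ext i
  obtain ⟨k, rfl⟩ := σ.surjective i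
  simp only [Pi.add_apply, Pi.smul_apply, Function.comp_apply, Equiv.symm_apply_apply,
    Pi.single_apply, σ.injective.eq_iff, smul_eq_mul]
  fin_cases k <;> simp [veroneseVector, veronesePoint]

theorem veroneseVector_smul (s : ℂ) (x : Fin 3 → ℂ) :
    veroneseVector (s • x) = s ^ 2 • veroneseVector x := by
  ext i
  fin_cases i <;> simp [veroneseVector] <;> ring

theorem homIdeal_coneOver_veronese : homIdeal (coneOver (coordPoint (σ 9))
    {p : PSpace 9 | ∃ x : Fin 3 → ℂ, Represents (veroneseMap σ c (veroneseVector x)) p}) =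
      RingHom.ker (veroneseHom σ c) := by
  ext f
  rw [mem_homIdeal_coneOver, RingHom.mem_ker]
  constructor
  · intro h
    refine eq_zero_of_eval_torus fun x hx => ?_
    rw [eval_veroneseHom]
    have h0 : veroneseMap σ c (veroneseVector ![x 0, x 1, x 2]) ≠ 0 := fun h0 => by
      rw [veroneseMap_apply] at h0
      have := congrFun h0 (σ 3)
      simp [veroneseVector] at this
      exact hx 1 this
    have := h _ ⟨_, ⟨_, represents_mk h0⟩, (represents_mk h0).mem⟩ (x 3)
    rwa [veroneseMap_veroneseVector] at this
  · rintro h v ⟨q, ⟨x, hx⟩, hv⟩ y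
    obtain ⟨s, rfl⟩ := hx.mem_iff.1 hv
    -- The scalar is a square, so it can be absorbed into x and the cone over the surface is
    -- parametrized without an extra factor.
    obtain ⟨s, rfl⟩ := IsAlgClosed.exists_pow_nat_eq s (n := 2) (by norm_num)
    rw [← map_smul, ← veroneseVector_smul, veroneseMap_veroneseVector]
    have := eval_veroneseHom (σ := σ) (c := c) ![s * x 0, s * x 1, s * x 2, y] f
    rw [h, map_zero] at this
    exact this.symm

/-- The tangent cone ideal is contained in the ideal of the parametrized cone by the arcs, and
contains its known equations; the normal forms close the gap, since no standard combination vanishes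
on the cone. -/
theorem VeroneseRel.tangentCone {Z : Set (PSpace 9)} (hc : c ≠ 0)
    (hrel : VeroneseRel σ c (tangentConeIdeal Z (coordPoint (σ 9))))
    (harc : ∀ x₀ x₁ x₂ y : ℂ, x₀ ≠ 0 → x₁ ≠ 0 → x₂ ≠ 0 →
      ∀ g ∈ tangentConeIdeal Z (coordPoint (σ 9)),
        eval (veronesePoint c x₀ x₁ x₂ y ∘ σ.symm) g = 0) :
    HasDimDegree (tangentConeIdeal Z (coordPoint (σ 9))) 3 4 ∧
      ∃ (L : Submodule ℂ (Fin 10 → ℂ)) (V : Set (PSpace 9)),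
        IsVeroneseSurface L V ∧ coordPoint (σ 9) ∉ linearSubspace L ∧
        tangentConeIdeal Z (coordPoint (σ 9)) = homIdeal (coneOver (coordPoint (σ 9)) V) := by
  have hle : tangentConeIdeal Z (coordPoint (σ 9)) ≤ RingHom.ker (veroneseHom σ c) := fun g hg =>
    eq_zero_of_eval_torus fun x hx => by
      rw [eval_veroneseHom]
      exact harc _ _ _ _ (hx 0) (hx 1) (hx 2) g hg
  refine ⟨hrel.hasDimDegree hc hle, _, _, ⟨veroneseMap σ c, veroneseMap_injective hc, rfl, rfl⟩,
    ?_, ?_⟩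
  · rw [mem_linearSubspace_of_represents (represents_coordPoint _)]
    rintro ⟨z, hz⟩
    rw [veroneseMap_apply] at hz
    have := congrFun hz (σ 9)
    simp at this
  · rw [homIdeal_coneOver_veronese]
    exact le_antisymm hle (le_of_normalForm hle hrel.normalForm
      fun g hg hgI => eq_zero_of_veroneseHom hc hg hgI)

/-! ### The quadruple points -/

/-- A coordinate point at which the threefold `Z` has equations and a parametrization of the same
form, up to the order of the coordinates, as the threefold of genus 9 at the last one. -/
structure VeroneseCorner (Z : Set (PSpace 9)) (σ : Equiv.Perm (Fin 10)) (b : Fin 5 → ℂ) : Prop where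
  r6 : X (σ 9) * X (σ 6) + -(X (σ 4) * X (σ 4)) ∈ homIdeal Z
  r7 : X (σ 9) * X (σ 7) + -(X (σ 4) * X (σ 1)) ∈ homIdeal Z
  r8 : X (σ 9) * X (σ 8) + -(X (σ 4) * X (σ 2)) ∈ homIdeal Z
  r35 : X (σ 3) * X (σ 5) - X (σ 4) * X (σ 4) ∈ homIdeal Z
  r32 : X (σ 3) * X (σ 2) - X (σ 1) * X (σ 4) ∈ homIdeal Z
  r51 : X (σ 5) * X (σ 1) - X (σ 2) * X (σ 4) ∈ homIdeal Z
  r04 : X (σ 0) * X (σ 4) - (C (b 0) * (X (σ 7) * X (σ 8)) + C (b 1) * (X (σ 7) * X (σ 1))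
    + C (b 2) * (X (σ 7) * X (σ 2)) + C (b 3) * (X (σ 8) * X (σ 2)) + C (b 4) * (X (σ 1) * X (σ 2)))
      ∈ homIdeal Z
  r03 : X (σ 9) * (X (σ 0) * X (σ 3) - C (b 4) * (X (σ 1) * X (σ 1)))
    + -(X (σ 1) * X (σ 1) * (C (b 0) * X (σ 6) + C (b 1) * X (σ 3) + C (b 2) * X (σ 4)
      + C (b 3) * X (σ 5))) ∈ homIdeal Z
  r05 : X (σ 9) * (X (σ 0) * X (σ 5) - C (b 4) * (X (σ 2) * X (σ 2)))
    + -(X (σ 2) * X (σ 2) * (C (b 0) * X (σ 6) + C (b 1) * X (σ 3) + C (b 2) * X (σ 4)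
      + C (b 3) * X (σ 5))) ∈ homIdeal Z
  mem : ∀ P μ α β : ℂ, P ≠ 0 → μ ≠ 0 → α ≠ 0 → β ≠ 0 →
    ![P ^ 2 / μ * (b 0 * α ^ 2 * β + b 1 * α * β ^ 2 + b 2 * α * β + b 3 * α + b 4 * β),
      P * β, P, μ * β, μ, μ / β, μ * α, P * α * β, P * α, μ / α] ∘ σ.symm ∈ affineCone Z

theorem VeroneseCorner.rel {Z : Set (PSpace 9)} {b : Fin 5 → ℂ} (h : VeroneseCorner Z σ b) :
    VeroneseRel σ (b 4) (tangentConeIdeal Z (coordPoint (σ 9))) := by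
  have ht : ∀ i : Fin 10, i ≠ 9 → ∀ c : ℂ,
      translate (Pi.single (σ 9) c) (X (σ i) : CoordRing 9) = X (σ i) := fun i hi c => by
    simp [translate, σ.injective.ne hi]
  have hC : ∀ (s c : ℂ), translate (Pi.single (σ 9) c) (C s : CoordRing 9) = C s :=
    fun s c => algHom_C _ _
  have h2 : ∀ i j : Fin 10, (X i * X j : CoordRing 9).IsHomogeneous 2 := fun i j =>
    (isHomogeneous_X ℂ i).mul (isHomogeneous_X ℂ j)
  have hCm : ∀ (c : ℂ) {m : ℕ} {f : CoordRing 9}, f.IsHomogeneous m → (C c * f).IsHomogeneous m :=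
    fun c m f hf => by simpa using (isHomogeneous_C (Fin 10) c).mul hf
  have r6 : X (σ 6) ∈ tangentConeIdeal Z (coordPoint (σ 9)) :=
    mem_tangentConeIdeal_of_mul_add h.r6 (isHomogeneous_X _ _) (h2 _ _).neg (by simp [ht])
      (by simp [ht])
  have r7 : X (σ 7) ∈ tangentConeIdeal Z (coordPoint (σ 9)) :=
    mem_tangentConeIdeal_of_mul_add h.r7 (isHomogeneous_X _ _) (h2 _ _).neg (by simp [ht])
      (by simp [ht])
  have r8 : X (σ 8) ∈ tangentConeIdeal Z (coordPoint (σ 9)) :=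
    mem_tangentConeIdeal_of_mul_add h.r8 (isHomogeneous_X _ _) (h2 _ _).neg (by simp [ht])
      (by simp [ht])
  have hcub : ∀ i, (-(X (σ i) * X (σ i) * (C (b 0) * X (σ 6) + C (b 1) * X (σ 3) + C (b 2) * X (σ 4)
      + C (b 3) * X (σ 5))) : CoordRing 9).IsHomogeneous 3 := fun i =>
    ((h2 _ _).mul ((((hCm _ (isHomogeneous_X _ _)).add (hCm _ (isHomogeneous_X _ _))).add
      (hCm _ (isHomogeneous_X _ _))).add (hCm _ (isHomogeneous_X _ _)))).neg
  refine ⟨r6, r7, r8, ?_, ?_, ?_, ?_, ?_, ?_⟩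
  · exact mem_tangentConeIdeal_of_mul_add h.r03 ((h2 _ _).sub (hCm _ (h2 _ _))) (hcub _)
      (by simp [ht, hC]) (by simp [ht, hC])
  · exact mem_tangentConeIdeal_of_mul_add h.r05 ((h2 _ _).sub (hCm _ (h2 _ _))) (hcub _)
      (by simp [ht, hC]) (by simp [ht, hC])
  · exact mem_tangentConeIdeal_of_isHomogeneous h.r35 ((h2 _ _).sub (h2 _ _)) (by simp [ht])
  -- All terms of this quadric except the one with b₄ are multiples of the linear initial forms `r7`
  -- and `r8`.
  · have := mem_tangentConeIdeal_of_isHomogeneous h.r04 ((h2 _ _).sub (((((hCm _ (h2 _ _)).add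
      (hCm _ (h2 _ _))).add (hCm _ (h2 _ _))).add (hCm _ (h2 _ _))).add (hCm _ (h2 _ _))))
      (j := σ 9) (by simp [ht, hC])
    have h7 := Ideal.mul_mem_left _ (C (b 0) * X (σ 8) + C (b 1) * X (σ 1) + C (b 2) * X (σ 2)) r7
    have h8 := Ideal.mul_mem_left _ (C (b 3) * X (σ 2)) r8
    convert Ideal.add_mem _ (Ideal.add_mem _ this h7) h8 using 1
    ring
  · exact mem_tangentConeIdeal_of_isHomogeneous h.r32 ((h2 _ _).sub (h2 _ _)) (by simp [ht])
  · exact mem_tangentConeIdeal_of_isHomogeneous h.r51 ((h2 _ _).sub (h2 _ _)) (by simp [ht])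

theorem VeroneseCorner.tangentCone {Z : Set (PSpace 9)} {b : Fin 5 → ℂ} (h : VeroneseCorner Z σ b)
    (hb : b 4 ≠ 0) : HasDimDegree (tangentConeIdeal Z (coordPoint (σ 9))) 3 4 ∧
      ∃ (L : Submodule ℂ (Fin 10 → ℂ)) (V : Set (PSpace 9)),
        IsVeroneseSurface L V ∧ coordPoint (σ 9) ∉ linearSubspace L ∧
        tangentConeIdeal Z (coordPoint (σ 9)) = homIdeal (coneOver (coordPoint (σ 9)) V) := by
  refine h.rel.tangentCone hb fun x₀ x₁ x₂ y h0 h1 h2 g hg => ?_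
  have := eval_eq_zero_of_arc (u := veronesePoint (b 4) x₀ x₁ x₂ 0 ∘ σ.symm)
    (represents_coordPoint (σ 9))
    (![Polynomial.C (x₀ ^ 2 * (b 3 * x₂ ^ 2 + b 2 * x₁ * x₂ + b 1 * x₁ ^ 2))
        + Polynomial.X * Polynomial.C (b 0 * x₀ ^ 2 * x₁ ^ 2 * x₂ ^ 2), 0, 0, 0, 0, 0,
      Polynomial.C (x₁ ^ 2 * x₂ ^ 2), Polynomial.C (x₀ * x₁ ^ 2 * x₂),
      Polynomial.C (x₀ * x₁ * x₂ ^ 2), 0] ∘ σ.symm) (fun e he => ?_) hg y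
  · rw [← this]
    congr 2
    ext i
    obtain ⟨k, rfl⟩ := σ.surjective i
    simp only [Pi.add_apply, Pi.smul_apply, Function.comp_apply, Equiv.symm_apply_apply,
      Pi.single_apply, σ.injective.eq_iff, smul_eq_mul]
    fin_cases k <;> simp [veronesePoint]
  -- With μ = α the vertex coordinate μ/α is constantly 1, and to first order in e the other
  -- coordinates are the prescribed Veronese point. In z₀ the term b₄β of G dominates as α → 0,
  -- whence the factor b₄.
  · convert h.mem (e * x₀ * x₂) (e * x₁ * x₂) (e * x₁ * x₂) (x₁ / x₂)
      (mul_ne_zero (mul_ne_zero he h0) h2) (mul_ne_zero (mul_ne_zero he h1) h2)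
      (mul_ne_zero (mul_ne_zero he h1) h2) (div_ne_zero h1 h2) using 1
    ext i
    obtain ⟨k, rfl⟩ := σ.surjective i
    simp only [Function.comp_apply, Equiv.symm_apply_apply, Pi.single_apply, σ.injective.eq_iff]
    fin_cases k <;> simp [veronesePoint] <;> field_simp
    ring

/-- The permutation of the coordinates given by a list of values. -/
def permOf (s : Fin 10 → Fin 10) (hs : Function.Injective s) : Equiv.Perm (Fin 10) :=
  Equiv.ofBijective s (Finite.injective_iff_bijective.1 hs)

theorem klm9_corner_nine (a : Fin 14 → ℂ) : VeroneseCorner (klm9 a)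
    (permOf ![0, 3, 4, 6, 7, 8, 5, 1, 2, 9] (by decide)) ![a 0, a 1, a 2, a 3, a 4] := by
  constructor
  case mem =>
    intro P μ α β hP hμ hα hβ
    convert klmPoint_mem_affineCone a hP hμ hα hβ using 1
    ext i
    obtain ⟨k, rfl⟩ := Equiv.surjective (permOf ![0, 3, 4, 6, 7, 8, 5, 1, 2, 9] (by decide)) i
    simp only [Function.comp_apply, Equiv.symm_apply_apply]
    fin_cases k <;> simp [klmPoint, permOf]
  all_goals
    rw [mem_homIdeal_klm9_iff]
    intro P μ α β hP hμ hα hβ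
    simp [klmPoint, permOf]
    field_simp
    ring

/-- The corners 5, 8, 6 come from the corner 9 by α ↦ 1/α, by α ↔ β, and by both; the last
coefficient becomes a₀, a₃, a₁ respectively. -/
theorem klm9_corner_five (a : Fin 14 → ℂ) : VeroneseCorner (klm9 a)
    (permOf ![0, 1, 2, 6, 7, 8, 9, 3, 4, 5] (by decide)) ![a 4, a 1, a 2, a 3, a 0] := by
  constructor
  case mem =>
    intro P μ α β hP hμ hα hβ
    convert klmPoint_mem_affineCone a (mul_ne_zero hP hα) hμ (inv_ne_zero hα) hβ using 1
    ext i
    obtain ⟨k, rfl⟩ := Equiv.surjective (permOf ![0, 1, 2, 6, 7, 8, 9, 3, 4, 5] (by decide)) i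
    simp only [Function.comp_apply, Equiv.symm_apply_apply]
    fin_cases k <;> simp [klmPoint, permOf, hα] <;> field_simp <;> ring1
  all_goals
    rw [mem_homIdeal_klm9_iff]
    intro P μ α β hP hμ hα hβ
    simp [klmPoint, permOf]
    field_simp
    ring

theorem klm9_corner_eight (a : Fin 14 → ℂ) : VeroneseCorner (klm9 a)
    (permOf ![0, 2, 4, 5, 7, 9, 6, 1, 3, 8] (by decide)) ![a 1, a 0, a 2, a 4, a 3] := by
  constructor
  case mem =>
    intro P μ α β hP hμ hα hβ
    convert klmPoint_mem_affineCone a hP hμ hβ hα using 1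
    ext i
    obtain ⟨k, rfl⟩ := Equiv.surjective (permOf ![0, 2, 4, 5, 7, 9, 6, 1, 3, 8] (by decide)) i
    simp only [Function.comp_apply, Equiv.symm_apply_apply]
    fin_cases k <;> simp [klmPoint, permOf, hP, hμ] <;> field_simp <;> ring1
  all_goals
    rw [mem_homIdeal_klm9_iff]
    intro P μ α β hP hμ hα hβ
    simp [klmPoint, permOf]
    field_simp
    ring

theorem klm9_corner_six (a : Fin 14 → ℂ) : VeroneseCorner (klm9 a)
    (permOf ![0, 1, 3, 5, 7, 9, 8, 2, 4, 6] (by decide)) ![a 3, a 0, a 2, a 4, a 1] := by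
  constructor
  case mem =>
    intro P μ α β hP hμ hα hβ
    convert klmPoint_mem_affineCone a (mul_ne_zero hP hα) hμ hβ (inv_ne_zero hα) using 1
    ext i
    obtain ⟨k, rfl⟩ := Equiv.surjective (permOf ![0, 1, 3, 5, 7, 9, 8, 2, 4, 6] (by decide)) i
    simp only [Function.comp_apply, Equiv.symm_apply_apply]
    fin_cases k <;> simp [klmPoint, permOf, hα] <;> field_simp <;> ring1
  all_goals
    rw [mem_homIdeal_klm9_iff]
    intro P μ α β hP hμ hα hβ
    simp [klmPoint, permOf]
    field_simp
    ring

/-- The four quadruple points. -/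
theorem klm9_quadruple {a : Fin 14 → ℂ} (hb : KlmGeneral ![a 0, a 1, a 2, a 3, a 4]) (j : Fin 10)
    (hj : j = 5 ∨ j = 9 ∨ j = 6 ∨ j = 8) :
    HasDimDegree (tangentConeIdeal (klm9 a) (coordPoint j)) 3 4 ∧
      ∃ (L : Submodule ℂ (Fin 10 → ℂ)) (V : Set (PSpace 9)),
        IsVeroneseSurface L V ∧ coordPoint j ∉ linearSubspace L ∧
        tangentConeIdeal (klm9 a) (coordPoint j) = homIdeal (coneOver (coordPoint j) V) := by
  rcases hj with rfl | rfl | rfl | rfl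
  · exact (klm9_corner_five a).tangentCone hb.h0
  · exact (klm9_corner_nine a).tangentCone hb.h4
  · exact (klm9_corner_six a).tangentCone hb.h1
  · exact (klm9_corner_eight a).tangentCone hb.h3

end

section

/-! ### Coordinate subspaces -/

/-- The vectors all of whose coordinates outside `S` vanish. -/
def coordSpan (S : Finset (Fin (n + 1))) : Submodule ℂ (Fin (n + 1) → ℂ) where
  carrier := {v | ∀ i ∉ S, v i = 0}
  add_mem' := fun hv hw i hi => by simp [hv i hi, hw i hi]
  zero_mem' := fun _ _ => rfl
  smul_mem' := fun c v hv i hi => by simp [hv i hi]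

theorem coordSpan_mono {S T : Finset (Fin (n + 1))} (h : S ⊆ T) : coordSpan S ≤ coordSpan T :=
  fun _ hv i hi => hv i fun hS => hi (h hS)

theorem single_mem_coordSpan {S : Finset (Fin (n + 1))} {j : Fin (n + 1)} :
    Pi.single j (1 : ℂ) ∈ coordSpan S ↔ j ∈ S := by
  refine ⟨fun h => ?_, fun h i hi => Pi.single_eq_of_ne (fun e => hi (by rwa [e])) _⟩
  by_contra hj
  simpa using h j hj

theorem finrank_coordSpan (S : Finset (Fin (n + 1))) :
    Module.finrank ℂ (coordSpan S) = S.card := by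
  refine le_antisymm (finrank_le_of_coordinates (S.orderEmbOfFin rfl) fun v hv h => ?_)
    (le_finrank_of_single_mem (S.orderEmbOfFin rfl) (S.orderEmbOfFin rfl).injective fun k =>
      single_mem_coordSpan.2 (S.orderEmbOfFin_mem rfl k))
  ext i
  by_cases hi : i ∈ S
  · obtain ⟨k, rfl⟩ : i ∈ Set.range (S.orderEmbOfFin rfl) := by
      rw [Finset.range_orderEmbOfFin]; exact hi
    exact h k
  · exact hv i hi

theorem isLinear_coordSpan {S : Finset (Fin (n + 1))} {k : ℕ} (h : S.card = k + 1) :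
    IsLinear k (linearSubspace (coordSpan S)) :=
  ⟨_, (finrank_coordSpan S).trans h, rfl⟩

theorem linearSubspace_coordSpan_inter (S T : Finset (Fin (n + 1))) :
    linearSubspace (coordSpan S) ∩ linearSubspace (coordSpan T)
      = linearSubspace (coordSpan (S ∩ T)) := by
  ext p
  constructor
  · rintro ⟨h1, h2⟩ v hv i hi
    rw [Finset.mem_inter, not_and_or] at hi
    exact hi.elim (h1 hv i) (h2 hv i)
  · exact fun h => ⟨h.trans (coordSpan_mono Finset.inter_subset_left),
      h.trans (coordSpan_mono Finset.inter_subset_right)⟩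

theorem linearSubspace_coordSpan_empty :
    linearSubspace (coordSpan (∅ : Finset (Fin (n + 1)))) = ∅ := by
  rw [Set.eq_empty_iff_forall_notMem]
  intro p hp
  exact p.rep_nonzero (funext fun i => hp (rep_mem_submodule p) i (Finset.notMem_empty i))

theorem coordPoint_mem_linearSubspace {S : Finset (Fin (n + 1))} {j : Fin (n + 1)} :
    coordPoint j ∈ linearSubspace (coordSpan S) ↔ j ∈ S := by
  rw [mem_linearSubspace_of_represents (represents_coordPoint j), single_mem_coordSpan]

theorem linearSubspace_coordSpan_singleton (j : Fin (n + 1)) :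
    linearSubspace (coordSpan {j}) = {coordPoint j} := by
  ext p
  constructor
  · exact fun hp => eq_coordPoint_of_represents (represents_rep p) fun i hi =>
      hp (rep_mem_submodule p) i (by simpa using hi)
  · rintro rfl
    exact coordPoint_mem_linearSubspace.2 (Finset.mem_singleton_self j)

theorem coordPoint_injective : Function.Injective (coordPoint (n := n)) := by
  intro i j h
  have := coordPoint_mem_linearSubspace (S := {j}) (j := i)
  rw [linearSubspace_coordSpan_singleton, h] at this
  simpa using this.1 rfl

/-- The restriction of polynomials to a coordinate subspace. -/
def restrictHom (S : Finset (Fin (n + 1))) : CoordRing n →ₐ[ℂ] CoordRing n :=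
  aeval fun i => if i ∈ S then X i else 0

theorem eval_restrictHom (S : Finset (Fin (n + 1))) (v : Fin (n + 1) → ℂ) (f : CoordRing n) :
    eval v (restrictHom S f) = eval (fun i => if i ∈ S then v i else 0) f := by
  rw [restrictHom, eval_aeval_eq]
  congr 2
  ext i
  split_ifs <;> simp

theorem eval_eq_zero_of_restrictHom {S : Finset (Fin (n + 1))} {f : CoordRing n}
    (h : restrictHom S f = 0) {v : Fin (n + 1) → ℂ} (hv : v ∈ coordSpan S) : eval v f = 0 := by
  have := eval_restrictHom S v f
  rw [h, map_zero] at this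
  rw [this]
  congr 2
  ext i
  split_ifs with hi
  · rfl
  · exact hv i hi

/-- A polynomial which vanishes on a coordinate subspace contains no monomial in its
coordinates. -/
theorem coeff_eq_zero_of_restrictHom {S : Finset (Fin (n + 1))} {g : CoordRing n}
    (h : restrictHom S g = 0) {d : Fin (n + 1) →₀ ℕ} (hd : ∀ i ∉ S, d i = 0) : coeff d g = 0 := by
  refine coeff_eq_zero_of_monomialMap (B := Set.univ) (A := {d | ∀ i ∉ S, d i = 0}) id (fun _ => 1)
    (fun _ _ => one_ne_zero) (fun d hd => ?_) (fun d _ hd => ?_) Function.injective_id.injOn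
    (fun _ _ => trivial) h hd
  · rw [restrictHom, aeval_monomial, monomial_eq, Finsupp.prod_fintype _ _ (by simp),
      id, Finsupp.prod_fintype _ _ (by simp), map_one, map_one]
    congr 1
    refine Finset.prod_congr rfl fun i _ => ?_
    split_ifs with hi
    · rfl
    · rw [hd i hi, pow_zero, pow_zero]
  · simp only [Set.mem_ofPred_eq, not_forall] at hd
    obtain ⟨i, hi, hd⟩ := hd
    rw [restrictHom, aeval_monomial, Finsupp.prod_fintype _ _ (by simp),
      Finset.prod_eq_zero (Finset.mem_univ i), mul_zero]
    rw [if_neg hi, zero_pow hd]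

end

section

/-! ### The cone over the reducible sextic surface -/

/-- The ideal `J` contains the equations of the cone over the reducible sextic surface. -/
structure NodeRel (J : Ideal (CoordRing 9)) : Prop where
  e7 : X 7 ∈ J
  seg : X 2 * X 3 - X 1 * X 4 ∈ J
  e59 : X 5 * X 9 ∈ J
  e68 : X 6 * X 8 ∈ J
  e56 : X 5 * X 6 ∈ J
  e58 : X 5 * X 8 ∈ J
  e69 : X 6 * X 9 ∈ J
  e89 : X 8 * X 9 ∈ J
  e54 : X 5 * X 4 ∈ J
  e53 : X 5 * X 3 ∈ J
  e92 : X 9 * X 2 ∈ J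
  e91 : X 9 * X 1 ∈ J
  e64 : X 6 * X 4 ∈ J
  e62 : X 6 * X 2 ∈ J
  e83 : X 8 * X 3 ∈ J
  e81 : X 8 * X 1 ∈ J

/-- The coordinates which do not vanish only involve the corners and edges of one plane, or the
edges. -/
structure NodeSupport {R : Type*} [Zero R] (d : Fin 10 → R) : Prop where
  e7 : d 7 = 0
  e59 : d 5 = 0 ∨ d 9 = 0
  e68 : d 6 = 0 ∨ d 8 = 0
  e56 : d 5 = 0 ∨ d 6 = 0
  e58 : d 5 = 0 ∨ d 8 = 0
  e69 : d 6 = 0 ∨ d 9 = 0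
  e89 : d 8 = 0 ∨ d 9 = 0
  e54 : d 5 = 0 ∨ d 4 = 0
  e53 : d 5 = 0 ∨ d 3 = 0
  e92 : d 9 = 0 ∨ d 2 = 0
  e91 : d 9 = 0 ∨ d 1 = 0
  e64 : d 6 = 0 ∨ d 4 = 0
  e62 : d 6 = 0 ∨ d 2 = 0
  e83 : d 8 = 0 ∨ d 3 = 0
  e81 : d 8 = 0 ∨ d 1 = 0

theorem nodeSupport_iff {R : Type*} [Zero R] (d : Fin 10 → R) : NodeSupport d ↔ d 7 = 0 ∧
    (d 5 = 0 ∨ d 9 = 0) ∧ (d 6 = 0 ∨ d 8 = 0) ∧ (d 5 = 0 ∨ d 6 = 0) ∧ (d 5 = 0 ∨ d 8 = 0) ∧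
    (d 6 = 0 ∨ d 9 = 0) ∧ (d 8 = 0 ∨ d 9 = 0) ∧ (d 5 = 0 ∨ d 4 = 0) ∧ (d 5 = 0 ∨ d 3 = 0) ∧
    (d 9 = 0 ∨ d 2 = 0) ∧ (d 9 = 0 ∨ d 1 = 0) ∧ (d 6 = 0 ∨ d 4 = 0) ∧ (d 6 = 0 ∨ d 2 = 0) ∧
    (d 8 = 0 ∨ d 3 = 0) ∧ (d 8 = 0 ∨ d 1 = 0) :=
  ⟨fun ⟨a, b, c, d, e, f, g, h, i, j, k, l, m, n, o⟩ => ⟨a, b, c, d, e, f, g, h, i, j, k, l, m, n, o⟩,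
    fun ⟨a, b, c, d, e, f, g, h, i, j, k, l, m, n, o⟩ => ⟨a, b, c, d, e, f, g, h, i, j, k, l, m, n, o⟩⟩

/-- The corners of the polygon of the threefold. -/
def nodeCorner : Fin 4 → Fin 10 := ![5, 9, 6, 8]

/-- The edge of the square next to a corner. -/
def nodeEdge : Fin 4 → Finset (Fin 10) := ![{1, 2}, {3, 4}, {1, 3}, {2, 4}]

/-- At most one corner coordinate is nonzero, and it kills the two coordinates of the square outside
its own edge. This is the decomposition of the surface into the quadric and four planes. -/
theorem NodeSupport.cases {R : Type*} [Zero R] {d : Fin 10 → R} (h : NodeSupport d) :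
    (d 5 = 0 ∧ d 9 = 0 ∧ d 6 = 0 ∧ d 8 = 0) ∨
      ∃ κ, d (nodeCorner κ) ≠ 0 ∧ ∀ i ∉ insert 0 (insert (nodeCorner κ) (nodeEdge κ)), d i = 0 := by
  by_cases h5 : d 5 = 0
  · by_cases h9 : d 9 = 0
    · by_cases h6 : d 6 = 0
      · by_cases h8 : d 8 = 0
        · exact Or.inl ⟨h5, h9, h6, h8⟩
        · refine Or.inr ⟨3, h8, fun i hi => ?_⟩
          fin_cases i
          exacts [absurd (by decide) hi, h.e81.resolve_left h8, absurd (by decide) hi,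
            h.e83.resolve_left h8, absurd (by decide) hi, h5, h6, h.e7, absurd (by decide) hi, h9]
      · refine Or.inr ⟨2, h6, fun i hi => ?_⟩
        fin_cases i
        exacts [absurd (by decide) hi, absurd (by decide) hi, h.e62.resolve_left h6,
          absurd (by decide) hi, h.e64.resolve_left h6, h5, absurd (by decide) hi, h.e7,
          h.e68.resolve_left h6, h9]
    · refine Or.inr ⟨1, h9, fun i hi => ?_⟩
      fin_cases i
      exacts [absurd (by decide) hi, h.e91.resolve_left h9, h.e92.resolve_left h9,
        absurd (by decide) hi, absurd (by decide) hi, h5, h.e69.resolve_right h9, h.e7,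
        h.e89.resolve_right h9, absurd (by decide) hi]
  · refine Or.inr ⟨0, h5, fun i hi => ?_⟩
    fin_cases i
    exacts [absurd (by decide) hi, absurd (by decide) hi, absurd (by decide) hi,
      h.e53.resolve_left h5, h.e54.resolve_left h5, absurd (by decide) hi,
      h.e56.resolve_left h5, h.e7, h.e58.resolve_left h5, h.e59.resolve_left h5]

/-- The exponents of the standard monomials of the cone over the reducible sextic surface. -/
structure NodeStd (d : Fin 10 →₀ ℕ) : Prop where
  support : NodeSupport d
  seg : d 2 = 0 ∨ d 3 = 0

/-- The equations of the cone over the reducible sextic surface, in terms of coordinates. -/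
structure NodePoint (v : Fin 10 → ℂ) : Prop where
  support : NodeSupport v
  seg : v 2 * v 3 = v 1 * v 4

variable {J : Ideal (CoordRing 9)}

/-- All equations are monomials except the one of the quadric, so the weights only have to put X₂X₃
above X₁X₄. -/
theorem NodeRel.exists_rule (h : NodeRel J) {d : Fin 10 →₀ ℕ} (hd : ¬ NodeStd d) :
    ∃ s ≤ d, ∃ r ∈ restrictSupport ℂ {e : Fin 10 →₀ ℕ | e.degree = s.degree ∧
      Finsupp.weight ![1, 1, 2, 2, 1, 1, 1, 1, 1, 1] e
        < Finsupp.weight ![1, 1, 2, 2, 1, 1, 1, 1, 1, 1] s}, monomial s 1 - r ∈ J := by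
  replace hd : ¬ (NodeSupport d ∧ (d 2 = 0 ∨ d 3 = 0)) := fun h => hd ⟨h.1, h.2⟩
  rw [nodeSupport_iff] at hd
  simp only [not_and_or, not_or] at hd
  have h0 : ∀ {i j : Fin 10}, i ≠ j → X i * X j ∈ J → d i ≠ 0 ∧ d j ≠ 0 →
      ∃ s ≤ d, ∃ r ∈ restrictSupport ℂ {e : Fin 10 →₀ ℕ | e.degree = s.degree ∧
        Finsupp.weight ![1, 1, 2, 2, 1, 1, 1, 1, 1, 1] e
          < Finsupp.weight ![1, 1, 2, 2, 1, 1, 1, 1, 1, 1] s}, monomial s 1 - r ∈ J :=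
    fun hij hJ hd => exists_rule_pair hij hd.1 hd.2 0 (Submodule.zero_mem _) (by rwa [sub_zero])
  rcases hd with (hd | hd | hd | hd | hd | hd | hd | hd | hd | hd | hd | hd | hd | hd | hd) | hd
  · exact exists_rule_single hd 0 (Submodule.zero_mem _) (by simpa using h.e7)
  · exact h0 (by decide) h.e59 hd
  · exact h0 (by decide) h.e68 hd
  · exact h0 (by decide) h.e56 hd
  · exact h0 (by decide) h.e58 hd
  · exact h0 (by decide) h.e69 hd
  · exact h0 (by decide) h.e89 hd
  · exact h0 (by decide) h.e54 hd
  · exact h0 (by decide) h.e53 hd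
  · exact h0 (by decide) h.e92 hd
  · exact h0 (by decide) h.e91 hd
  · exact h0 (by decide) h.e64 hd
  · exact h0 (by decide) h.e62 hd
  · exact h0 (by decide) h.e83 hd
  · exact h0 (by decide) h.e81 hd
  · exact exists_rule_pair (by decide) hd.1 hd.2 _ (X_mul_X_mem_lowerTerms (by decide)) h.seg

theorem NodeRel.normalForm (h : NodeRel J) (d : Fin 10 →₀ ℕ) :
    ∃ g ∈ restrictSupport ℂ {e | e ∈ {d | NodeStd d} ∧ e.degree = d.degree},
      monomial d 1 - g ∈ J :=
  exists_normalForm _ _ _ (fun _ hd => h.exists_rule hd) d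

theorem NodeRel.normalForm' (h : NodeRel J) (hX : X 0 ∈ J) (d : Fin 10 →₀ ℕ) :
    ∃ g ∈ restrictSupport ℂ {e | e ∈ {d | NodeStd d ∧ d 0 = 0} ∧ e.degree = d.degree},
      monomial d 1 - g ∈ J := by
  refine exists_normalForm _ ![1, 1, 2, 2, 1, 1, 1, 1, 1, 1] _ (fun d hd => ?_) d
  rw [Set.mem_ofPred_eq, not_and_or] at hd
  rcases hd with hd | hd
  · exact h.exists_rule hd
  · exact exists_rule_single hd 0 (Submodule.zero_mem _) (by simpa using hX)

/-- The parametrization of the cone over the quadric. -/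
def segreHom : CoordRing 9 →ₐ[ℂ] MvPolynomial (Fin 5) ℂ :=
  aeval ![X 4, X 0 * X 1, X 0 * X 2, X 3 * X 1, X 3 * X 2, 0, 0, 0, 0, 0]

theorem eval_segreHom (x : Fin 5 → ℂ) (f : CoordRing 9) : eval x (segreHom f) =
    eval ![x 4, x 0 * x 1, x 0 * x 2, x 3 * x 1, x 3 * x 2, 0, 0, 0, 0, 0] f := by
  rw [segreHom, eval_aeval_eq]
  congr 2
  ext i
  fin_cases i <;> simp

/-- The polynomials which vanish on the cone over the reducible sextic surface. -/
def NodeVanishing (g : CoordRing 9) : Prop :=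
  segreHom g = 0 ∧ ∀ κ, restrictHom (insert 0 (insert (nodeCorner κ) (nodeEdge κ))) g = 0

/-- Each standard monomial is detected on one component: with a corner coordinate, on the
corresponding plane; without one, on the quadric, where the Segre parametrization separates the
monomials free of X₂X₃. -/
theorem NodeVanishing.eq_zero {g : CoordRing 9} (hg : g ∈ restrictSupport ℂ {d | NodeStd d})
    (h : NodeVanishing g) : g = 0 := by
  ext d
  by_cases hd : NodeStd d
  · rcases hd.support.cases with hd' | ⟨κ, -, hκ⟩
    · refine coeff_eq_zero_of_monomialMap (B := {d | NodeStd d})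
        (A := {d | d 7 = 0 ∧ d 5 = 0 ∧ d 9 = 0 ∧ d 6 = 0 ∧ d 8 = 0})
        (fun d => Finsupp.equivFunOnFinite.symm ![d 1 + d 2, d 1 + d 3, d 2 + d 4, d 3 + d 4, d 0])
        (fun _ => 1) (fun _ _ => one_ne_zero) (ρ := segreHom) (fun d hd => ?_)
        (fun d hB hA => ?_) ?_ hg h.1 ⟨hd.support.e7, hd'⟩
      · obtain ⟨h7, h5, h9, h6, h8⟩ := hd
        rw [segreHom, aeval_monomial, Finsupp.prod_fintype _ _ (by simp), monomial_eq,
          Finsupp.prod_fintype _ _ (by simp)]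
        simp [Fin.prod_univ_succ, h7, h5, h6, h8, h9]
        ring
      · rw [segreHom, aeval_monomial, Finsupp.prod_fintype _ _ (by simp)]
        simp only [Set.mem_ofPred_eq, not_and_or] at hA
        have key : ∀ i : Fin 10, 5 ≤ i → d i ≠ 0 → (algebraMap ℂ (MvPolynomial (Fin 5) ℂ)) 1 *
            ∏ i, ![X 4, X 0 * X 1, X 0 * X 2, X 3 * X 1, X 3 * X 2, 0, 0, 0, 0, 0] i ^ d i = 0 := by
          intro i hi hdi
          rw [Finset.prod_eq_zero (Finset.mem_univ i), mul_zero]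
          fin_cases i <;> first | exact absurd hi (by decide) | exact zero_pow hdi
        rcases hA with hA | hA | hA | hA | hA <;> exact key _ (by decide) hA
      · rintro d ⟨⟨h7, h5, h9, h6, h8⟩, hd⟩ e ⟨⟨k7, k5, k9, k6, k8⟩, he⟩ hde
        have e0 := DFunLike.congr_fun hde 0
        have e1 := DFunLike.congr_fun hde 1
        have e2 := DFunLike.congr_fun hde 2
        have e3 := DFunLike.congr_fun hde 3
        have e4 := DFunLike.congr_fun hde 4
        simp at e0 e1 e2 e3 e4
        have hs := hd.seg
        have ks := he.seg
        clear hde hd he hg h hd'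
        ext i
        fin_cases i
        · exact e4
        · change d 1 = e 1; omega
        · change d 2 = e 2; omega
        · change d 3 = e 3; omega
        · change d 4 = e 4; omega
        exacts [h5.trans k5.symm, h6.trans k6.symm, h7.trans k7.symm, h8.trans k8.symm,
          h9.trans k9.symm]
    · exact coeff_eq_zero_of_restrictHom (h.2 κ) hκ
  · by_contra hne
    exact hd (hg (mem_support_iff.2 hne))

end

/-! ### Counting the standard monomials of the reducible sextic surface -/

section

/-- An index set for the standard monomials of degree `k` of the reducible sextic surface. -/
abbrev NodeIndex (k : ℕ) : Type :=
  (Fin (k + 1) × Fin (k + 1)) ⊕ (Fin 4 × Σ i : Fin k, Fin (i + 1))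

/-- The exponents of a monomial in the coordinates of a plane. -/
def planeExp (c p q : ℕ) : Fin 4 → Fin 10 → ℕ :=
  ![![0, p, q, 0, 0, c, 0, 0, 0, 0], ![0, 0, 0, p, q, 0, 0, 0, 0, c],
    ![0, p, 0, q, 0, 0, c, 0, 0, 0], ![0, 0, p, 0, q, 0, 0, 0, c, 0]]

/-- The standard monomials of degree `k` of the reducible sextic surface. -/
def nodeExp (k : ℕ) : NodeIndex k → (Fin 10 →₀ ℕ) := Sum.elim
  (fun x => Finsupp.equivFunOnFinite.symm ![0, min (x.1 : ℕ) x.2, x.1 - (x.2 : ℕ),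
    x.2 - (x.1 : ℕ), k - max (x.1 : ℕ) x.2, 0, 0, 0, 0, 0])
  (fun x => Finsupp.equivFunOnFinite.symm
    (planeExp (k - x.2.1) (x.2.1 - (x.2.2 : ℕ)) x.2.2 x.1))

theorem planeExp_nodeCorner (c p q : ℕ) (κ κ' : Fin 4) :
    planeExp c p q κ (nodeCorner κ') = if κ = κ' then c else 0 := by
  fin_cases κ <;> fin_cases κ' <;> rfl

theorem planeExp_edge (c p q : ℕ) (κ : Fin 4) : planeExp c p q κ (![2, 4, 3, 4] κ) = q := by
  fin_cases κ <;> rfl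

theorem nodeExp_injective (k : ℕ) : Function.Injective (nodeExp k) := by
  rintro (⟨⟨i, hi⟩, ⟨j, hj⟩⟩ | ⟨κ, ⟨i, hi⟩, ⟨j, hj⟩⟩) (⟨⟨i', hi'⟩, ⟨j', hj'⟩⟩ |
    ⟨κ', ⟨i', hi'⟩, ⟨j', hj'⟩⟩) h <;> have h := fun l => DFunLike.congr_fun h l
  · have h1 := h 1
    have h2 := h 2
    have h3 := h 3
    simp [nodeExp, planeExp] at h1 h2 h3 ⊢
    omega
  · have h5 := h 5
    have h6 := h 6
    have h8 := h 8
    have h9 := h 9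
    fin_cases κ' <;> simp [nodeExp, planeExp] at h5 h6 h8 h9 <;> omega
  · have h5 := h 5
    have h6 := h 6
    have h8 := h 8
    have h9 := h 9
    fin_cases κ <;> simp [nodeExp, planeExp] at h5 h6 h8 h9 <;> omega
  · have hκ : κ = κ' := by
      by_contra hne
      have h := h (nodeCorner κ)
      simp [nodeExp, planeExp_nodeCorner, Ne.symm hne] at h
      omega
    subst hκ
    have h1 := h (nodeCorner κ)
    have h2 := h (![2, 4, 3, 4] κ)
    simp [nodeExp, planeExp_nodeCorner, planeExp_edge] at h1 h2
    obtain rfl : i = i' := by omega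
    obtain rfl : j = j' := h2
    rfl

theorem range_nodeExp (k : ℕ) : Set.range (nodeExp k) =
    {e | e ∈ {d | NodeStd d ∧ d 0 = 0} ∧ e.degree = k} := by
  ext d
  constructor
  · rintro ⟨⟨⟨i, hi⟩, ⟨j, hj⟩⟩ | ⟨κ, ⟨i, hi⟩, ⟨j, hj⟩⟩, rfl⟩
    · refine ⟨⟨⟨(nodeSupport_iff _).2 ?_, ?_⟩, rfl⟩, ?_⟩
      · simp [nodeExp, planeExp]
      · simp [nodeExp, planeExp]; omega
      · simp [nodeExp, planeExp, Finsupp.degree_eq_sum, Fin.sum_univ_succ]; omega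
    · simp only at hj
      refine ⟨⟨⟨(nodeSupport_iff _).2 ?_, ?_⟩, ?_⟩, ?_⟩
      · fin_cases κ <;> simp [nodeExp, planeExp]
      · fin_cases κ <;> simp [nodeExp, planeExp]
      · fin_cases κ <;> simp [nodeExp, planeExp]
      · fin_cases κ <;> simp [nodeExp, planeExp, Finsupp.degree_eq_sum, Fin.sum_univ_succ] <;> omega
  · rintro ⟨⟨⟨hd, hseg⟩, h0⟩, hdeg⟩
    rw [Finsupp.degree_eq_sum] at hdeg
    rcases hd.cases with ⟨h5, h9, h6, h8⟩ | ⟨κ, hκ0, hκ⟩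
    · simp [Fin.sum_univ_succ, h0, hd.e7, h5, h6, h8, h9] at hdeg
      -- The index is a bidegree on the Segre quadric. As `d 2` or `d 3` is zero, `d 1` is the
      -- minimum of its two entries.
      refine ⟨Sum.inl ⟨⟨d 1 + d 2, by omega⟩, ⟨d 1 + d 3, by omega⟩⟩, ?_⟩
      ext l
      fin_cases l
      · exact h0.symm
      · simp [nodeExp, planeExp]; omega
      · simp [nodeExp, planeExp]; omega
      · simp [nodeExp, planeExp]; omega
      · simp [nodeExp, planeExp]; omega
      exacts [h5.symm, h6.symm, hd.e7.symm, h8.symm, h9.symm]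
    · fin_cases κ
      · have h (i : Fin 10) (hi : i ∉ ({0, 5, 1, 2} : Finset (Fin 10))) : d i = 0 := hκ i hi
        have h3 := h 3 (by decide)
        have h4 := h 4 (by decide)
        have h6 := h 6 (by decide)
        have h7 := h 7 (by decide)
        have h8 := h 8 (by decide)
        have h9 := h 9 (by decide)
        replace hκ0 : d 5 ≠ 0 := hκ0
        simp [Fin.sum_univ_succ, h0, h3, h4, h6, h7, h8, h9] at hdeg
        refine ⟨Sum.inr ⟨0, ⟨d 1 + d 2, by omega⟩, ⟨d 2, by simp⟩⟩, ?_⟩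
        ext l
        fin_cases l
        · exact h0.symm
        · simp [nodeExp, planeExp]
        · rfl
        · exact h3.symm
        · exact h4.symm
        · simp [nodeExp, planeExp]; omega
        exacts [h6.symm, h7.symm, h8.symm, h9.symm]
      · have h (i : Fin 10) (hi : i ∉ ({0, 9, 3, 4} : Finset (Fin 10))) : d i = 0 := hκ i hi
        have h1 := h 1 (by decide)
        have h2 := h 2 (by decide)
        have h5 := h 5 (by decide)
        have h6 := h 6 (by decide)
        have h7 := h 7 (by decide)
        have h8 := h 8 (by decide)
        replace hκ0 : d 9 ≠ 0 := hκ0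
        simp [Fin.sum_univ_succ, h0, h1, h2, h6, h7, h8, h5] at hdeg
        refine ⟨Sum.inr ⟨1, ⟨d 3 + d 4, by omega⟩, ⟨d 4, by simp⟩⟩, ?_⟩
        ext l
        fin_cases l
        · exact h0.symm
        · exact h1.symm
        · exact h2.symm
        · simp [nodeExp, planeExp]
        · rfl
        · exact h5.symm
        · exact h6.symm
        · exact h7.symm
        · exact h8.symm
        · simp [nodeExp, planeExp]; omega
      · have h (i : Fin 10) (hi : i ∉ ({0, 6, 1, 3} : Finset (Fin 10))) : d i = 0 := hκ i hi
        have h2 := h 2 (by decide)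
        have h4 := h 4 (by decide)
        have h5 := h 5 (by decide)
        have h7 := h 7 (by decide)
        have h8 := h 8 (by decide)
        have h9 := h 9 (by decide)
        replace hκ0 : d 6 ≠ 0 := hκ0
        simp [Fin.sum_univ_succ, h0, h2, h4, h5, h7, h8, h9] at hdeg
        refine ⟨Sum.inr ⟨2, ⟨d 1 + d 3, by omega⟩, ⟨d 3, by simp⟩⟩, ?_⟩
        ext l
        fin_cases l
        · exact h0.symm
        · simp [nodeExp, planeExp]
        · exact h2.symm
        · rfl
        · exact h4.symm
        · exact h5.symm
        · simp [nodeExp, planeExp]; omega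
        exacts [h7.symm, h8.symm, h9.symm]
      · have h (i : Fin 10) (hi : i ∉ ({0, 8, 2, 4} : Finset (Fin 10))) : d i = 0 := hκ i hi
        have h1 := h 1 (by decide)
        have h3 := h 3 (by decide)
        have h5 := h 5 (by decide)
        have h6 := h 6 (by decide)
        have h7 := h 7 (by decide)
        have h9 := h 9 (by decide)
        replace hκ0 : d 8 ≠ 0 := hκ0
        simp [Fin.sum_univ_succ, h0, h1, h3, h5, h6, h7, h9] at hdeg
        refine ⟨Sum.inr ⟨3, ⟨d 2 + d 4, by omega⟩, ⟨d 4, by simp⟩⟩, ?_⟩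
        ext l
        fin_cases l
        · exact h0.symm
        · exact h1.symm
        · simp [nodeExp, planeExp]
        · exact h3.symm
        · rfl
        · exact h5.symm
        · exact h6.symm
        · exact h7.symm
        · simp [nodeExp, planeExp]; omega
        · exact h9.symm

/-- There are (k+1)² monomials on the quadric and, in each of the four planes, k(k+1)/2 divisible by
the corner coordinate. Those not divisible by it are already counted on the edge, which lies in the
quadric. -/
theorem card_nodeIndex (k : ℕ) : (Fintype.card (NodeIndex k) : ℚ) = 3 * k ^ 2 + 4 * k + 1 := by
  have h (m : ℕ) : ∑ i ∈ Finset.range m, ((i : ℚ) + 1) = m * (m + 1) / 2 := by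
    induction m with
    | zero => simp
    | succ m ih => rw [Finset.sum_range_succ, ih]; push_cast; ring
  rw [Fintype.card_sum, Fintype.card_prod, Fintype.card_prod, Fintype.card_sigma]
  simp only [Fintype.card_fin]
  rw [Fin.sum_univ_eq_sum_range (fun i => i + 1)]
  push_cast
  rw [h]
  ring

variable {J : Ideal (CoordRing 9)}

theorem NodeRel.hasDimDegree (hJ : NodeRel J) (hX : X 0 ∈ J)
    (h : ∀ g ∈ restrictSupport ℂ {d | NodeStd d ∧ d 0 = 0}, g ∈ J → g = 0) :
    HasDimDegree J 2 6 := by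
  refine ⟨Polynomial.C 3 * Polynomial.X ^ 2 + Polynomial.C 4 * Polynomial.X
    + Polynomial.C 1, Filter.Eventually.of_forall fun k => ?_,
    Polynomial.natDegree_quadratic (by norm_num), ?_⟩
  · rw [hilbertFunction_eq_card (hJ.normalForm' hX) h (nodeExp k) (nodeExp_injective k)
      (range_nodeExp k), card_nodeIndex]
    simp
  · rw [Polynomial.leadingCoeff_quadratic (by norm_num)]
    norm_num [Nat.factorial]

/-- The vertex coordinate X₀ is free, so the count for the surface is summed over all degrees m ≤ k;
the leading coefficient 1 is 6/3!. -/
theorem NodeRel.hasDimDegree_cone (hJ : NodeRel J) (h : ∀ g ∈ J, NodeVanishing g) :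
    HasDimDegree J 3 6 := by
  refine ⟨Polynomial.C 1 * Polynomial.X ^ 3 + Polynomial.C (7 / 2) * Polynomial.X ^ 2
    + Polynomial.C (7 / 2) * Polynomial.X + Polynomial.C 1, Filter.Eventually.of_forall fun k => ?_,
    Polynomial.natDegree_cubic (by norm_num), ?_⟩
  · have h0 : ∀ m x, nodeExp m x 0 = 0 := fun m x =>
      ((range_nodeExp m).le ⟨x, rfl⟩).1.2
    rw [hilbertFunction_eq_card (T := Σ m : Fin (k + 1), NodeIndex m) hJ.normalForm
      (fun g hg hgI => (h g hgI).eq_zero hg)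
      (fun x => nodeExp x.1 x.2 + Finsupp.single 0 (k - x.1)) ?_ ?_]
    · rw [Fintype.card_sigma, Fin.sum_univ_eq_sum_range (fun m => Fintype.card (NodeIndex m))]
      push_cast
      simp only [card_nodeIndex]
      simp only [Polynomial.eval_add, Polynomial.eval_mul, Polynomial.eval_C, Polynomial.eval_pow,
        Polynomial.eval_X]
      clear h h0
      induction k with
      | zero => norm_num
      | succ k ih => rw [Finset.sum_range_succ, ih]; push_cast; ring
    · rintro ⟨⟨m, hm⟩, x⟩ ⟨⟨m', hm'⟩, x'⟩ hx
      have hx0 := DFunLike.congr_fun hx 0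
      simp only [Finsupp.add_apply, h0, Finsupp.single_eq_same] at hx0
      obtain rfl : m = m' := by omega
      obtain rfl : x = x' := nodeExp_injective m (add_right_cancel hx)
      rfl
    · ext d
      constructor
      · rintro ⟨x, rfl⟩
        obtain ⟨⟨⟨h1, h2⟩, h3⟩, h4⟩ := (range_nodeExp x.1).le ⟨x.2, rfl⟩
        have hne : ∀ i : Fin 10, i ≠ 0 →
            (nodeExp x.1 x.2 + Finsupp.single 0 (k - x.1) : Fin 10 →₀ ℕ) i = nodeExp x.1 x.2 i := fun i hi => by
          simp [hi]
        refine ⟨⟨?_, ?_⟩, ?_⟩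
        · rw [nodeSupport_iff] at h1 ⊢
          simpa [hne] using h1
        · simpa [hne] using h2
        · have := x.1.2
          rw [map_add, h4, Finsupp.degree_single]
          omega
      · rintro ⟨⟨h1, h2⟩, hdeg⟩
        have hd : d.erase 0 + Finsupp.single 0 (d 0) = d := Finsupp.erase_add_single 0 d
        have hne : ∀ i : Fin 10, i ≠ 0 → d.erase 0 i = d i := fun i hi => Finsupp.erase_ne hi
        have hdeg' := congrArg Finsupp.degree hd
        rw [map_add, Finsupp.degree_single, hdeg] at hdeg'
        obtain ⟨x, hx⟩ := (Set.ext_iff.1 (range_nodeExp (k - d 0)) (d.erase 0)).2 ⟨⟨⟨by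
          rw [nodeSupport_iff] at h1 ⊢
          simpa [hne] using h1, by simpa [hne] using h2⟩, Finsupp.erase_same⟩, by omega⟩
        refine ⟨⟨⟨k - d 0, by omega⟩, x⟩, ?_⟩
        conv_rhs => rw [← hd]
        simp only [hx]
        congr 2
        omega
  · rw [Polynomial.leadingCoeff_cubic (by norm_num)]
    norm_num [Nat.factorial]

end

/-! ### The cone over the reducible surface and the arcs at the sextuple point -/

section

theorem exists_segre {v₁ v₂ v₃ v₄ : ℂ} (h : v₂ * v₃ = v₁ * v₄) :
    ∃ x₀ x₁ x₂ x₃ : ℂ, x₀ * x₁ = v₁ ∧ x₀ * x₂ = v₂ ∧ x₃ * x₁ = v₃ ∧ x₃ * x₂ = v₄ := by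
  by_cases h1 : v₁ = 0
  · subst h1
    rw [zero_mul, mul_eq_zero] at h
    rcases h with rfl | rfl
    · exact ⟨0, v₃, v₄, 1, by simp⟩
    · exact ⟨v₂, 0, 1, v₄, by simp⟩
  · exact ⟨1, v₁, v₂, v₃ / v₁, by simp, by simp, by field_simp, by field_simp; linear_combination h⟩

theorem nodePoint_segre (x : Fin 5 → ℂ) :
    NodePoint ![x 4, x 0 * x 1, x 0 * x 2, x 3 * x 1, x 3 * x 2, 0, 0, 0, 0, 0] :=
  ⟨(nodeSupport_iff _).2 (by simp), by simp; ring⟩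

theorem nodePoint_of_mem_coordSpan (κ : Fin 4) {v : Fin 10 → ℂ}
    (hv : v ∈ coordSpan (n := 9) (insert 0 (insert (nodeCorner κ) (nodeEdge κ)))) :
    NodePoint v := by
  have h : ∀ i, i ∉ insert 0 (insert (nodeCorner κ) (nodeEdge κ)) → v i = 0 := hv
  clear hv
  fin_cases κ
  · have h3 := h 3 (by decide)
    have h4 := h 4 (by decide)
    have h6 := h 6 (by decide)
    have h7 := h 7 (by decide)
    have h8 := h 8 (by decide)
    have h9 := h 9 (by decide)
    exact ⟨(nodeSupport_iff _).2 (by simp [*]), by simp [*]⟩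
  · have h1 := h 1 (by decide)
    have h2 := h 2 (by decide)
    have h5 := h 5 (by decide)
    have h6 := h 6 (by decide)
    have h7 := h 7 (by decide)
    have h8 := h 8 (by decide)
    exact ⟨(nodeSupport_iff _).2 (by simp [*]), by simp [*]⟩
  · have h2 := h 2 (by decide)
    have h4 := h 4 (by decide)
    have h5 := h 5 (by decide)
    have h7 := h 7 (by decide)
    have h8 := h 8 (by decide)
    have h9 := h 9 (by decide)
    exact ⟨(nodeSupport_iff _).2 (by simp [*]), by simp [*]⟩
  · have h1 := h 1 (by decide)
    have h3 := h 3 (by decide)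
    have h5 := h 5 (by decide)
    have h6 := h 6 (by decide)
    have h7 := h 7 (by decide)
    have h9 := h 9 (by decide)
    exact ⟨(nodeSupport_iff _).2 (by simp [*]), by simp [*]⟩

theorem nodeVanishing_iff {g : CoordRing 9} :
    NodeVanishing g ↔ ∀ v, NodePoint v → eval v g = 0 := by
  constructor
  · rintro ⟨h1, h2⟩ v ⟨hv, hseg⟩
    rcases hv.cases with ⟨h5, h9, h6, h8⟩ | ⟨κ, -, hκ⟩
    · obtain ⟨x₀, x₁, x₂, x₃, e1, e2, e3, e4⟩ := exists_segre hseg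
      have := eval_segreHom ![x₀, x₁, x₂, x₃, v 0] g
      rw [h1, map_zero] at this
      rw [this]
      congr 2
      ext i
      fin_cases i
      exacts [rfl, e1.symm, e2.symm, e3.symm, e4.symm, h5, h6, hv.e7, h8, h9]
    · exact eval_eq_zero_of_restrictHom (h2 κ) hκ
  · refine fun h => ⟨MvPolynomial.funext fun x => ?_, fun κ => MvPolynomial.funext fun x => ?_⟩
    · rw [eval_segreHom, map_zero]
      exact h _ (nodePoint_segre x)
    · rw [eval_restrictHom, map_zero]
      exact h _ (nodePoint_of_mem_coordSpan κ fun i hi => if_neg hi)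

/-! ### The sextuple point -/

/-- The quadric with X₀X₇ has initial form X₇. Modulo X₇ the other quadrics become monomials, except
for the one of the square, and the initial forms of the cubics X₀XᵢXⱼ - … are the products of two
adjacent corners. -/
theorem nodeRel_tangentConeIdeal (a : Fin 14 → ℂ) :
    NodeRel (tangentConeIdeal (klm9 a) (coordPoint 0)) := by
  have ht : ∀ i : Fin 10, i ≠ 0 → ∀ c : ℂ,
      translate (Pi.single 0 c) (X i : CoordRing 9) = X i := fun i hi c => by
    simp [translate, hi]
  have hC : ∀ (s c : ℂ), translate (Pi.single 0 c) (C s : CoordRing 9) = C s :=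
    fun s c => algHom_C _ _
  have h2 : ∀ i j : Fin 10, (X i * X j : CoordRing 9).IsHomogeneous 2 := fun i j =>
    (isHomogeneous_X ℂ i).mul (isHomogeneous_X ℂ j)
  have hCm : ∀ (c : ℂ) {m : ℕ} {f : CoordRing 9}, f.IsHomogeneous m → (C c * f).IsHomogeneous m :=
    fun c m f hf => by simpa using (isHomogeneous_C (Fin 10) c).mul hf
  have e7 : X 7 ∈ tangentConeIdeal (klm9 a) (coordPoint 0) :=
    mem_tangentConeIdeal_of_mul_add (H := -(C (a 0) * (X 1 * X 2) + C (a 1) * (X 1 * X 3)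
      + C (a 2) * (X 1 * X 4) + C (a 3) * (X 2 * X 4) + C (a 4) * (X 3 * X 4)))
      (by rw [← sub_eq_add_neg]; exact klmRel_mem_homIdeal a 11) (isHomogeneous_X _ _)
      (((((hCm _ (h2 _ _)).add (hCm _ (h2 _ _))).add (hCm _ (h2 _ _))).add
        (hCm _ (h2 _ _))).add (hCm _ (h2 _ _))).neg (by simp [ht]) (by simp [ht, hC])
  have hbin : ∀ i j k l : Fin 10, i ≠ 0 → j ≠ 0 → k ≠ 0 → l ≠ 0 →
      X i * X j - X k * X l ∈ homIdeal (klm9 a) →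
      X i * X j - X k * X l ∈ tangentConeIdeal (klm9 a) (coordPoint 0) :=
    fun i j k l hi hj hk hl h => mem_tangentConeIdeal_of_isHomogeneous h ((h2 _ _).sub (h2 _ _))
      (by simp [ht, hi, hj, hk, hl])
  have hmon : ∀ i j k : Fin 10, i ≠ 0 → j ≠ 0 → k ≠ 0 →
      X i * X j - X 7 * X k ∈ homIdeal (klm9 a) →
      X i * X j ∈ tangentConeIdeal (klm9 a) (coordPoint 0) := fun i j k hi hj hk h => by
    have := Ideal.add_mem _ (hbin i j 7 k hi hj (by decide) hk h) (Ideal.mul_mem_left _ (X k) e7)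
    rwa [mul_comm (X k), sub_add_cancel] at this
  have hcub : ∀ i j k : Fin 10, i ≠ 0 → j ≠ 0 → k ≠ 0 →
      X 0 * X i * X j - X k * X k * klmForm a ∈ homIdeal (klm9 a) →
      X i * X j ∈ tangentConeIdeal (klm9 a) (coordPoint 0) := fun i j k hi hj hk h => by
    refine mem_tangentConeIdeal_of_mul_add (H := -(X k * X k * klmForm a))
      (by rwa [← mul_assoc, ← sub_eq_add_neg]) (h2 _ _) ?_ (by simp [ht, hi, hj])
      (by simp [ht, hC, klmForm, hk])
    exact ((h2 _ _).mul (((((hCm _ (isHomogeneous_X _ _)).add (hCm _ (isHomogeneous_X _ _))).add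
      (hCm _ (isHomogeneous_X _ _))).add (hCm _ (isHomogeneous_X _ _))).add
      (hCm _ (isHomogeneous_X _ _)))).neg
  have hr := klmRel_mem_homIdeal a
  exact
    { e7 := e7
      seg := hbin _ _ _ _ (by decide) (by decide) (by decide) (by decide) (hr 0)
      e59 := hmon _ _ _ (by decide) (by decide) (by decide) (hr 1)
      e68 := hmon _ _ _ (by decide) (by decide) (by decide) (hr 2)
      e54 := hmon _ _ _ (by decide) (by decide) (by decide) (hr 3)
      e53 := hmon _ _ _ (by decide) (by decide) (by decide) (hr 4)
      e92 := hmon _ _ _ (by decide) (by decide) (by decide) (hr 5)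
      e91 := hmon _ _ _ (by decide) (by decide) (by decide) (hr 6)
      e64 := hmon _ _ _ (by decide) (by decide) (by decide) (hr 7)
      e62 := hmon _ _ _ (by decide) (by decide) (by decide) (hr 8)
      e83 := hmon _ _ _ (by decide) (by decide) (by decide) (hr 9)
      e81 := hmon _ _ _ (by decide) (by decide) (by decide) (hr 10)
      e89 := hcub _ _ _ (by decide) (by decide) (by decide) (hr 12)
      e69 := hcub _ _ _ (by decide) (by decide) (by decide) (hr 13)
      e58 := hcub _ _ _ (by decide) (by decide) (by decide) (hr 14)
      e56 := hcub _ _ _ (by decide) (by decide) (by decide) (hr 15) }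

/-- With P of order e and μ = e²w, where w is the value of the homogenized G, the coordinate z₀ is
constantly 1, z₁, …, z₄ are e times any point of the quadric with nonzero coordinates, and the
corners are of order e². The arc exists only where G ≠ 0; multiplying by G handles the remaining
points. -/
theorem segreHom_eq_zero {a : Fin 14 → ℂ} (h3 : a 3 ≠ 0) {g : CoordRing 9}
    (hg : g ∈ tangentConeIdeal (klm9 a) (coordPoint 0)) : segreHom g = 0 := by
  set G : MvPolynomial (Fin 5) ℂ := C (a 0) * X 0 ^ 2 * X 1 * X 2 + C (a 1) * X 0 * X 3 * X 1 ^ 2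
    + C (a 2) * X 0 * X 3 * X 1 * X 2 + C (a 3) * X 0 * X 3 * X 2 ^ 2
    + C (a 4) * X 3 ^ 2 * X 1 * X 2 with hG
  have hG0 : G ≠ 0 := fun h => h3 (by simpa [hG] using congrArg (eval ![1, 0, 1, 1, 0]) h)
  refine (mul_eq_zero.1 (?_ : segreHom g * G = 0)).resolve_right hG0
  refine eq_zero_of_eval_torus fun x hx => ?_
  rw [map_mul, eval_segreHom]
  by_cases hw : eval x G = 0
  · rw [hw, mul_zero]
  obtain ⟨w, hwG⟩ : ∃ w, eval x G = w := ⟨_, rfl⟩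
  rw [hwG] at hw ⊢
  simp [hG] at hwG
  have h0 := hx 0
  have h1 := hx 1
  have h2 := hx 2
  have h3 := hx 3
  have := eval_eq_zero_of_arc
    (u := ![0, x 0 * x 1, x 0 * x 2, x 3 * x 1, x 3 * x 2, 0, 0, 0, 0, 0])
    (represents_coordPoint 0) (fun i => Polynomial.C (![0, 0, 0, 0, 0, w * (x 0 / x 3),
      w * (x 1 / x 2), w, w / (x 1 / x 2), w / (x 0 / x 3)] i)) (fun e he => ?_) hg (x 4)
  · refine mul_eq_zero_of_left (Eq.trans ?_ this) _
    congr 2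
    ext i
    fin_cases i <;> simp
  · convert klmPoint_mem_affineCone a (P := e * x 3 * x 2) (μ := e ^ 2 * w) (α := x 0 / x 3)
      (β := x 1 / x 2) (mul_ne_zero (mul_ne_zero he h3) h2) (mul_ne_zero (pow_ne_zero 2 he) hw)
      (div_ne_zero h0 h3) (div_ne_zero h1 h2) using 1
    ext i
    fin_cases i <;> simp [klmPoint] <;> field_simp
    rw [← hwG]
    ring

theorem eval_plane_eq_zero {Z : Set (PSpace 9)} {σ : Equiv.Perm (Fin 10)} {b : Fin 14 → ℂ}
    (hZ : ∀ P μ α β : ℂ, P ≠ 0 → μ ≠ 0 → α ≠ 0 → β ≠ 0 →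
      klmPoint b P μ α β ∘ σ.symm ∈ affineCone Z) (hb : b 0 ≠ 0) {g : CoordRing 9}
    (hg : g ∈ tangentConeIdeal Z (coordPoint (σ 0))) {x₁ x₂ x₅ : ℂ} (h1 : x₁ ≠ 0) (h2 : x₂ ≠ 0)
    (h5 : x₅ ≠ 0) (y : ℂ) : eval (![y, x₁, x₂, 0, 0, x₅, 0, 0, 0, 0] ∘ σ.symm) g = 0 := by
  obtain ⟨κ, rfl⟩ : ∃ κ, x₅ = κ * b 0 * x₁ * x₂ := ⟨x₅ / (b 0 * x₁ * x₂), by field_simp⟩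
  have hκ : κ ≠ 0 := by rintro rfl; simp at h5
  clear h5
  -- The first-order coefficient of z₀ along the arc. It points towards the vertex, so it is
  -- compensated by taking y - u₀ in place of y.
  obtain ⟨u₀, hu₀⟩ : ∃ u₀, u₀ = (b 1 * x₁ ^ 2 + b 2 * x₁ * x₂ + b 3 * x₂ ^ 2)
    / (κ * b 0 * x₁ * x₂) := ⟨_, rfl⟩
  have := eval_eq_zero_of_arc (u := ![u₀, x₁, x₂, 0, 0, κ * b 0 * x₁ * x₂, 0, 0, 0, 0] ∘ σ.symm)
    (represents_coordPoint (σ 0)) (![Polynomial.C (b 4 / (κ ^ 2 * b 0)), 0, 0,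
      Polynomial.C (x₁ / κ), Polynomial.C (x₂ / κ), 0, Polynomial.C (b 0 * x₁ ^ 2),
      Polynomial.C (b 0 * x₁ * x₂), Polynomial.C (b 0 * x₂ ^ 2),
      Polynomial.X * Polynomial.C (b 0 * x₁ * x₂ / κ)] ∘ σ.symm) (fun e he => ?_) hg (y - u₀)
  · refine Eq.trans ?_ this
    congr 2
    ext i
    obtain ⟨k, rfl⟩ := σ.surjective i
    simp only [Pi.add_apply, Pi.smul_apply, Function.comp_apply, Equiv.symm_apply_apply,
      Pi.single_apply, σ.injective.eq_iff, smul_eq_mul]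
    fin_cases k <;> simp
  -- Here α tends to infinity like 1/e. Then z₁, z₂, z₅ are of order e, the other coordinates
  -- besides z₀ are of order at least e², and the term b₀α²β of G makes z₀ tend to 1.
  · convert hZ (e ^ 2 * x₂ / κ) (e ^ 2 * b 0 * x₁ * x₂) (κ / e) (x₁ / x₂)
      (div_ne_zero (mul_ne_zero (pow_ne_zero 2 he) h2) hκ)
      (mul_ne_zero (mul_ne_zero (mul_ne_zero (pow_ne_zero 2 he) hb) h1) h2)
      (div_ne_zero hκ he) (div_ne_zero h1 h2) using 1
    ext i
    obtain ⟨k, rfl⟩ := σ.surjective i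
    simp only [Function.comp_apply, Equiv.symm_apply_apply, Pi.single_apply, σ.injective.eq_iff]
    fin_cases k <;> simp [klmPoint, hu₀] <;> field_simp
    ring

theorem restrictHom_plane_eq_zero {Z : Set (PSpace 9)} {σ : Equiv.Perm (Fin 10)} {b : Fin 14 → ℂ}
    (hZ : ∀ P μ α β : ℂ, P ≠ 0 → μ ≠ 0 → α ≠ 0 → β ≠ 0 →
      klmPoint b P μ α β ∘ σ.symm ∈ affineCone Z) (hb : b 0 ≠ 0) {S : Finset (Fin 10)}
    (hS : ∀ i, σ i ∈ S ↔ i ∈ ({0, 1, 2, 5} : Finset (Fin 10))) {g : CoordRing 9}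
    (hg : g ∈ tangentConeIdeal Z (coordPoint (σ 0))) : restrictHom (n := 9) S g = 0 := by
  refine eq_zero_of_eval_torus fun x hx => ?_
  rw [eval_restrictHom]
  have := eval_plane_eq_zero hZ hb hg (hx (σ 1)) (hx (σ 2)) (hx (σ 5)) (x (σ 0))
  refine Eq.trans ?_ this
  congr 2
  ext i
  obtain ⟨k, rfl⟩ := σ.surjective i
  simp only [hS, Function.comp_apply, Equiv.symm_apply_apply]
  fin_cases k <;> simp

/-- The arcs for one plane are carried to the other three by the symmetries of the parameters, with
a₄, a₁, a₃ in the role of a₀. -/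
theorem nodeVanishing_of_mem_tangentConeIdeal {a : Fin 14 → ℂ} (h0 : a 0 ≠ 0) (h1 : a 1 ≠ 0)
    (h3 : a 3 ≠ 0) (h4 : a 4 ≠ 0) {g : CoordRing 9}
    (hg : g ∈ tangentConeIdeal (klm9 a) (coordPoint 0)) : NodeVanishing g := by
  refine ⟨segreHom_eq_zero h3 hg, fun κ => ?_⟩
  fin_cases κ
  · refine restrictHom_plane_eq_zero (σ := 1) (b := a) (fun P μ α β hP hμ hα hβ => ?_) h0
      (by decide) hg
    exact klmPoint_mem_affineCone a hP hμ hα hβ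
  · refine restrictHom_plane_eq_zero
      (σ := permOf ![0, 3, 4, 1, 2, 9, 6, 7, 8, 5] (by decide))
      (b := a ∘ ![4, 1, 2, 3, 0, 5, 6, 7, 8, 9, 10, 11, 12, 13]) (fun P μ α β hP hμ hα hβ => ?_) h4
      (by decide) hg
    convert klmPoint_mem_affineCone a (mul_ne_zero hP hα) hμ (inv_ne_zero hα) hβ using 1
    ext i
    obtain ⟨k, rfl⟩ := Equiv.surjective (permOf ![0, 3, 4, 1, 2, 9, 6, 7, 8, 5] (by decide)) i
    simp only [Function.comp_apply, Equiv.symm_apply_apply]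
    fin_cases k <;> simp [klmPoint, permOf, hα] <;> field_simp <;> ring1
  · refine restrictHom_plane_eq_zero
      (σ := permOf ![0, 1, 3, 2, 4, 6, 5, 7, 9, 8] (by decide))
      (b := a ∘ ![1, 0, 2, 4, 3, 5, 6, 7, 8, 9, 10, 11, 12, 13]) (fun P μ α β hP hμ hα hβ => ?_) h1
      (by decide) hg
    convert klmPoint_mem_affineCone a hP hμ hβ hα using 1
    ext i
    obtain ⟨k, rfl⟩ := Equiv.surjective (permOf ![0, 1, 3, 2, 4, 6, 5, 7, 9, 8] (by decide)) i
    simp only [Function.comp_apply, Equiv.symm_apply_apply]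
    fin_cases k <;> simp [klmPoint, permOf, hP, hμ] <;> field_simp <;> ring1
  · refine restrictHom_plane_eq_zero
      (σ := permOf ![0, 2, 4, 1, 3, 8, 5, 7, 9, 6] (by decide))
      (b := a ∘ ![3, 0, 2, 4, 1, 5, 6, 7, 8, 9, 10, 11, 12, 13]) (fun P μ α β hP hμ hα hβ => ?_) h3
      (by decide) hg
    convert klmPoint_mem_affineCone a (mul_ne_zero hP hα) hμ hβ (inv_ne_zero hα) using 1
    ext i
    obtain ⟨k, rfl⟩ := Equiv.surjective (permOf ![0, 2, 4, 1, 3, 8, 5, 7, 9, 6] (by decide)) i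
    simp only [Function.comp_apply, Equiv.symm_apply_apply]
    fin_cases k <;> simp [klmPoint, permOf, hα] <;> field_simp <;> ring1

end

/-! ### The reducible sextic surface and the configuration of its components -/

section

/-- The planes of the reducible sextic surface. -/
def nodePlane (κ : Fin 4) : Set (PSpace 9) :=
  linearSubspace (coordSpan (n := 9) (insert (nodeCorner κ) (nodeEdge κ)))

/-- The quadric of the reducible sextic surface. -/
def nodeQuadric : Set (PSpace 9) :=
  {p | p ∈ linearSubspace (coordSpan (n := 9) {1, 2, 3, 4}) ∧
    ∀ v ∈ p.submodule, v 2 * v 3 = v 1 * v 4}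

/-- The reducible sextic surface. -/
def nodeSurface : Set (PSpace 9) :=
  nodePlane 0 ∪ nodePlane 2 ∪ nodePlane 1 ∪ nodePlane 3 ∪ nodeQuadric

theorem mem_nodeQuadric_iff {p : PSpace 9} {v : Fin 10 → ℂ} (hv : Represents v p) :
    p ∈ nodeQuadric ↔ v ∈ coordSpan (n := 9) {1, 2, 3, 4} ∧ v 2 * v 3 = v 1 * v 4 := by
  rw [nodeQuadric, Set.mem_ofPred_eq, mem_linearSubspace_of_represents hv]
  refine and_congr_right fun _ => ⟨fun h => h v hv.mem, fun h w hw => ?_⟩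
  obtain ⟨c, rfl⟩ := hv.mem_iff.1 hw
  simp only [Pi.smul_apply, smul_eq_mul]
  linear_combination c ^ 2 * h

theorem mem_nodeSurface_iff {p : PSpace 9} {v : Fin 10 → ℂ} (hv : Represents v p) :
    p ∈ nodeSurface ↔ NodePoint v ∧ v 0 = 0 := by
  have hplane : ∀ κ, p ∈ nodePlane κ → NodePoint v ∧ v 0 = 0 := fun κ h => by
    have h := (mem_linearSubspace_of_represents hv).1 h
    refine ⟨nodePoint_of_mem_coordSpan κ (coordSpan_mono (Finset.subset_insert _ _) h), h 0 ?_⟩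
    fin_cases κ <;> decide
  constructor
  · rintro ((((h | h) | h) | h) | h)
    · exact hplane _ h
    · exact hplane _ h
    · exact hplane _ h
    · exact hplane _ h
    · obtain ⟨h, hs⟩ := (mem_nodeQuadric_iff hv).1 h
      have h0 := h 0 (by decide)
      have h5 := h 5 (by decide)
      have h6 := h 6 (by decide)
      have h7 := h 7 (by decide)
      have h8 := h 8 (by decide)
      have h9 := h 9 (by decide)
      exact ⟨⟨(nodeSupport_iff _).2 (by simp [*]), hs⟩, h0⟩
  · rintro ⟨⟨h, hs⟩, h0⟩
    rcases h.cases with ⟨h5, h9, h6, h8⟩ | ⟨κ, -, hκ⟩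
    · refine Or.inr ((mem_nodeQuadric_iff hv).2 ⟨fun i hi => ?_, hs⟩)
      fin_cases i
      exacts [h0, absurd (by decide) hi, absurd (by decide) hi, absurd (by decide) hi,
        absurd (by decide) hi, h5, h6, h.e7, h8, h9]
    · have : p ∈ nodePlane κ := (mem_linearSubspace_of_represents hv).2 fun i hi => by
        by_cases hi0 : i = 0
        · rwa [hi0]
        · exact hκ i (by simpa [hi0] using hi)
      revert this
      fin_cases κ
      · exact fun h => Or.inl (Or.inl (Or.inl (Or.inl h)))
      · exact fun h => Or.inl (Or.inl (Or.inr h))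
      · exact fun h => Or.inl (Or.inl (Or.inl (Or.inr h)))
      · exact fun h => Or.inl (Or.inr h)

theorem mem_affineCone_nodeSurface {v : Fin 10 → ℂ} :
    v ∈ affineCone nodeSurface ↔ NodePoint v ∧ v 0 = 0 := by
  constructor
  · rintro ⟨p, hp, hv⟩
    obtain ⟨c, rfl⟩ := mem_submodule_iff.1 hv
    obtain ⟨⟨h, hs⟩, h0⟩ := (mem_nodeSurface_iff (represents_rep p)).1 hp
    refine ⟨⟨?_, ?_⟩, by simp [h0]⟩
    · rw [nodeSupport_iff] at h ⊢
      rcases eq_or_ne c 0 with rfl | hc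
      · simp
      · simpa [hc] using h
    · simp only [Pi.smul_apply, smul_eq_mul]
      linear_combination c ^ 2 * hs
  · intro h
    by_cases hv : v = 0
    · subst hv
      refine ⟨coordPoint 1, ?_, Submodule.zero_mem _⟩
      refine Or.inl (Or.inl (Or.inl (Or.inl ?_)))
      exact coordPoint_mem_linearSubspace.2 (by decide)
    · exact ⟨_, (mem_nodeSurface_iff (represents_mk hv)).2 h, (represents_mk hv).mem⟩

theorem nodePoint_add_single {v : Fin 10 → ℂ} (y : ℂ) :
    NodePoint (v + y • Pi.single 0 1) ↔ NodePoint v := by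
  have key : ∀ (v : Fin 10 → ℂ) (y : ℂ), NodePoint v → NodePoint (v + y • Pi.single 0 1) := by
    rintro v y ⟨h, hs⟩
    refine ⟨?_, by simpa using hs⟩
    rw [nodeSupport_iff] at h ⊢
    simpa using h
  refine ⟨fun h => ?_, key v y⟩
  have := key _ (-y) h
  rwa [add_assoc, ← add_smul, add_neg_cancel, zero_smul, add_zero] at this

theorem mem_homIdeal_coneOver_nodeSurface {f : CoordRing 9} :
    f ∈ homIdeal (coneOver (coordPoint 0) nodeSurface) ↔ NodeVanishing f := by
  rw [mem_homIdeal_coneOver, nodeVanishing_iff]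
  constructor
  · intro h v hv
    have := h (v + (-v 0) • Pi.single 0 1)
      (mem_affineCone_nodeSurface.2 ⟨(nodePoint_add_single _).2 hv, by simp⟩) (v 0)
    rwa [add_assoc, ← add_smul, neg_add_cancel, zero_smul, add_zero] at this
  · exact fun h v hv y =>
      h _ ((nodePoint_add_single y).2 (mem_affineCone_nodeSurface.1 hv).1)

theorem mem_homIdeal_nodeSurface {f : CoordRing 9} :
    f ∈ homIdeal nodeSurface ↔ ∀ v, NodePoint v → v 0 = 0 → eval v f = 0 := by
  rw [homIdeal, mem_vanishingIdeal_iff]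
  simp only [aeval_eq_eval]
  exact ⟨fun h v hv h0 => h v (mem_affineCone_nodeSurface.2 ⟨hv, h0⟩), fun h v hv =>
    h v (mem_affineCone_nodeSurface.1 hv).1 (mem_affineCone_nodeSurface.1 hv).2⟩

theorem eval_add_single {g : CoordRing 9} {B : Set (Fin 10 →₀ ℕ)} (hB : ∀ d ∈ B, d 0 = 0)
    (hg : g ∈ restrictSupport ℂ B) (v : Fin 10 → ℂ) (y : ℂ) :
    eval (v + y • Pi.single 0 1) g = eval v g := by
  rw [eval_eq', eval_eq']
  refine Finset.sum_congr rfl fun d hd => ?_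
  congr 1
  refine Finset.prod_congr rfl fun i _ => ?_
  by_cases hi : i = 0
  · rw [hi, hB d (hg hd), pow_zero, pow_zero]
  · simp [hi]

/-- A standard combination free of X₀ takes the same values on the surface and on the cone over it,
so vanishing on the surface already forces it to be zero. -/
theorem hasDimDegree_nodeSurface : HasDimDegree (homIdeal nodeSurface) 2 6 := by
  have hprod : ∀ i j : Fin 10, (∀ v : Fin 10 → ℂ, NodeSupport v → v i = 0 ∨ v j = 0) →
      X i * X j ∈ homIdeal nodeSurface := fun i j h =>
    mem_homIdeal_nodeSurface.2 fun v hv _ => by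
      rw [map_mul, eval_X, eval_X, mul_eq_zero]
      exact h v hv.support
  refine NodeRel.hasDimDegree ?_ (mem_homIdeal_nodeSurface.2 fun v _ h0 => by
    rw [eval_X, h0]) fun g hg hgI => ?_
  · exact
      { e7 := mem_homIdeal_nodeSurface.2 fun v hv _ => by rw [eval_X, hv.support.e7]
        seg := mem_homIdeal_nodeSurface.2 fun v hv _ => by simp [hv.seg]
        e59 := hprod _ _ fun v hv => hv.e59
        e68 := hprod _ _ fun v hv => hv.e68
        e56 := hprod _ _ fun v hv => hv.e56
        e58 := hprod _ _ fun v hv => hv.e58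
        e69 := hprod _ _ fun v hv => hv.e69
        e89 := hprod _ _ fun v hv => hv.e89
        e54 := hprod _ _ fun v hv => hv.e54
        e53 := hprod _ _ fun v hv => hv.e53
        e92 := hprod _ _ fun v hv => hv.e92
        e91 := hprod _ _ fun v hv => hv.e91
        e64 := hprod _ _ fun v hv => hv.e64
        e62 := hprod _ _ fun v hv => hv.e62
        e83 := hprod _ _ fun v hv => hv.e83
        e81 := hprod _ _ fun v hv => hv.e81 }
  · refine NodeVanishing.eq_zero (restrictSupport_mono _ (fun d hd => hd.1) hg)
      (nodeVanishing_iff.2 fun v hv => ?_)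
    rw [← eval_add_single (fun d hd => hd.2) hg v (-v 0)]
    exact mem_homIdeal_nodeSurface.1 hgI _ ((nodePoint_add_single _).2 hv) (by simp)

theorem tangentConeIdeal_klm9_node {a : Fin 14 → ℂ} (h0 : a 0 ≠ 0) (h1 : a 1 ≠ 0)
    (h3 : a 3 ≠ 0) (h4 : a 4 ≠ 0) : tangentConeIdeal (klm9 a) (coordPoint 0)
      = homIdeal (coneOver (coordPoint 0) nodeSurface) := by
  have hle : tangentConeIdeal (klm9 a) (coordPoint 0)
      ≤ homIdeal (coneOver (coordPoint 0) nodeSurface) := fun g hg =>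
    mem_homIdeal_coneOver_nodeSurface.2 (nodeVanishing_of_mem_tangentConeIdeal h0 h1 h3 h4 hg)
  exact le_antisymm hle (le_of_normalForm hle (nodeRel_tangentConeIdeal a).normalForm
    fun g hg hgI => (mem_homIdeal_coneOver_nodeSurface.1 hgI).eq_zero hg)

/-- The quadratic form which defines the quadric of the reducible sextic surface. -/
def nodeForm : QuadraticForm ℂ (coordSpan (n := 9) {1, 2, 3, 4}) :=
  QuadraticMap.linMulLin ((LinearMap.proj 2).domRestrict _) ((LinearMap.proj 3).domRestrict _)
    - QuadraticMap.linMulLin ((LinearMap.proj 1).domRestrict _) ((LinearMap.proj 4).domRestrict _)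

theorem nodeForm_apply (v : coordSpan (n := 9) {1, 2, 3, 4}) :
    nodeForm v = (v : Fin 10 → ℂ) 2 * (v : Fin 10 → ℂ) 3
      - (v : Fin 10 → ℂ) 1 * (v : Fin 10 → ℂ) 4 := rfl

theorem nodeForm_nondegenerate : nodeForm.Nondegenerate := by
  rw [QuadraticMap.nondegenerate_iff_radical_eq_bot, eq_bot_iff]
  intro v hv
  obtain ⟨h, hv⟩ := QuadraticMap.mem_radical_iff'.1 hv
  -- Pairing a vector of the radical with the j-th coordinate vector reads off, up to sign, the
  -- coordinate opposite to j.
  have key : ∀ (j : Fin 10) (hj : j ∈ ({1, 2, 3, 4} : Finset (Fin 10))),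
      nodeForm (v + ⟨Pi.single j 1, single_mem_coordSpan.2 hj⟩)
        = nodeForm ⟨Pi.single j 1, single_mem_coordSpan.2 hj⟩ := fun j hj => hv _
  have k1 := key 1 (by decide)
  have k2 := key 2 (by decide)
  have k3 := key 3 (by decide)
  have k4 := key 4 (by decide)
  rw [nodeForm_apply] at h
  simp [nodeForm_apply] at k1 k2 k3 k4
  refine Subtype.ext (funext fun i => ?_)
  by_cases hi : i ∈ ({1, 2, 3, 4} : Finset (Fin 10))
  · simp only [Finset.mem_insert, Finset.mem_singleton] at hi
    rcases hi with rfl | rfl | rfl | rfl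
    · change (v : Fin 10 → ℂ) 1 = 0
      linear_combination h - k4
    · change (v : Fin 10 → ℂ) 2 = 0
      linear_combination k3 - h
    · change (v : Fin 10 → ℂ) 3 = 0
      linear_combination k2 - h
    · change (v : Fin 10 → ℂ) 4 = 0
      linear_combination h - k1
  · exact v.2 i hi

theorem isQuadricSurface_nodeQuadric :
    IsQuadricSurface (coordSpan (n := 9) {1, 2, 3, 4}) nodeQuadric := by
  refine ⟨finrank_coordSpan _, nodeForm, nodeForm_nondegenerate, ?_⟩
  ext p
  simp only [nodeQuadric, Set.mem_ofPred_eq, nodeForm_apply, sub_eq_zero]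
  exact and_congr_right fun h => ⟨fun hp v hv => hp v hv, fun hp v hv => hp ⟨v, h hv⟩ hv⟩

theorem nodePlane_inter_nodeQuadric (κ : Fin 4) :
    nodePlane κ ∩ nodeQuadric = linearSubspace (coordSpan (n := 9) (nodeEdge κ)) := by
  have h1 : insert (nodeCorner κ) (nodeEdge κ) ∩ {1, 2, 3, 4} = nodeEdge κ := by
    revert κ; decide
  have h2 : ({1, 2, 3, 4} : Finset (Fin 10)) ∩ nodeEdge κ = nodeEdge κ := by
    revert κ; decide
  ext p
  rw [← h1, ← linearSubspace_coordSpan_inter]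
  constructor
  · exact fun h => ⟨h.1, h.2.1⟩
  · intro h
    refine ⟨h.1, (mem_nodeQuadric_iff (represents_rep p)).2 ⟨h.2 (rep_mem_submodule p), ?_⟩⟩
    have hp : p.rep ∈ coordSpan (n := 9) (nodeEdge κ) := by
      rw [linearSubspace_coordSpan_inter, h1] at h
      exact h (rep_mem_submodule p)
    have hmem : p.rep ∈ coordSpan (n := 9) (insert 0 (insert (nodeCorner κ) (nodeEdge κ))) :=
      coordSpan_mono ((Finset.subset_insert _ _).trans (Finset.subset_insert _ _)) hp
    exact (nodePoint_of_mem_coordSpan κ hmem).seg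

/-- The reducible sextic surface, and the configuration of its components. -/
theorem klm9_sextuple {a : Fin 14 → ℂ} (h0 : a 0 ≠ 0) (h1 : a 1 ≠ 0)
    (h3 : a 3 ≠ 0) (h4 : a 4 ≠ 0) : HasDimDegree (tangentConeIdeal (klm9 a) (coordPoint 0)) 3 6 ∧
      ∃ (L₇ L₃ : Submodule ℂ (Fin 10 → ℂ)) (M Q : Set (PSpace 9))
        (π π' l l' : Fin 2 → Set (PSpace 9)) (q : Fin 2 → Fin 2 → PSpace 9),
        Module.finrank ℂ L₇ = 8 ∧ coordPoint 0 ∉ linearSubspace L₇ ∧ M ⊆ linearSubspace L₇ ∧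
        tangentConeIdeal (klm9 a) (coordPoint 0) = homIdeal (coneOver (coordPoint 0) M) ∧
        HasDimDegree (homIdeal M) 2 6 ∧
        M = π 0 ∪ π 1 ∪ π' 0 ∪ π' 1 ∪ Q ∧
        (∀ i, IsLinear 2 (π i) ∧ IsLinear 2 (π' i)) ∧
        L₃ ≤ L₇ ∧ IsQuadricSurface L₃ Q ∧
        (∀ i, IsLinear 1 (l i) ∧ IsLinear 1 (l' i) ∧ π i ∩ Q = l i ∧ π' i ∩ Q = l' i) ∧
        (∀ i, l i ∩ l' i = ∅) ∧
        l 0 ∩ l 1 = {q 0 0} ∧ l 0 ∩ l' 1 = {q 0 1} ∧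
        l' 0 ∩ l 1 = {q 1 0} ∧ l' 0 ∩ l' 1 = {q 1 1} ∧
        Function.Injective (fun ij : Fin 2 × Fin 2 => q ij.1 ij.2) := by
  have hplane : ∀ κ, IsLinear 2 (nodePlane κ) := fun κ =>
    isLinear_coordSpan (by revert κ; decide)
  have hline : ∀ κ, IsLinear 1 (linearSubspace (coordSpan (n := 9) (nodeEdge κ))) := fun κ =>
    isLinear_coordSpan (by revert κ; decide)
  have hpoint : ∀ (κ κ' : Fin 4) (j : Fin 10), nodeEdge κ ∩ nodeEdge κ' = {j} →
      linearSubspace (coordSpan (n := 9) (nodeEdge κ))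
        ∩ linearSubspace (coordSpan (n := 9) (nodeEdge κ')) = {coordPoint (n := 9) j} :=
    fun κ κ' j h => by
      rw [linearSubspace_coordSpan_inter, h, linearSubspace_coordSpan_singleton]
  -- The planes at opposite corners, 5 and 9, respectively 6 and 8, form the pairs π, π'; their
  -- edges are opposite sides of the square 1, 2, 4, 3, and the four points are its vertices.
  refine ⟨(nodeRel_tangentConeIdeal a).hasDimDegree_cone fun g hg =>
      nodeVanishing_of_mem_tangentConeIdeal h0 h1 h3 h4 hg,
    coordSpan (n := 9) {1, 2, 3, 4, 5, 6, 8, 9}, coordSpan (n := 9) {1, 2, 3, 4}, nodeSurface,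
    nodeQuadric, fun i => nodePlane (![0, 2] i), fun i => nodePlane (![1, 3] i),
    fun i => linearSubspace (coordSpan (n := 9) (nodeEdge (![0, 2] i))),
    fun i => linearSubspace (coordSpan (n := 9) (nodeEdge (![1, 3] i))),
    fun i j => coordPoint (![![1, 2], ![3, 4]] i j), finrank_coordSpan _, ?_, ?_,
    tangentConeIdeal_klm9_node h0 h1 h3 h4, hasDimDegree_nodeSurface, rfl,
    fun i => ⟨hplane _, hplane _⟩, coordSpan_mono (by decide), isQuadricSurface_nodeQuadric,
    fun i => ⟨hline _, hline _, nodePlane_inter_nodeQuadric _, nodePlane_inter_nodeQuadric _⟩,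
    fun i => ?_, hpoint _ _ _ (by decide), hpoint _ _ _ (by decide), hpoint _ _ _ (by decide),
    hpoint _ _ _ (by decide), ?_⟩
  · rw [coordPoint_mem_linearSubspace]
    decide
  · intro p hp
    obtain ⟨h, h0⟩ := (mem_nodeSurface_iff (represents_rep p)).1 hp
    refine (mem_linearSubspace_of_represents (represents_rep p)).2 fun i hi => ?_
    fin_cases i <;> first | exact absurd (by decide) hi | skip
    · exact h0
    · exact h.support.e7
  · have : nodeEdge (![0, 2] i) ∩ nodeEdge (![1, 3] i) = ∅ := by
      revert i; decide
    rw [linearSubspace_coordSpan_inter, this, linearSubspace_coordSpan_empty]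
  · have : Function.Injective fun ij : Fin 2 × Fin 2 =>
        (![![1, 2], ![3, 4]] : Fin 2 → Fin 2 → Fin 10) ij.1 ij.2 := by decide
    exact coordPoint_injective.comp this

end

end EnriquesFano

end

open EnriquesFano in
theorem mainTheorem7 (a : Fin 14 → ℂ)
    (h0 : a 0 ≠ 0) (h1 : a 1 ≠ 0) (h3 : a 3 ≠ 0) (h4 : a 4 ≠ 0)
    (hdisc : (a 2 ^ 2 - 4 * a 0 * a 4 - 4 * a 1 * a 3) ^ 2 ≠ 64 * a 0 * a 1 * a 3 * a 4) :
    -- the fourteen monomials are a basis of the linear system of sextics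
    (LinearIndependent ℂ sextic ∧ Submodule.span ℂ (Set.range sextic) = sexticSystem) ∧
    -- `E_3` is an elliptic quartic curve in the Fano threefold, whose span is a `ℙ³`, and the
    -- threefold in `ℙ⁹` is the projection from that span
    (IsEllipticQuartic (curveE3 a) ∧
      Module.finrank ℂ (Submodule.span ℂ (affineCone (curveE3 a))) = 4 ∧
      curveE3 a = fano13 ∩ linearSubspace (Submodule.span ℂ (affineCone (curveE3 a))) ∧
      LinearMap.ker (projectionMap a) = Submodule.span ℂ (affineCone (curveE3 a)) ∧
      Function.Surjective (projectionMap a)) ∧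
    -- it is a threefold whose ideal is generated by quadrics and cubics
    (IsVarietyOfDim (klm9 a) 3 ∧
      homIdeal (klm9 a) = Ideal.span {f | f ∈ homIdeal (klm9 a) ∧
        (f.IsHomogeneous 2 ∨ f.IsHomogeneous 3)}) ∧
    -- it has exactly five singular points
    singularLocus (klm9 a) 3 =
      {coordPoint 5, coordPoint 9, coordPoint 6, coordPoint 8, coordPoint 0} ∧
    -- four are quadruple points whose tangent cone is a cone over a Veronese surface
    (∀ j : Fin 10, j = 5 ∨ j = 9 ∨ j = 6 ∨ j = 8 →
      HasMultiplicity (klm9 a) 3 (coordPoint j) 4 ∧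
      ∃ (L : Submodule ℂ (Fin 10 → ℂ)) (V : Set (PSpace 9)),
        IsVeroneseSurface L V ∧ coordPoint j ∉ linearSubspace L ∧
        tangentConeIdeal (klm9 a) (coordPoint j) = homIdeal (coneOver (coordPoint j) V)) ∧
    -- the fifth is a sextuple point whose tangent cone is a cone over a reducible sextic surface
    (HasMultiplicity (klm9 a) 3 (coordPoint 0) 6 ∧
      ∃ (L₇ L₃ : Submodule ℂ (Fin 10 → ℂ)) (M Q : Set (PSpace 9))
        (π π' l l' : Fin 2 → Set (PSpace 9)) (q : Fin 2 → Fin 2 → PSpace 9),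
        Module.finrank ℂ L₇ = 8 ∧ coordPoint 0 ∉ linearSubspace L₇ ∧ M ⊆ linearSubspace L₇ ∧
        tangentConeIdeal (klm9 a) (coordPoint 0) = homIdeal (coneOver (coordPoint 0) M) ∧
        HasDimDegree (homIdeal M) 2 6 ∧
        M = π 0 ∪ π 1 ∪ π' 0 ∪ π' 1 ∪ Q ∧
        (∀ i, IsLinear 2 (π i) ∧ IsLinear 2 (π' i)) ∧
        L₃ ≤ L₇ ∧ IsQuadricSurface L₃ Q ∧
        (∀ i, IsLinear 1 (l i) ∧ IsLinear 1 (l' i) ∧ π i ∩ Q = l i ∧ π' i ∩ Q = l' i) ∧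
        (∀ i, l i ∩ l' i = ∅) ∧
        l 0 ∩ l 1 = {q 0 0} ∧ l 0 ∩ l' 1 = {q 0 1} ∧
        l' 0 ∩ l 1 = {q 1 0} ∧ l' 0 ∩ l' 1 = {q 1 1} ∧
        Function.Injective (fun ij : Fin 2 × Fin 2 => q ij.1 ij.2)) := by
  have hb := klmGeneral_of h0 h1 h3 h4 hdisc
  have hsing := singularLocus_klm9 h0 h1 h3 h4 hdisc
  have hmem : ∀ j : Fin 10, coordPoint j ∈ ({coordPoint 5, coordPoint 9, coordPoint 6,
      coordPoint 8, coordPoint 0} : Set (PSpace 9)) → coordPoint j ∈ klm9 a := fun j hj => by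
    rw [← hsing] at hj
    exact hj.1
  exact ⟨⟨linearIndependent_sextic, span_sextic⟩,
    ⟨isEllipticQuartic_curveE3 hb, finrank_span_curveE3 h0 h1 h3 h4,
      curveE3_eq_inter h0 h1 h3 h4, (span_affineCone_curveE3 h0 h1 h3 h4).symm,
      surjective_projectionMap h0⟩,
    ⟨isVarietyOfDim_klm9 a, homIdeal_klm9_eq_span h0 h1 h3 h4⟩, hsing,
    fun j hj => ⟨⟨hmem j (by rcases hj with rfl | rfl | rfl | rfl <;> simp),
      (klm9_quadruple hb j hj).1⟩, (klm9_quadruple hb j hj).2⟩,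
    ⟨hmem 0 (by simp), (klm9_sextuple h0 h1 h3 h4).1⟩, (klm9_sextuple h0 h1 h3 h4).2⟩
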